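/- **Setting.** Let $G$ be a complex Lie group whose Lie algebra $\mathfrak g$ is semisimple, $\mathfrak h\subset\mathfrak g$ a Cartan subalgebra with root system $\mathbf R\subset\mathfrak h^*$, and $\langle\cdot,\cdot\rangle$ a non-degenerate symmetric invariant bilinear form on $\mathfrak g$ (if $G$ is not connected, assume that the form is $\mathrm{Ad}(G)$-invariant). Let $\Omega\in(S^2\mathfrak g)^{\mathfrak g}$ be the corresponding tensor, $\Omega=\sum_i e_i\otimes e^i$ for dual bases $(e_i),(e^i)$, and fix $E_\alpha\in\mathfrak g_\alpha$ with $\langle E_\alpha,E_{-\alpha}\rangle=1$ for all $\alpha\in\mathbf R$. Let $\mathbf U\subset\mathbf R$ satisfy $(\mathbf U+\mathbf U)\cap\mathbf R\subset\mathbf U$ and $-\mathbf U=\mathbf U$, so that $\mathfrak u=\mathfrak h\oplus\sum_{\alpha\in\mathbf U}\mathfrak g_\alpha$ is a reductive subalgebra, and let $U\subset G$ be the connected Lie subgroup with Lie algebra $\mathfrak u$; $G/U$ carries the complex structure for which $p:G\to G/U$ is a holomorphic submersion. Write $b^L$, $b^R$ for the left- and right-invariant tensor fields on $G$ with value $b$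 at the identity, and $$\mathrm{CYB}(r)=[r^{12},r^{13}]+[r^{12},r^{23}]+[r^{13},r^{23}].$$ Let $\rho\in\mathfrak g\otimes\mathfrak g$ satisfy $\rho+\rho^{21}=\Omega$, and put $\pi_\rho=\rho^L-\rho^R$, $\varphi=-\mathrm{CYB}(\rho)$. A *$(G,\pi_\rho,\varphi)$-homogeneous quasi-Poisson structure* on $X=G/U$ is a holomorphic bivector field $\pi$ on $X$ such that for all $g\in G$, $x\in X$ $$\pi(gx)=(l_g)_*\pi(x)+(\rho_x)_*\pi_\rho(g),\qquad \tfrac12[\pi,\pi]=\varphi_X,$$ where $l_g(x)=\rho_x(g)=gx$, $\varphi_X(x)=(\rho_x)_*\varphi$, and the Schouten bracket is normalized by $\tfrac12[\pi,\pi](df,dg,dh)=\{f,\{g,h\}\}+\{g,\{h,f\}\}+\{h,\{f,g\}\}$ with $\{f,g\}=\pi(df,dg)$. For $b\in\mathfrak g\otimes\mathfrak g$ with $b+b^{21}=\Omega$ that is $\mathfrak u$-invariant, $\pi_b^\rho$ denotes the bivector field on $G/U$ with $\pi_b^\rho(p(g))=p_*\big(b^L(g)-\rho^R(g)\big)$ for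 all $g\in G$. Say that a function $\alpha\mapsto x_\alpha$, $\mathbf R\to\mathbb C$, is *of coth type* if there are a set of simple roots $\Pi\subset\mathbf R$, with corresponding set of positive roots $\mathbf R_+$, a subset $\Delta\subset\Pi$ such that $\mathbf N=(\mathrm{span}\,\Delta)\cap\mathbf R$ contains $\mathbf U$, and an element $h\in\mathfrak h$ with $\alpha(h)\in\pi i\mathbb Z$ for $\alpha\in\mathbf U$ and $\alpha(h)\notin\pi i\mathbb Z$ for $\alpha\in\mathbf N\setminus\mathbf U$, such that $$x_\alpha=\begin{cases}0,&\alpha\in\mathbf U,\\ \tfrac12\coth\alpha(h),&\alpha\in\mathbf N\setminus\mathbf U,\\ \pm\tfrac12,&\alpha\in\pm\mathbf R_+\setminus\mathbf N.\end{cases}$$ **Theorem.** 1. A function $\alpha\mapsto x_\alpha$ on $\mathbf R$ is of coth type if and only if it satisfies: (a) $x_\alpha=0$ for $\alpha\in\mathbf U$; (b) $x_{-\alpha}=-x_\alpha$ for $\alpha\in\mathbf R$; (c) $x_\alpha+x_\beta=0$ whenever $\alpha,\beta\in\mathbf R\setminus\mathbf U$, $\gamma\in\mathbf U$, $\alpha+\beta+\gamma=0$;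 (d) $x_\alpha x_\beta+x_\beta x_\gamma+x_\gamma x_\alpha=-\tfrac14$ whenever $\alpha,\beta,\gamma\in\mathbf R\setminus\mathbf U$, $\alpha+\beta+\gamma=0$. 2. Every $(G,\pi_\rho,\varphi)$-homogeneous quasi-Poisson structure on $G/U$ equals $\pi^\rho_{x+\Omega/2}$ with $x=\sum_{\alpha\in\mathbf R}x_\alpha E_\alpha\otimes E_{-\alpha}$ for some function $\alpha\mapsto x_\alpha$ of coth type. 3. Conversely, for every function $\alpha\mapsto x_\alpha$ of coth type, with $x=\sum_{\alpha\in\mathbf R}x_\alpha E_\alpha\otimes E_{-\alpha}$, the bivector field $\pi^\rho_{x+\Omega/2}$ is well defined and is a $(G,\pi_\rho,\varphi)$-homogeneous quasi-Poisson structure on $G/U$. -/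

import Mathlib

open scoped Manifold ContDiff TensorProduct

noncomputable section

namespace QuasiPoisson

/-! ### Tensors over a Lie algebra -/

section Tensors

/-- Evaluation of a 2-tensor on a pair of covectors: `(a ⊗ b)(α, β) = α a * β b`. -/
def eval₂ {V : Type*} [AddCommGroup V] [Module ℂ V] (α β : V →ₗ[ℂ] ℂ) : V ⊗[ℂ] V →ₗ[ℂ] ℂ :=
  LinearMap.mul' ℂ ℂ ∘ₗ TensorProduct.map α β

/-- Evaluation of a 3-tensor on a triple of covectors:
`(a ⊗ b ⊗ c)(α, β, γ) = α a * (β b * γ c)`. -/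
def eval₃ {V : Type*} [AddCommGroup V] [Module ℂ V] (α β γ : V →ₗ[ℂ] ℂ) :
    V ⊗[ℂ] (V ⊗[ℂ] V) →ₗ[ℂ] ℂ :=
  LinearMap.mul' ℂ ℂ ∘ₗ TensorProduct.map α (eval₂ β γ)

theorem eval₂_tmul {V : Type*} [AddCommGroup V] [Module ℂ V] (α β : V →ₗ[ℂ] ℂ) (a b : V) :
    eval₂ α β (a ⊗ₜ[ℂ] b) = α a * β b := by
  simp [eval₂]

theorem eval₃_tmul {V : Type*} [AddCommGroup V] [Module ℂ V] (α β γ : V →ₗ[ℂ] ℂ) (a b c : V) :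
    eval₃ α β γ (a ⊗ₜ[ℂ] (b ⊗ₜ[ℂ] c)) = α a * (β b * γ c) := by
  simp [eval₃, eval₂]

variable {𝔤 : Type*} [LieRing 𝔤] [LieAlgebra ℂ 𝔤]

/-- The bracket as a linear map `𝔤 ⊗ 𝔤 → 𝔤`, `a ⊗ b ↦ ⁅a, b⁆`. -/
def bracketMap (𝔤 : Type*) [LieRing 𝔤] [LieAlgebra ℂ 𝔤] : 𝔤 ⊗[ℂ] 𝔤 →ₗ[ℂ] 𝔤 :=
  TensorProduct.lift (LieModule.toEnd ℂ 𝔤 𝔤 : 𝔤 →ₗ[ℂ] Module.End ℂ 𝔤)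

/-- `[r¹², s¹³]`, as a linear function of `r ⊗ s`. -/
def br12_13 (𝔤 : Type*) [LieRing 𝔤] [LieAlgebra ℂ 𝔤] :
    (𝔤 ⊗[ℂ] 𝔤) ⊗[ℂ] (𝔤 ⊗[ℂ] 𝔤) →ₗ[ℂ] 𝔤 ⊗[ℂ] (𝔤 ⊗[ℂ] 𝔤) :=
  TensorProduct.map (bracketMap 𝔤) LinearMap.id ∘ₗ
    (TensorProduct.tensorTensorTensorComm ℂ 𝔤 𝔤 𝔤 𝔤).toLinearMap

/-- `[r¹², s²³]`, as a linear function of `r ⊗ s`. -/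
def br12_23 (𝔤 : Type*) [LieRing 𝔤] [LieAlgebra ℂ 𝔤] :
    (𝔤 ⊗[ℂ] 𝔤) ⊗[ℂ] (𝔤 ⊗[ℂ] 𝔤) →ₗ[ℂ] 𝔤 ⊗[ℂ] (𝔤 ⊗[ℂ] 𝔤) :=
  TensorProduct.map LinearMap.id
      (TensorProduct.map (bracketMap 𝔤) LinearMap.id ∘ₗ
        (TensorProduct.assoc ℂ 𝔤 𝔤 𝔤).symm.toLinearMap) ∘ₗ
    (TensorProduct.assoc ℂ 𝔤 𝔤 (𝔤 ⊗[ℂ] 𝔤)).toLinearMap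

/-- `[r¹³, s²³]`, as a linear function of `r ⊗ s`. -/
def br13_23 (𝔤 : Type*) [LieRing 𝔤] [LieAlgebra ℂ 𝔤] :
    (𝔤 ⊗[ℂ] 𝔤) ⊗[ℂ] (𝔤 ⊗[ℂ] 𝔤) →ₗ[ℂ] 𝔤 ⊗[ℂ] (𝔤 ⊗[ℂ] 𝔤) :=
  (TensorProduct.assoc ℂ 𝔤 𝔤 𝔤).toLinearMap ∘ₗ
    TensorProduct.map LinearMap.id (bracketMap 𝔤) ∘ₗ
      (TensorProduct.tensorTensorTensorComm ℂ 𝔤 𝔤 𝔤 𝔤).toLinearMap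

theorem br12_13_tmul (a b c d : 𝔤) :
    br12_13 𝔤 ((a ⊗ₜ[ℂ] b) ⊗ₜ[ℂ] (c ⊗ₜ[ℂ] d)) = ⁅a, c⁆ ⊗ₜ[ℂ] (b ⊗ₜ[ℂ] d) := by
  simp [br12_13, bracketMap]

theorem br12_23_tmul (a b c d : 𝔤) :
    br12_23 𝔤 ((a ⊗ₜ[ℂ] b) ⊗ₜ[ℂ] (c ⊗ₜ[ℂ] d)) = a ⊗ₜ[ℂ] (⁅b, c⁆ ⊗ₜ[ℂ] d) := by
  simp [br12_23, bracketMap]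

theorem br13_23_tmul (a b c d : 𝔤) :
    br13_23 𝔤 ((a ⊗ₜ[ℂ] b) ⊗ₜ[ℂ] (c ⊗ₜ[ℂ] d)) = a ⊗ₜ[ℂ] (c ⊗ₜ[ℂ] ⁅b, d⁆) := by
  simp [br13_23, bracketMap]

/-- `CYB(r) = [r¹², r¹³] + [r¹², r²³] + [r¹³, r²³]`. -/
def CYB (r : 𝔤 ⊗[ℂ] 𝔤) : 𝔤 ⊗[ℂ] (𝔤 ⊗[ℂ] 𝔤) :=
  br12_13 𝔤 (r ⊗ₜ[ℂ] r) + br12_23 𝔤 (r ⊗ₜ[ℂ] r) + br13_23 𝔤 (r ⊗ₜ[ℂ] r)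

/-- The tensor `Ω = ∑ eᵢ ⊗ eⁱ` of a nondegenerate bilinear form, where `(eᵢ)` is a basis and `(eⁱ)`
the dual basis with respect to the form (`Ω` does not depend on the choice of `(eᵢ)`). -/
def formTensor {V : Type*} [AddCommGroup V] [Module ℂ V] [FiniteDimensional ℂ V]
    (B : LinearMap.BilinForm ℂ V) (hB : B.Nondegenerate) : V ⊗[ℂ] V :=
  ∑ i, Module.finBasis ℂ V i ⊗ₜ[ℂ] B.dualBasis hB (Module.finBasis ℂ V) i

end Tensors

/-! ### Root data -/

section Roots

open LieAlgebra LieAlgebra.IsKilling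

/-- The hyperbolic cotangent. -/
def coth (z : ℂ) : ℂ := Complex.cosh z / Complex.sinh z

variable {𝔤 : Type*} [LieRing 𝔤] [LieAlgebra ℂ 𝔤] [FiniteDimensional ℂ 𝔤]
  [LieAlgebra.IsSemisimple ℂ 𝔤] (H : LieSubalgebra ℂ 𝔤) [H.IsCartanSubalgebra]

/-- The set `R ⊆ 𝔥*` of roots of `(𝔤, 𝔥)`. -/
def roots : Set (Module.Dual ℂ H) := Set.range (rootSystem H).root

/-- `𝒰 ⊆ R` is reductive: `(𝒰 + 𝒰) ∩ R ⊆ 𝒰` and `-𝒰 = 𝒰`. -/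
structure IsReductiveSet (𝒰 : Set (Module.Dual ℂ H)) : Prop where
  subset_roots : 𝒰 ⊆ roots H
  add_mem : ∀ α ∈ 𝒰, ∀ β ∈ 𝒰, α + β ∈ roots H → α + β ∈ 𝒰
  neg_mem : ∀ α ∈ 𝒰, -α ∈ 𝒰

/-- `𝔲 = 𝔥 ⊕ ∑_{α ∈ 𝒰} 𝔤_α`. -/
def regularSubspace (𝒰 : Set (Module.Dual ℂ H)) : Submodule ℂ 𝔤 :=
  H.toSubmodule ⊔ ⨆ α ∈ 𝒰, (rootSpace H (α : H → ℂ)).toSubmodule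

/-- Root vectors `E_α ∈ 𝔤_α` with `⟨E_α, E_{-α}⟩ = 1` for all roots `α`
(the values of `e` outside `R` are irrelevant). -/
def IsNormalizedRootVectors (B : LinearMap.BilinForm ℂ 𝔤) (e : Module.Dual ℂ H → 𝔤) : Prop :=
  ∀ α ∈ roots H, e α ∈ rootSpace H (α : H → ℂ) ∧ B (e α) (e (-α)) = 1

/-- `∑_{α ∈ R} x_α E_α ⊗ E_{-α}`. -/
def rootTensor (e : Module.Dual ℂ H → 𝔤) (x : Module.Dual ℂ H → ℂ) : 𝔤 ⊗[ℂ] 𝔤 :=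
  ∑ i : H.root, x ((rootSystem H).root i) •
    (e ((rootSystem H).root i) ⊗ₜ[ℂ] e (-(rootSystem H).root i))

variable {H}

/-- The set `Π` of simple roots of a base. -/
def simpleRoots (b : (rootSystem H).Base) : Set (Module.Dual ℂ H) :=
  (rootSystem H).root '' b.support

/-- The set `R₊` of positive roots of a base. -/
def positiveRoots (b : (rootSystem H).Base) : Set (Module.Dual ℂ H) :=
  {α | α ∈ roots H ∧ α ∈ AddSubmonoid.closure (simpleRoots b)}

variable (H)

/-- The Levi subset `(span Δ) ∩ R`. -/
def leviSubset (Δ : Set (Module.Dual ℂ H)) : Set (Module.Dual ℂ H) :=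
  {α | α ∈ roots H ∧ α ∈ Submodule.span ℂ Δ}

/-- The four conditions on a function `α ↦ x_α` on the roots:
* `x_α = 0` for `α ∈ 𝒰`;
* `x_{-α} = -x_α` for `α ∈ R`;
* `x_α + x_β = 0` if `α, β ∈ R \ 𝒰`, `γ ∈ 𝒰`, `α + β + γ = 0`;
* `x_α x_β + x_β x_γ + x_γ x_α = -1/4` if `α, β, γ ∈ R \ 𝒰`, `α + β + γ = 0`. -/
structure SatisfiesEquations (𝒰 : Set (Module.Dual ℂ H)) (x : Module.Dual ℂ H → ℂ) : Prop where
  zero : ∀ α ∈ 𝒰, x α = 0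
  neg : ∀ α ∈ roots H, x (-α) = -x α
  add : ∀ α ∈ roots H \ 𝒰, ∀ β ∈ roots H \ 𝒰, ∀ γ ∈ 𝒰, α + β + γ = 0 → x α + x β = 0
  quad : ∀ α ∈ roots H \ 𝒰, ∀ β ∈ roots H \ 𝒰, ∀ γ ∈ roots H \ 𝒰, α + β + γ = 0 →
    x α * x β + x β * x γ + x γ * x α = -1 / 4

/-- `x` is the function built from some choice of a base `Π` (with positive roots `R₊`), of a
subset `Δ ⊆ Π` with `N = (span Δ) ∩ R ⊇ 𝒰`, and of `h ∈ 𝔥` such that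
`α(h) ∉ πiℤ` for `α ∈ N \ 𝒰` and `α(h) ∈ πiℤ` for `α ∈ 𝒰`:
`x_α = 0` on `𝒰`, `x_α = ½ coth α(h)` on `N \ 𝒰`, and `x_α = ±½` on `±R₊ \ N`. -/
def IsCothFunction (𝒰 : Set (Module.Dual ℂ H)) (x : Module.Dual ℂ H → ℂ) : Prop :=
  ∃ (b : (rootSystem H).Base) (Δ : Set (Module.Dual ℂ H)) (h : H),
    Δ ⊆ simpleRoots b ∧ 𝒰 ⊆ leviSubset H Δ ∧
    (∀ α ∈ leviSubset H Δ \ 𝒰, ¬ ∃ k : ℤ, α h = (Real.pi : ℂ) * Complex.I * k) ∧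
    (∀ α ∈ 𝒰, ∃ k : ℤ, α h = (Real.pi : ℂ) * Complex.I * k) ∧
    (∀ α ∈ 𝒰, x α = 0) ∧
    (∀ α ∈ leviSubset H Δ \ 𝒰, x α = 1 / 2 * coth (α h)) ∧
    (∀ α ∈ positiveRoots b \ leviSubset H Δ, x α = 1 / 2 ∧ x (-α) = -1 / 2)

end Roots

/-! ### Bivector fields -/

section Bivector

variable {F : Type*} [NormedAddCommGroup F] [NormedSpace ℂ F]
  {X : Type*} [TopologicalSpace X] [ChartedSpace F X]

/-- The differential at `x` of a function on a complex manifold, as a covector. -/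
def dAt (f : X → ℂ) (x : X) : TangentSpace 𝓘(ℂ, F) x →ₗ[ℂ] ℂ :=
  (mfderiv 𝓘(ℂ, F) 𝓘(ℂ, ℂ) f x).toLinearMap

/-- `f` is holomorphic in a neighbourhood of `x`. -/
def HolAt (F : Type*) [NormedAddCommGroup F] [NormedSpace ℂ F] {X : Type*} [TopologicalSpace X]
    [ChartedSpace F X] (f : X → ℂ) (x : X) : Prop :=
  ContMDiffAt 𝓘(ℂ, F) 𝓘(ℂ, ℂ) ω f x

/-- A holomorphic bivector field on a complex manifold: a skew-symmetric tensor
`π x ∈ T_xX ⊗ T_xX` at each point, depending holomorphically on `x` (i.e., the function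
`π(df, dg)` is holomorphic near each point near which `f` and `g` are holomorphic). -/
structure BivectorField (F : Type*) [NormedAddCommGroup F] [NormedSpace ℂ F] (X : Type*)
    [TopologicalSpace X] [ChartedSpace F X] where
  toFun : ∀ x : X, TangentSpace 𝓘(ℂ, F) x ⊗[ℂ] TangentSpace 𝓘(ℂ, F) x
  skew : ∀ x : X, TensorProduct.comm ℂ _ _ (toFun x) = -toFun x
  holomorphic : ∀ (x : X) (f g : X → ℂ), HolAt F f x → HolAt F g x →
    HolAt F (fun y => eval₂ (dAt f y) (dAt g y) (toFun y)) x

/-- The bracket `{f, g} = π(df, dg)`. -/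
def BivectorField.bracket (π : BivectorField F X) (f g : X → ℂ) : X → ℂ :=
  fun x => eval₂ (dAt f x) (dAt g x) (π.toFun x)

/-- `½[π, π] = ψ`, where `[·, ·]` is the Schouten bracket: `½[π, π]` is the trivector field given
on differentials by `½[π, π](df, dg, dh) = {f, {g, h}} + {g, {h, f}} + {h, {f, g}}`; locally, if
`π = ½ ∑ πⁱʲ ∂ᵢ ∧ ∂ⱼ` then `½[π, π]ⁱʲᵏ = ∑ₗ (πⁱˡ ∂ₗ πʲᵏ + πʲˡ ∂ₗ πᵏⁱ + πᵏˡ ∂ₗ πⁱʲ)`. -/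
def HalfSchoutenSquareEq (π : BivectorField F X)
    (ψ : ∀ x : X, TangentSpace 𝓘(ℂ, F) x ⊗[ℂ]
      (TangentSpace 𝓘(ℂ, F) x ⊗[ℂ] TangentSpace 𝓘(ℂ, F) x)) : Prop :=
  ∀ (x : X) (f g h : X → ℂ), HolAt F f x → HolAt F g x → HolAt F h x →
    π.bracket f (π.bracket g h) x + π.bracket g (π.bracket h f) x
        + π.bracket h (π.bracket f g) x =
      eval₃ (dAt f x) (dAt g x) (dAt h x) (ψ x)

end Bivector

/-! ### Lie groups and homogeneous spaces -/

section Groups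

variable {E : Type*} [NormedAddCommGroup E] [NormedSpace ℂ E]
  {G : Type*} [Group G] [TopologicalSpace G] [ChartedSpace E G]

instance [FiniteDimensional ℂ E] : FiniteDimensional ℂ (GroupLieAlgebra 𝓘(ℂ, E) G) :=
  inferInstanceAs (FiniteDimensional ℂ E)

/-- The differential at `1` of left translation, `𝔤 → T_gG`. -/
def dLeft (g : G) : GroupLieAlgebra 𝓘(ℂ, E) G →ₗ[ℂ] TangentSpace 𝓘(ℂ, E) g :=
  (mfderiv 𝓘(ℂ, E) 𝓘(ℂ, E) (fun a : G => g * a) 1).toLinearMap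

/-- The differential at `1` of right translation, `𝔤 → T_gG`. -/
def dRight (g : G) : GroupLieAlgebra 𝓘(ℂ, E) G →ₗ[ℂ] TangentSpace 𝓘(ℂ, E) g :=
  (mfderiv 𝓘(ℂ, E) 𝓘(ℂ, E) (fun a : G => a * g) 1).toLinearMap

/-- The adjoint action `Ad_g` of `G` on `𝔤`. -/
def Ad (g : G) : GroupLieAlgebra 𝓘(ℂ, E) G →ₗ[ℂ] GroupLieAlgebra 𝓘(ℂ, E) G :=
  (mfderiv 𝓘(ℂ, E) 𝓘(ℂ, E) (fun a : G => g * a * g⁻¹) 1).toLinearMap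

/-- The tensor field `b^L - ρ^R` on `G`, where `b^L` is the left-invariant and `ρ^R` the
right-invariant tensor field with value `b`, resp. `ρ`, at `1`. -/
def leftSubRight (b ρ : GroupLieAlgebra 𝓘(ℂ, E) G ⊗[ℂ] GroupLieAlgebra 𝓘(ℂ, E) G) (g : G) :
    TangentSpace 𝓘(ℂ, E) g ⊗[ℂ] TangentSpace 𝓘(ℂ, E) g :=
  TensorProduct.map (dLeft g) (dLeft g) b - TensorProduct.map (dRight g) (dRight g) ρ

/-- `U` is connected and its Lie algebra is `𝔲`: the vectors of `𝔲` are exactly the velocities at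
`z = 0` of the holomorphic curves `c` in `G` with `c(0) = 1` that run in `U`.
(This is used for subgroups `U` such that `G/U` is a complex manifold and `p : G → G/U` is a
submersion. Such a `U` is the fibre `p⁻¹(p(1))`, hence a closed complex Lie subgroup, and the
velocities above form its tangent space at `1`.) -/
structure IsConnectedWithLieAlgebra (U : Subgroup G)
    (𝔲 : Submodule ℂ (GroupLieAlgebra 𝓘(ℂ, E) G)) : Prop where
  connected : IsConnected (U : Set G)
  mem_iff : ∀ v : GroupLieAlgebra 𝓘(ℂ, E) G, v ∈ 𝔲 ↔
    ∃ c : ℂ → G, ContMDiffAt 𝓘(ℂ, ℂ) 𝓘(ℂ, E) ω c 0 ∧ c 0 = 1 ∧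
      (∀ᶠ z in nhds (0 : ℂ), c z ∈ U) ∧ mfderiv 𝓘(ℂ, ℂ) 𝓘(ℂ, E) c 0 (1 : ℂ) = v

variable {F : Type*} [NormedAddCommGroup F] [NormedSpace ℂ F]

section Action

variable {X : Type*} [TopologicalSpace X] [ChartedSpace F X] [MulAction G X]

/-- The differential at `x` of `l_g : X → X`, `x ↦ g • x`. -/
def dAct (g : G) (x : X) : TangentSpace 𝓘(ℂ, F) x →ₗ[ℂ] TangentSpace 𝓘(ℂ, F) (g • x) :=
  (mfderiv 𝓘(ℂ, F) 𝓘(ℂ, F) (fun y : X => g • y) x).toLinearMap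

/-- The differential at `g` of `ρ_x : G → X`, `g ↦ g • x`. -/
def dOrbit (g : G) (x : X) : TangentSpace 𝓘(ℂ, E) g →ₗ[ℂ] TangentSpace 𝓘(ℂ, F) (g • x) :=
  (mfderiv 𝓘(ℂ, E) 𝓘(ℂ, F) (fun a : G => a • x) g).toLinearMap

/-- The infinitesimal action `𝔤 → T_xX`: the differential at `1` of `ρ_x : G → X`. -/
def dOrbitOne (x : X) : GroupLieAlgebra 𝓘(ℂ, E) G →ₗ[ℂ] TangentSpace 𝓘(ℂ, F) x :=
  (mfderiv 𝓘(ℂ, E) 𝓘(ℂ, F) (fun a : G => a • x) 1).toLinearMap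

/-- The trivector field `φ_X` on a `G`-space `X` induced by `φ`: `φ_X(x) = (ρ_x)_* φ`. -/
def inducedTrivector (φ : GroupLieAlgebra 𝓘(ℂ, E) G ⊗[ℂ]
      (GroupLieAlgebra 𝓘(ℂ, E) G ⊗[ℂ] GroupLieAlgebra 𝓘(ℂ, E) G)) (x : X) :
    TangentSpace 𝓘(ℂ, F) x ⊗[ℂ] (TangentSpace 𝓘(ℂ, F) x ⊗[ℂ] TangentSpace 𝓘(ℂ, F) x) :=
  TensorProduct.map (dOrbitOne x) (TensorProduct.map (dOrbitOne x) (dOrbitOne x)) φ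

/-- `(X, π)` is a quasi-Poisson `(G, π_G, φ)`-space:
`π(g x) = (l_g)_* π(x) + (ρ_x)_* π_G(g)` and `½[π, π] = φ_X`. -/
structure IsQuasiPoissonSpace
    (πG : ∀ g : G, TangentSpace 𝓘(ℂ, E) g ⊗[ℂ] TangentSpace 𝓘(ℂ, E) g)
    (φ : GroupLieAlgebra 𝓘(ℂ, E) G ⊗[ℂ]
      (GroupLieAlgebra 𝓘(ℂ, E) G ⊗[ℂ] GroupLieAlgebra 𝓘(ℂ, E) G))
    (π : BivectorField F X) : Prop where
  multiplicative : ∀ (g : G) (x : X), π.toFun (g • x) =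
    TensorProduct.map (dAct g x) (dAct g x) (π.toFun x) +
      TensorProduct.map (dOrbit g x) (dOrbit g x) (πG g)
  schouten : HalfSchoutenSquareEq π (inducedTrivector φ)

end Action

section Quotient

variable (U : Subgroup G) [ChartedSpace F (G ⧸ U)]

/-- The differential at `g` of the projection `p : G → G/U`. -/
def dProj (g : G) :
    TangentSpace 𝓘(ℂ, E) g →ₗ[ℂ] TangentSpace 𝓘(ℂ, F) (QuotientGroup.mk g : G ⧸ U) :=
  (mfderiv 𝓘(ℂ, E) 𝓘(ℂ, F) (QuotientGroup.mk : G → G ⧸ U) g).toLinearMap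

/-- `π = π_b^ρ`: the bivector field on `G/U` with `π(p(g)) = p_*(b^L(g) - ρ^R(g))` for all `g`. -/
def IsPi (ρ b : GroupLieAlgebra 𝓘(ℂ, E) G ⊗[ℂ] GroupLieAlgebra 𝓘(ℂ, E) G)
    (π : BivectorField F (G ⧸ U)) : Prop :=
  ∀ g : G, π.toFun (QuotientGroup.mk g) =
    TensorProduct.map (dProj U g) (dProj U g) (leftSubRight b ρ g)

end Quotient

end Groups

end QuasiPoisson

end

open scoped Manifold ContDiff TensorProduct

set_option linter.unusedSectionVars false

noncomputable section

/-! Part 1 is combinatorics of root systems. If x solves the equations, the roots with x_α ≠ -1/2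
form a parabolic set, so they contain the positive roots of some base
(`exists_base_forall_mem_of_parabolic`). Let Δ consist of the simple roots with x_α ≠ 1/2; its Levi
subset N is then exactly the set where x_α ≠ ±1/2. On N \ 𝒰 the substitution y_α = (2x_α + 1)/(2x_α
- 1), with y_α = 1 on 𝒰, turns the equations into y_{α+β} = y_α y_β
(`SatisfiesEquations.expValue_add`). Logarithms of y at the simple roots of Δ therefore determine h
with y_α = exp(2α(h)), which says x_α = ½ coth α(h) off 𝒰. Conversely, the addition theorem of coth
gives the quadratic equation inside N, and a grading that vanishes exactly on N settles the
relations that leave N.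

Parts 2 and 3 rest on testing tensors against functions. For functions pulled back from G/U, the
bracket of π_b^ρ is that of b^L - ρ^R on G. The covectors v ↦ v^L(p^*f) at 1 are exactly those that
vanish on 𝔲 (`leftCov_pull_mem_dualAnnihilator`, `exists_leftCov_pull_eq`). Each condition on π thus
becomes a condition on b modulo 𝔲: multiplicativity means π = π_b^ρ for some b; independence of the
representative means Ad(U)-invariance, equivalently 𝔲-invariance because U is connected;
skew-symmetry means b + b²¹ = Ω.

Left- and right-invariant fields commute, and the two families satisfy opposite commutation rules.
The Jacobiator of b^L - ρ^R is therefore CYB(b)^L - CYB(ρ)^R (`leftRightBracket_jacobiator`). The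
second term is φ_X, so the Schouten condition says that CYB(b) vanishes modulo 𝔲.

Finally, 𝔥-invariance forces b = x + Ω/2 modulo 𝔲. The annihilator of 𝔲 is spanned by the
functionals ⟨E_α, ·⟩ with α ∉ 𝒰. On them 𝔲-invariance reads (x_α + x_β)⟨E_α, [E_γ, E_β]⟩ = 0, and
the Yang–Baxter equation reads (x_αx_β + x_βx_γ + x_γx_α + ¼)⟨E_α, [E_β, E_γ]⟩ = 0. If the three
roots sum to zero the structure constants do not vanish (`form_lie_ne_zero`), and otherwise they do,
so these are precisely the equations of Part 1. -/

lemma RootPairing.root_reflectionPerm_self {ι R M N : Type*} [CommRing R] [AddCommGroup M]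
    [Module R M] [AddCommGroup N] [Module R N] (P : RootPairing ι R M N) (i : ι) :
    P.root (P.reflectionPerm i i) = -P.root i := by
  simp [RootPairing.root_reflectionPerm]

/-! ### Bases contained in parabolic subsets of a root system -/

namespace RootPairing.Base

variable {ι K M N : Type*} [Finite ι] [Field K] [CharZero K] [AddCommGroup M] [Module K M]
  [AddCommGroup N] [Module K N] {P : RootPairing ι K M N} [P.IsCrystallographic] [P.IsReduced] [P.IsRootSystem]

/-- The image of a base under the reflection in the root with index `j`. -/
def reflect (b : P.Base) (j : ι) : P.Base :=
  Base.mk' P (P.reflectionPerm j '' b.support)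
    (by
      refine LinearIndepOn.image_of_comp _ _ ?_
      have := b.linearIndepOn_root.map_injOn (P.reflection j).toLinearMap
        (P.reflection j).injective.injOn
      refine this.congr fun i _ => ?_
      simp [root_reflectionPerm])
    (by
      intro i
      have key : ∀ x ∈ AddSubmonoid.closure (P.root '' b.support), P.reflection j x ∈
          AddSubmonoid.closure (P.root '' (P.reflectionPerm j '' b.support)) := by
        intro x hx
        induction hx using AddSubmonoid.closure_induction with
        | mem x hx =>
          obtain ⟨k, hk, rfl⟩ := hx
          exact AddSubmonoid.subset_closure ⟨_, ⟨k, hk, rfl⟩, by simp [root_reflectionPerm]⟩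
        | zero => simp
        | add x y _ _ hx hy => rw [map_add]; exact add_mem hx hy
      have hi : P.root i = P.reflection j (P.root (P.reflectionPerm j i)) := by
        simp [root_reflectionPerm]
      rcases b.root_mem_or_neg_mem (P.reflectionPerm j i) with h | h
      · left; rw [hi]; exact key _ h
      · right; rw [hi, ← map_neg]; exact key _ h)

/-- The reflection carries the expansion of a root in the old base to the expansion of its image in
the new base, and the height is the sum of the coefficients. -/
lemma height_reflect (b : P.Base) (j i : ι) :
    (b.reflect j).height i = b.height (P.reflectionPerm j i) := by
  classical
  obtain ⟨f, -, -, hf⟩ := b.exists_root_eq_sum_int (P.reflectionPerm j i)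
  have hs : (b.reflect j).support = b.support.image (P.reflectionPerm j) := by
    ext; simp only [reflect, Base.mk']; simp
  have hg : P.root i =
      ∑ k ∈ (b.reflect j).support, f (P.reflectionPerm j k) • P.root k := by
    rw [hs, Finset.sum_image (P.reflectionPerm j).injective.injOn]
    have : P.root i = P.reflection j (P.root (P.reflectionPerm j i)) := by
      simp [root_reflectionPerm]
    rw [this, hf, map_sum]
    refine Finset.sum_congr rfl fun k _ => ?_
    simp [root_reflectionPerm]
  rw [height_eq_sum hf, height_eq_sum (f := fun k => f (P.reflectionPerm j k)) hg, hs,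
    Finset.sum_image (P.reflectionPerm j).injective.injOn]
  simp

/-- Every parabolic subset of a root system contains a base. -/
theorem exists_base_forall_mem_of_parabolic (Q : Set M)
    (hQ : ∀ i, P.root i ∈ Q ∨ -P.root i ∈ Q)
    (hadd : ∀ i j k, P.root k = P.root i + P.root j → P.root i ∈ Q → P.root j ∈ Q →
      P.root k ∈ Q) :
    ∃ b : P.Base, ∀ i, b.IsPos i → P.root i ∈ Q := by
  classical
  let _ := P.indexNeg
  let _ := Fintype.ofFinite ι
  -- The base is chosen to have as many positive roots in Q as possible. If a simple root j were not
  -- in Q, reflecting the base in j would increase this number.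
  let c : P.Base → ℕ := fun b => (Finset.univ.filter fun i => b.IsPos i ∧ P.root i ∈ Q).card
  have : Nonempty P.Base := P.nonempty_base
  obtain ⟨b, hb⟩ : ∃ b, ∀ b', c b' ≤ c b := by
    have hbd : BddAbove (Set.range c) :=
      ⟨Fintype.card ι, by rintro _ ⟨b, rfl⟩; exact Finset.card_le_univ _⟩
    obtain ⟨b, hb⟩ := Nat.sSup_mem (Set.range_nonempty c) hbd
    exact ⟨b, fun b' => hb ▸ le_csSup hbd ⟨b', rfl⟩⟩
  have hsupp : ∀ j ∈ b.support, P.root j ∈ Q := by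
    intro j hj
    by_contra hjQ
    have hneg : P.root (-j) ∈ Q := by simpa using (hQ j).resolve_left hjQ
    -- The reflection in a simple root permutes the other positive roots and only replaces j by -j.
    -- Nothing in Q is lost, since j ∉ Q, and -j ∈ Q is gained.
    refine absurd (hb (b.reflect j)) (not_le.2 (Finset.card_lt_card ?_))
    rw [Finset.ssubset_iff_of_subset]
    · refine ⟨-j, ?_, ?_⟩
      · simp only [Finset.mem_filter, Finset.mem_univ, true_and]
        refine ⟨?_, hneg⟩
        rw [isPos_iff, height_reflect]
        have : P.reflectionPerm j (-j) = j := by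
          rw [P.indexNeg_neg]; simp
        rw [this]; exact b.isPos_of_mem_support hj
      · simp only [Finset.mem_filter, Finset.mem_univ, true_and, not_and]
        intro h
        exact absurd (b.isPos_of_mem_support hj) ((IsPos.neg_iff_not b j).1 h)
    · intro i hi
      simp only [Finset.mem_filter, Finset.mem_univ, true_and] at hi ⊢
      refine ⟨?_, hi.2⟩
      rw [isPos_iff, height_reflect]
      exact hi.1.reflectionPerm hj (by rintro rfl; exact hjQ hi.2)
  -- Every positive root is reached from a simple one by adding simple roots with all partial sums
  -- roots, so closure of Q under such sums suffices.
  exact ⟨b, fun i hi => hi.induction_on_add hsupp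
    fun i j k hk hi hj => hadd i j k hk hi (hsupp j hj)⟩

omit [P.IsReduced] [P.IsRootSystem] in
lemma IsPos.root_mem_closure {b : P.Base} {i : ι} (hi : b.IsPos i) :
    P.root i ∈ AddSubmonoid.closure (P.root '' b.support) := by
  refine hi.induction_on_add (p := fun i => P.root i ∈ AddSubmonoid.closure (P.root '' b.support))
    (fun j hj => AddSubmonoid.subset_closure ⟨j, hj, rfl⟩) ?_
  intro i j k hk hi hj
  rw [hk]
  exact add_mem hi (AddSubmonoid.subset_closure ⟨j, hj, rfl⟩)

omit [P.IsCrystallographic] [P.IsReduced] [Finite ι] in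
/-- A functional which is `0` on a given set of simple roots and `1` on the others. -/
lemma exists_dual_grading (b : P.Base) (Δ : Set M) :
    ∃ f : Module.Dual K M, (∀ i ∈ b.support, P.root i ∈ Δ → f (P.root i) = 0) ∧
      (∀ i ∈ b.support, P.root i ∉ Δ → f (P.root i) = 1) ∧
      ∀ x ∈ AddSubmonoid.closure (P.root '' b.support), ∃ n : ℕ, f x = n ∧
        (n = 0 → x ∈ Submodule.span K Δ) := by
  classical
  let f : Module.Dual K M :=
    b.toWeightBasis.constr K fun i : b.support => if P.root i ∈ Δ then (0 : K) else 1
  have hf : ∀ i ∈ b.support, f (P.root i) = if P.root i ∈ Δ then (0 : K) else 1 := by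
    intro i hi
    have := b.toWeightBasis.constr_basis K
      (fun i : b.support => if P.root i ∈ Δ then (0 : K) else 1) ⟨i, hi⟩
    rwa [b.toWeightBasis_apply] at this
  refine ⟨f, fun i hi h => by rw [hf i hi, if_pos h], fun i hi h => by rw [hf i hi, if_neg h],
    fun x hx => ?_⟩
  induction hx using AddSubmonoid.closure_induction with
  | mem x hx =>
    obtain ⟨i, hi, rfl⟩ := hx
    by_cases h : P.root i ∈ Δ
    · exact ⟨0, by rw [hf i hi, if_pos h]; simp, fun _ => Submodule.subset_span h⟩
    · exact ⟨1, by rw [hf i hi, if_neg h]; simp, by simp⟩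
  | zero => exact ⟨0, by simp, by simp⟩
  | add x y _ _ hx hy =>
    obtain ⟨n, hn, hn'⟩ := hx
    obtain ⟨m, hm, hm'⟩ := hy
    refine ⟨n + m, by simp [hn, hm], fun h => ?_⟩
    exact add_mem (hn' (by omega)) (hm' (by omega))

end RootPairing.Base

namespace QuasiPoisson

/-! ### Identities for the hyperbolic cotangent -/

section Coth

lemma sinh_ne_zero_iff (z : ℂ) :
    Complex.sinh z ≠ 0 ↔ ¬ ∃ k : ℤ, z = (Real.pi : ℂ) * Complex.I * k := by
  rw [not_iff_not]
  have h : Complex.sinh z = Complex.sin (z * Complex.I) * (-Complex.I) := by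
    rw [Complex.sin_mul_I, mul_assoc]; simp
  rw [h, mul_eq_zero, Complex.sin_eq_zero_iff]
  simp only [neg_eq_zero, Complex.I_ne_zero, or_false]
  constructor
  · rintro ⟨k, hk⟩
    refine ⟨-k, ?_⟩
    have := congrArg (· * (-Complex.I)) hk
    simp only [mul_assoc, mul_neg, Complex.I_mul_I] at this
    push_cast
    linear_combination this
  · rintro ⟨k, rfl⟩
    refine ⟨-k, ?_⟩
    push_cast
    linear_combination (Real.pi : ℂ) * k * Complex.I_mul_I

lemma coth_neg (z : ℂ) : coth (-z) = -coth z := by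
  simp [coth, div_neg]

lemma exp_two_mul_sub_one (z : ℂ) :
    Complex.exp (2 * z) - 1 = 2 * Complex.exp z * Complex.sinh z := by
  rw [two_mul, Complex.exp_add, Complex.sinh, Complex.exp_neg]
  field_simp [Complex.exp_ne_zero z]

lemma exp_two_mul_add_one (z : ℂ) :
    Complex.exp (2 * z) + 1 = 2 * Complex.exp z * Complex.cosh z := by
  rw [two_mul, Complex.exp_add, Complex.cosh, Complex.exp_neg]
  field_simp [Complex.exp_ne_zero z]

/-- In this form the period πi is visible, and the relation can be solved for exp(2z). No side
condition is needed: where sinh vanishes, both quotients are 0 by convention. -/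
lemma coth_eq_exp (z : ℂ) : coth z = (Complex.exp (2 * z) + 1) / (Complex.exp (2 * z) - 1) := by
  rw [exp_two_mul_sub_one, exp_two_mul_add_one, coth, mul_div_mul_left]
  simp [Complex.exp_ne_zero]

lemma coth_congr {z w : ℂ} {k : ℤ} (h : z = w + (Real.pi : ℂ) * Complex.I * k) :
    coth z = coth w := by
  have : Complex.exp (2 * z) = Complex.exp (2 * w) :=
    Complex.exp_eq_exp_iff_exists_int.2 ⟨k, by rw [h]; ring⟩
  rw [coth_eq_exp, coth_eq_exp, this]

/-- With c = -(a + b) and denominators cleared, this is the addition theorem for sinh and cosh.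
Divided by 4 it is the quadratic equation for ½ coth. -/
lemma coth_mul_add {a b c : ℂ} (h : a + b + c = 0) (ha : Complex.sinh a ≠ 0)
    (hb : Complex.sinh b ≠ 0) (hc : Complex.sinh c ≠ 0) :
    coth a * coth b + coth b * coth c + coth c * coth a = -1 := by
  obtain rfl : c = -(a + b) := by linear_combination h
  rw [Complex.sinh_neg, neg_ne_zero] at hc
  rw [coth_neg]
  simp only [coth]
  field_simp
  rw [Complex.sinh_add, Complex.cosh_add]
  ring

end Coth

/-! ### Functions of coth type and the four equations -/

section RootFunctions

open LieAlgebra LieAlgebra.IsKilling RootPairing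

variable {𝔤 : Type*} [LieRing 𝔤] [LieAlgebra ℂ 𝔤] [FiniteDimensional ℂ 𝔤]
  [LieAlgebra.IsSemisimple ℂ 𝔤] {H : LieSubalgebra ℂ 𝔤} [H.IsCartanSubalgebra]

lemma neg_mem_roots {α : Module.Dual ℂ H} (h : α ∈ roots H) : -α ∈ roots H := by
  obtain ⟨i, rfl⟩ := h
  let _ := (rootSystem H).indexNeg
  exact ⟨-i, (rootSystem H).root_reflectionPerm_self i⟩

lemma ne_zero_of_mem_roots {α : Module.Dual ℂ H} (h : α ∈ roots H) : α ≠ 0 := by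
  obtain ⟨i, rfl⟩ := h
  exact (rootSystem H).ne_zero i

lemma IsReductiveSet.neg_mem_iff {𝒰 : Set (Module.Dual ℂ H)} (h𝒰 : IsReductiveSet H 𝒰)
    {α : Module.Dual ℂ H} : -α ∈ 𝒰 ↔ α ∈ 𝒰 :=
  ⟨fun h => neg_neg α ▸ h𝒰.neg_mem _ h, h𝒰.neg_mem α⟩

lemma neg_mem_leviSubset_iff {Δ : Set (Module.Dual ℂ H)} {α : Module.Dual ℂ H} :
    -α ∈ leviSubset H Δ ↔ α ∈ leviSubset H Δ := by
  have : ∀ α : Module.Dual ℂ H, α ∈ leviSubset H Δ → -α ∈ leviSubset H Δ := fun α h =>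
    ⟨neg_mem_roots h.1, neg_mem h.2⟩
  exact ⟨fun h => neg_neg α ▸ this _ h, this α⟩

lemma add_mem_leviSubset {Δ : Set (Module.Dual ℂ H)} {α β : Module.Dual ℂ H}
    (hα : α ∈ leviSubset H Δ) (hβ : β ∈ leviSubset H Δ) (h : α + β ∈ roots H) :
    α + β ∈ leviSubset H Δ :=
  ⟨h, add_mem hα.2 hβ.2⟩

lemma isPos_mem_positiveRoots {b : (rootSystem H).Base} {i : H.root} (h : b.IsPos i) :
    (rootSystem H).root i ∈ positiveRoots b :=
  ⟨⟨i, rfl⟩, h.root_mem_closure⟩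

lemma mem_or_neg_mem_positiveRoots (b : (rootSystem H).Base) {α : Module.Dual ℂ H}
    (h : α ∈ roots H) : α ∈ positiveRoots b ∨ -α ∈ positiveRoots b := by
  obtain ⟨i, rfl⟩ := id h
  rcases b.root_mem_or_neg_mem i with h' | h'
  · exact Or.inl ⟨h, h'⟩
  · exact Or.inr ⟨neg_mem_roots h, h'⟩

/-- The grading functional of a Levi subset. -/
lemma exists_leviSubset_grading (b : (rootSystem H).Base) {Δ : Set (Module.Dual ℂ H)}
    (hΔ : Δ ⊆ simpleRoots b) :
    ∃ f : Module.Dual ℂ (Module.Dual ℂ H), (∀ α ∈ simpleRoots b, α ∉ Δ → f α = 1) ∧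
      (∀ α ∈ Submodule.span ℂ Δ, f α = 0) ∧
      ∀ α ∈ positiveRoots b, ∃ n : ℕ, f α = n ∧ (n = 0 → α ∈ leviSubset H Δ) := by
  obtain ⟨f, hf0, hf1, hf⟩ := b.exists_dual_grading Δ
  refine ⟨f, ?_, ?_, ?_⟩
  · rintro _ ⟨i, hi, rfl⟩ h
    exact hf1 i hi h
  · intro α hα
    induction hα using Submodule.span_induction with
    | mem x hx =>
      obtain ⟨i, hi, rfl⟩ := hΔ hx
      exact hf0 i hi hx
    | zero => simp
    | add x y _ _ hx hy => simp [hx, hy]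
    | smul c x _ hx => simp [hx]
  · intro α hα
    obtain ⟨n, hn, h⟩ := hf α hα.2
    exact ⟨n, hn, fun h0 => ⟨hα.1, h h0⟩⟩

/-- The grading is zero on the Levi subset, positive on the positive roots outside it and negative
on their negatives. A linear relation between roots becomes one between integers, which rules out
most sign patterns. -/
lemma trichotomy_of_grading {b : (rootSystem H).Base} {Δ : Set (Module.Dual ℂ H)}
    {f : Module.Dual ℂ (Module.Dual ℂ H)}
    (hf0 : ∀ α ∈ Submodule.span ℂ Δ, f α = 0)
    (hf : ∀ α ∈ positiveRoots b, ∃ n : ℕ, f α = n ∧ (n = 0 → α ∈ leviSubset H Δ))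
    {α : Module.Dual ℂ H} (hα : α ∈ roots H) :
    ∃ n : ℤ, f α = n ∧ ((α ∈ leviSubset H Δ ∧ n = 0) ∨
      (α ∈ positiveRoots b \ leviSubset H Δ ∧ 0 < n) ∨
      (-α ∈ positiveRoots b \ leviSubset H Δ ∧ n < 0)) := by
  by_cases hN : α ∈ leviSubset H Δ
  · exact ⟨0, by simpa using hf0 α hN.2, Or.inl ⟨hN, rfl⟩⟩
  rcases mem_or_neg_mem_positiveRoots b hα with h | h
  · obtain ⟨n, hn, hn'⟩ := hf α h
    have : n ≠ 0 := fun h0 => hN (hn' h0)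
    exact ⟨n, by simpa using hn, Or.inr (Or.inl ⟨⟨h, hN⟩, by omega⟩)⟩
  · obtain ⟨n, hn, hn'⟩ := hf _ h
    have : n ≠ 0 := fun h0 => hN (neg_mem_leviSubset_iff.1 (hn' h0))
    refine ⟨-n, ?_, Or.inr (Or.inr ⟨⟨h, fun h' => hN (neg_mem_leviSubset_iff.1 h')⟩, by omega⟩)⟩
    rw [map_neg] at hn
    push_cast
    linear_combination -hn

/-- A function of coth type satisfies the four equations. -/
theorem IsCothFunction.satisfiesEquations {𝒰 : Set (Module.Dual ℂ H)}
    (h𝒰 : IsReductiveSet H 𝒰) {x : Module.Dual ℂ H → ℂ} (hx : IsCothFunction H 𝒰 x) :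
    SatisfiesEquations H 𝒰 x := by
  obtain ⟨b, Δ, h, hΔ, h𝒰Δ, hN, hU, hx0, hxN, hxP⟩ := hx
  obtain ⟨f, -, hf0, hf⟩ := exists_leviSubset_grading b hΔ
  have tri := fun {α} (hα : α ∈ roots H) => trichotomy_of_grading hf0 hf hα
  have xN : ∀ α ∈ leviSubset H Δ \ 𝒰, x (-α) = -x α := fun α hα => by
    have : -α ∈ leviSubset H Δ \ 𝒰 :=
      ⟨neg_mem_leviSubset_iff.2 hα.1, fun h' => hα.2 (h𝒰.neg_mem_iff.1 h')⟩
    rw [hxN _ this, hxN _ hα, LinearMap.neg_apply, coth_neg]; ring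
  have xpos : ∀ α ∈ positiveRoots b \ leviSubset H Δ, x α = 1 / 2 := fun α hα => (hxP α hα).1
  have xneg : ∀ α, -α ∈ positiveRoots b \ leviSubset H Δ → x α = -1 / 2 := fun α hα => by
    have := (hxP _ hα).2
    rwa [neg_neg] at this
  refine ⟨hx0, fun α hα => ?_, fun α hα β hβ γ hγ habc => ?_, fun α hα β hβ γ hγ habc => ?_⟩
  · by_cases hαU : α ∈ 𝒰
    · rw [hx0 _ hαU, hx0 _ (h𝒰.neg_mem _ hαU), neg_zero]
    obtain ⟨-, -, ⟨hα', -⟩ | ⟨hα', -⟩ | ⟨hα', -⟩⟩ := tri hα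
    · exact xN α ⟨hα', hαU⟩
    · rw [(hxP α hα').1, (hxP α hα').2]; ring
    · rw [(hxP _ hα').1, xneg α hα']; ring
  · have hfs : f α + f β + f γ = 0 := by rw [← map_add, ← map_add, habc, map_zero]
    rw [hf0 γ (h𝒰Δ hγ).2, add_zero] at hfs
    obtain ⟨n, hn, hα'⟩ := tri hα.1
    obtain ⟨m, hm, hβ'⟩ := tri hβ.1
    rw [hn, hm] at hfs
    replace hfs : n + m = 0 := by exact_mod_cast hfs
    -- As γ has degree 0, the degrees of α and β are opposite: both roots lie in N, or they lie
    -- outside N with opposite signs.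
    rcases hα' with ⟨hα', hn⟩ | ⟨hα', hn⟩ | ⟨hα', hn⟩ <;>
    rcases hβ' with ⟨hβ', hm⟩ | ⟨hβ', hm⟩ | ⟨hβ', hm⟩ <;> try omega
    · obtain ⟨k, hk⟩ := hU γ hγ
      have hβe : β h = (-α) h + (Real.pi : ℂ) * Complex.I * (-k : ℤ) := by
        have := LinearMap.congr_fun habc h
        simp only [LinearMap.add_apply, LinearMap.zero_apply, hk] at this
        simp only [LinearMap.neg_apply]
        push_cast
        linear_combination this
      rw [hxN α ⟨hα', hα.2⟩, hxN β ⟨hβ', hβ.2⟩, coth_congr hβe, LinearMap.neg_apply, coth_neg]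
      ring
    · rw [xpos α hα', xneg β hβ']; ring
    · rw [xneg α hα', xpos β hβ']; ring
  · have hfs : f α + f β + f γ = 0 := by rw [← map_add, ← map_add, habc, map_zero]
    obtain ⟨n, hn, hα'⟩ := tri hα.1
    obtain ⟨m, hm, hβ'⟩ := tri hβ.1
    obtain ⟨k, hk, hγ'⟩ := tri hγ.1
    rw [hn, hm, hk] at hfs
    replace hfs : n + m + k = 0 := by exact_mod_cast hfs
    have sgn : ∀ {δ : Module.Dual ℂ H} {l : ℤ}, ((δ ∈ leviSubset H Δ ∧ l = 0) ∨
        (δ ∈ positiveRoots b \ leviSubset H Δ ∧ 0 < l) ∨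
        (-δ ∈ positiveRoots b \ leviSubset H Δ ∧ l < 0)) →
        (δ ∈ leviSubset H Δ ∧ l = 0) ∨ (x δ = 1 / 2 ∧ 0 < l) ∨ (x δ = -1 / 2 ∧ l < 0) := by
      rintro δ l (hd | hd | hd)
      · exact Or.inl hd
      · exact Or.inr (Or.inl ⟨xpos _ hd.1, hd.2⟩)
      · exact Or.inr (Or.inr ⟨xneg _ hd.1, hd.2⟩)
    rcases sgn hα' with ⟨hα', hn⟩ | ⟨hα', hn⟩ | ⟨hα', hn⟩ <;>
    rcases sgn hβ' with ⟨hβ', hm⟩ | ⟨hβ', hm⟩ | ⟨hβ', hm⟩ <;>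
    rcases sgn hγ' with ⟨hγ', hk⟩ | ⟨hγ', hk⟩ | ⟨hγ', hk⟩ <;> try omega
    · rw [hxN α ⟨hα', hα.2⟩, hxN β ⟨hβ', hβ.2⟩, hxN γ ⟨hγ', hγ.2⟩]
      have hs : α h + β h + γ h = 0 := by
        have := LinearMap.congr_fun habc h
        simpa using this
      have := coth_mul_add hs ((sinh_ne_zero_iff _).2 (hN α ⟨hα', hα.2⟩))
        ((sinh_ne_zero_iff _).2 (hN β ⟨hβ', hβ.2⟩)) ((sinh_ne_zero_iff _).2 (hN γ ⟨hγ', hγ.2⟩))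
      linear_combination this / 4
    -- A relation of total degree 0 that is not inside N contains a root of positive and one of
    -- negative degree, with values 1/2 and -1/2. The third value then cancels from the sum, leaving
    -- -1/4.
    all_goals
      simp only [hα', hβ', hγ']
      ring

/-- The set of roots where the function is not `-1/2` is parabolic. -/
lemma SatisfiesEquations.ne_neg_half_of_add {𝒰 : Set (Module.Dual ℂ H)}
    (h𝒰 : IsReductiveSet H 𝒰) {x : Module.Dual ℂ H → ℂ} (hx : SatisfiesEquations H 𝒰 x)
    {α β : Module.Dual ℂ H} (hα : α ∈ roots H) (hβ : β ∈ roots H) (hαβ : α + β ∈ roots H)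
    (hxα : x α ≠ -1 / 2) (hxβ : x β ≠ -1 / 2) : x (α + β) ≠ -1 / 2 := by
  have h0 : (0 : ℂ) ≠ -1 / 2 := by norm_num
  by_cases hU : α + β ∈ 𝒰
  · rw [hx.zero _ hU]; exact h0
  have hU' : -(α + β) ∉ 𝒰 := fun h => hU (h𝒰.neg_mem_iff.1 h)
  have hR' := neg_mem_roots hαβ
  by_cases hαU : α ∈ 𝒰
  · have hβU : β ∉ 𝒰 := fun h => hU (h𝒰.add_mem _ hαU _ h hαβ)
    have := hx.add _ ⟨hR', hU'⟩ β ⟨hβ, hβU⟩ α hαU (by abel)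
    rw [hx.neg _ hαβ] at this
    rwa [show x (α + β) = x β by linear_combination -this]
  by_cases hβU : β ∈ 𝒰
  · have := hx.add _ ⟨hR', hU'⟩ α ⟨hα, hαU⟩ β hβU (by abel)
    rw [hx.neg _ hαβ] at this
    rwa [show x (α + β) = x α by linear_combination -this]
  have := hx.quad _ ⟨hα, hαU⟩ _ ⟨hβ, hβU⟩ _ ⟨hR', hU'⟩ (by abel)
  rw [hx.neg _ hαβ] at this
  intro hc
  -- The quadratic equation is equivalent to (x_α + ½)(x_β + ½) = (x_α + x_β)(x_{α+β} + ½).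
  have h2 : (x α - (-1 / 2)) * (x β - (-1 / 2)) = 0 := by
    linear_combination this + (x α + x β) * hc
  rcases mul_eq_zero.1 h2 with h | h
  · exact hxα (sub_eq_zero.1 h)
  · exact hxβ (sub_eq_zero.1 h)

/-- The multiplicative form of the equations: `α ↦ exp (2 α(h))`. -/
def expValue (𝒰 : Set (Module.Dual ℂ H)) (x : Module.Dual ℂ H → ℂ) (α : Module.Dual ℂ H) : ℂ :=
  -- On 𝒰 the quotient would be -1, because x = 0 there, whereas α(h) ∈ πiℤ requires the value 1.
  open Classical in if α ∈ 𝒰 then 1 else (2 * x α + 1) / (2 * x α - 1)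

/-- If none of α, β, α + β lies in 𝒰, clearing denominators gives 8 times the quadratic equation. If
one summand lies in 𝒰, the additive equation says that adding it does not change x; if only the sum
does, x_β = -x_α and the two factors are inverse to each other. -/
lemma SatisfiesEquations.expValue_add {𝒰 : Set (Module.Dual ℂ H)}
    (h𝒰 : IsReductiveSet H 𝒰) {x : Module.Dual ℂ H → ℂ} (hx : SatisfiesEquations H 𝒰 x)
    {α β : Module.Dual ℂ H} (hα : α ∈ roots H) (hβ : β ∈ roots H) (hαβ : α + β ∈ roots H)
    (h1 : x α ≠ 1 / 2) (h2 : x β ≠ 1 / 2) (h3 : x (α + β) ≠ 1 / 2)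
    (h1' : x α ≠ -1 / 2) :
    expValue 𝒰 x (α + β) = expValue 𝒰 x α * expValue 𝒰 x β := by
  have nz : ∀ {z : ℂ}, z ≠ 1 / 2 → 2 * z - 1 ≠ 0 := fun h h' => h (by linear_combination h' / 2)
  have nz' : ∀ {z : ℂ}, z ≠ -1 / 2 → 2 * z + 1 ≠ 0 := fun h h' => h (by linear_combination h' / 2)
  have hR' := neg_mem_roots hαβ
  simp only [expValue]
  by_cases hαU : α ∈ 𝒰 <;> by_cases hβU : β ∈ 𝒰
  · simp [hαU, hβU, h𝒰.add_mem _ hαU _ hβU hαβ]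
  · have hU : α + β ∉ 𝒰 := fun h => hβU (by
      have := h𝒰.add_mem _ h _ (h𝒰.neg_mem _ hαU) (by simpa using hβ)
      simpa using this)
    have := hx.add _ ⟨hR', fun h => hU (h𝒰.neg_mem_iff.1 h)⟩ β ⟨hβ, hβU⟩ α hαU (by abel)
    rw [hx.neg _ hαβ] at this
    simp [hαU, hβU, hU, show x (α + β) = x β by linear_combination -this]
  · have hU : α + β ∉ 𝒰 := fun h => hαU (by
      have := h𝒰.add_mem _ h _ (h𝒰.neg_mem _ hβU) (by simpa using hα)
      simpa using this)
    have := hx.add _ ⟨hR', fun h => hU (h𝒰.neg_mem_iff.1 h)⟩ α ⟨hα, hαU⟩ β hβU (by abel)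
    rw [hx.neg _ hαβ] at this
    simp [hαU, hβU, hU, show x (α + β) = x α by linear_combination -this]
  · by_cases hU : α + β ∈ 𝒰
    · have := hx.add _ ⟨hα, hαU⟩ β ⟨hβ, hβU⟩ _ (h𝒰.neg_mem _ hU) (by abel)
      have hb : x β = -x α := by linear_combination this
      have n1 := nz h1
      have n2 := nz h2
      have n3 := nz' h1'
      rw [hb] at n2
      simp only [hαU, hβU, hU, if_true, if_false, hb]
      rw [div_mul_div_comm, eq_comm, div_eq_one_iff_eq (mul_ne_zero n1 n2)]
      ring
    · have := hx.quad _ ⟨hα, hαU⟩ _ ⟨hβ, hβU⟩ _ ⟨hR', fun h => hU (h𝒰.neg_mem_iff.1 h)⟩ (by abel)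
      rw [hx.neg _ hαβ] at this
      simp only [hαU, hβU, hU, if_false]
      rw [div_mul_div_comm, div_eq_div_iff (nz h3) (mul_ne_zero (nz h1) (nz h2))]
      linear_combination 8 * this

lemma expValue_neg {𝒰 : Set (Module.Dual ℂ H)}
    (h𝒰 : IsReductiveSet H 𝒰) {x : Module.Dual ℂ H → ℂ} (hx : SatisfiesEquations H 𝒰 x)
    {α : Module.Dual ℂ H} (hα : α ∈ roots H) :
    expValue 𝒰 x (-α) = (expValue 𝒰 x α)⁻¹ := by
  by_cases hU : α ∈ 𝒰
  · simp [expValue, hU, h𝒰.neg_mem_iff.2 hU]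
  · simp only [expValue, hU, mt h𝒰.neg_mem_iff.1 hU, if_false]
    rw [hx.neg α hα, inv_div, ← neg_div_neg_eq]
    ring

omit [FiniteDimensional ℂ 𝔤] [IsSemisimple ℂ 𝔤] [H.IsCartanSubalgebra] in
lemma expValue_ne_zero {𝒰 : Set (Module.Dual ℂ H)} {x : Module.Dual ℂ H → ℂ}
    {α : Module.Dual ℂ H} (h1 : x α ≠ 1 / 2) (h2 : x α ≠ -1 / 2) : expValue 𝒰 x α ≠ 0 := by
  simp only [expValue]
  split_ifs
  · exact one_ne_zero
  · exact div_ne_zero (fun h => h2 (by linear_combination h / 2))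
      (fun h => h1 (by linear_combination h / 2))

/-- A function which satisfies the four equations is of coth type. -/
theorem SatisfiesEquations.isCothFunction {𝒰 : Set (Module.Dual ℂ H)}
    (h𝒰 : IsReductiveSet H 𝒰) {x : Module.Dual ℂ H → ℂ} (hx : SatisfiesEquations H 𝒰 x) :
    IsCothFunction H 𝒰 x := by
  classical
  have hh : (1 / 2 : ℂ) ≠ -1 / 2 := by norm_num
  let P := rootSystem H
  let _ := P.indexNeg
  have mem (i : H.root) : P.root i ∈ roots H := ⟨i, rfl⟩
  have hneg : ∀ {α : Module.Dual ℂ H}, α ∈ roots H → (x (-α) ≠ -1 / 2 ↔ x α ≠ 1 / 2) := by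
    intro α hα
    rw [hx.neg α hα, not_iff_not]
    constructor <;> intro h
    · linear_combination -h
    · linear_combination -h
  -- Since x is odd, x_α and x_{-α} are not both -1/2; together with closure under sums this makes
  -- the set parabolic.
  obtain ⟨b, hb⟩ := Base.exists_base_forall_mem_of_parabolic (P := P) {α | x α ≠ -1 / 2}
    (fun i => by
      by_cases h : x (P.root i) = -1 / 2
      · right
        refine (hneg (mem i)).2 ?_
        rw [h]
        exact hh.symm
      · exact Or.inl h)
    (fun i j k hk hi hj => by
      have hk' := mem k
      rw [hk] at hk' ⊢
      exact hx.ne_neg_half_of_add h𝒰 (mem i) (mem j) hk' hi hj)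
  -- The simple roots omitted from Δ are those with x = 1/2, the only boundary value still possible
  -- on positive roots.
  let Δ : Set (Module.Dual ℂ H) := {α | α ∈ simpleRoots b ∧ x α ≠ 1 / 2}
  have hΔ : Δ ⊆ simpleRoots b := fun α h => h.1
  obtain ⟨f, hf1, hf0, hf⟩ := exists_leviSubset_grading b hΔ
  have hposnat : ∀ i, b.IsPos i → ∃ n : ℕ, f (P.root i) = n ∧
      (n = 0 → P.root i ∈ leviSubset H Δ) := fun i hi => hf _ (isPos_mem_positiveRoots hi)
  -- A positive root of degree 0 is a sum of simple roots of degree 0, that is, of elements of Δ.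
  -- The condition x ≠ 1/2 survives sums by the closure property applied to the negatives.
  have key1 : ∀ i, b.IsPos i → f (P.root i) = 0 → x (P.root i) ≠ 1 / 2 := by
    intro i hi
    refine (hi.induction_on_add (p := fun i => b.IsPos i ∧ (f (P.root i) = 0 → x (P.root i) ≠ 1 / 2))
      ?_ ?_).2
    · intro j hj
      refine ⟨b.isPos_of_mem_support hj, fun h hc => ?_⟩
      have := hf1 (P.root j) ⟨j, hj, rfl⟩ (fun h' => h'.2 hc)
      rw [h] at this
      exact zero_ne_one this
    · rintro i j k hk ⟨hi, hi'⟩ hj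
      refine ⟨hi.add (b.isPos_of_mem_support hj) hk, fun h => ?_⟩
      obtain ⟨n, hn, -⟩ := hposnat i hi
      obtain ⟨m, hm, -⟩ := hposnat j (b.isPos_of_mem_support hj)
      rw [hk, map_add, hn, hm] at h
      have h' : n + m = 0 := by exact_mod_cast h
      have h1 := hi' (by rw [hn, show n = 0 by omega]; simp)
      have h2 : x (P.root j) ≠ 1 / 2 := fun hc => by
        have := hf1 (P.root j) ⟨j, hj, rfl⟩ (fun h' => h'.2 hc)
        rw [hm, show m = 0 by omega] at this
        simp at this
      have hk' := mem k
      rw [hk] at hk' ⊢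
      rw [← hneg hk', neg_add]
      exact hx.ne_neg_half_of_add h𝒰 (neg_mem_roots (mem i)) (neg_mem_roots (mem j))
        (by rw [← neg_add]; exact neg_mem_roots hk') ((hneg (mem i)).2 h1) ((hneg (mem j)).2 h2)
  -- Conversely, let γ = α + β be positive with x_γ ≠ 1/2. Then -β = α + (-γ) is a sum of two roots
  -- with x ≠ -1/2, so x_β ≠ 1/2, and likewise for α. Descending in this way ends in Δ.
  have key2 : ∀ i, b.IsPos i → x (P.root i) ≠ 1 / 2 → P.root i ∈ leviSubset H Δ := by
    intro i hi
    refine (hi.induction_on_add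
      (p := fun i => b.IsPos i ∧ (x (P.root i) ≠ 1 / 2 → P.root i ∈ leviSubset H Δ)) ?_ ?_).2
    · exact fun j hj => ⟨b.isPos_of_mem_support hj, fun h =>
        ⟨mem j, Submodule.subset_span ⟨⟨j, hj, rfl⟩, h⟩⟩⟩
    · rintro i j k hk ⟨hi, hi'⟩ hj
      refine ⟨hi.add (b.isPos_of_mem_support hj) hk, fun h => ?_⟩
      have h' := (hneg (mem k)).2 h
      have hj' := b.isPos_of_mem_support hj
      have e1 : -P.root j = P.root i + -P.root k := by rw [hk]; abel
      have e2 : -P.root i = P.root j + -P.root k := by rw [hk]; abel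
      have h1 : x (P.root j) ≠ 1 / 2 := by
        rw [← hneg (mem j), e1]
        exact hx.ne_neg_half_of_add h𝒰 (mem i) (neg_mem_roots (mem k))
          (by rw [← e1]; exact neg_mem_roots (mem j)) (hb i hi) h'
      have h2 : x (P.root i) ≠ 1 / 2 := by
        rw [← hneg (mem i), e2]
        exact hx.ne_neg_half_of_add h𝒰 (mem j) (neg_mem_roots (mem k))
          (by rw [← e2]; exact neg_mem_roots (mem i)) (hb j hj') h'
      have hk' := mem k
      rw [hk] at hk' ⊢
      exact add_mem_leviSubset (hi' h2) ⟨mem j, Submodule.subset_span ⟨⟨j, hj, rfl⟩, h1⟩⟩ hk'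
  have levi_iff : ∀ α ∈ roots H, α ∈ leviSubset H Δ ↔ (x α ≠ 1 / 2 ∧ x α ≠ -1 / 2) := by
    have hpos : ∀ i, b.IsPos i → (P.root i ∈ leviSubset H Δ ↔
        (x (P.root i) ≠ 1 / 2 ∧ x (P.root i) ≠ -1 / 2)) := fun i hi =>
      ⟨fun h => ⟨key1 i hi (hf0 _ h.2), hb i hi⟩, fun h => key2 i hi h.1⟩
    rintro _ ⟨i, rfl⟩
    rcases Base.IsPos.or_neg b i with hi | hi
    · exact hpos i hi
    · have h := hpos (-i) hi
      have e : P.root (-i) = -P.root i := P.root_reflectionPerm_self i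
      rw [e, neg_mem_leviSubset_iff, ← hneg (neg_mem_roots (mem i)), neg_neg, hneg (mem i),
        and_comm] at h
      exact h
  -- Any logarithm will do, since only exp(2α(h)) matters. Simple roots outside Δ receive the value
  -- log 0 / 2 = 0 by convention, which plays no role.
  let φ : Module.Dual ℂ (Module.Dual ℂ H) :=
    b.toWeightBasis.constr ℂ fun i : b.support => Complex.log (expValue 𝒰 x (P.root i)) / 2
  have hφ : ∀ i ∈ b.support, φ (P.root i) = Complex.log (expValue 𝒰 x (P.root i)) / 2 := by
    intro i hi
    have := b.toWeightBasis.constr_basis ℂ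
      (fun i : b.support => Complex.log (expValue 𝒰 x (P.root i)) / 2) ⟨i, hi⟩
    rwa [b.toWeightBasis_apply] at this
  let h : H := (Module.evalEquiv ℂ H).symm φ
  have hh' : ∀ α : Module.Dual ℂ H, α h = φ α := fun α => by
    simp [h]
  -- Degrees of positive roots are nonnegative, so a sum in the Levi subset has both summands there,
  -- and multiplicativity propagates the identity from Δ.
  have hexp : ∀ α ∈ leviSubset H Δ, Complex.exp (2 * α h) = expValue 𝒰 x α := by
    have hpos : ∀ i, b.IsPos i → P.root i ∈ leviSubset H Δ →
        Complex.exp (2 * P.root i h) = expValue 𝒰 x (P.root i) := by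
      intro i hi
      refine (hi.induction_on_add (p := fun i => b.IsPos i ∧ (P.root i ∈ leviSubset H Δ →
        Complex.exp (2 * P.root i h) = expValue 𝒰 x (P.root i))) ?_ ?_).2
      · intro j hj
        refine ⟨b.isPos_of_mem_support hj, fun hl => ?_⟩
        have := (levi_iff _ (mem j)).1 hl
        rw [hh', hφ j hj, mul_div_cancel₀ _ two_ne_zero,
          Complex.exp_log (expValue_ne_zero this.1 this.2)]
      · rintro i j k hk ⟨hi, hi'⟩ hj
        have hj' := b.isPos_of_mem_support hj
        refine ⟨hi.add hj' hk, fun hl => ?_⟩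
        obtain ⟨n, hn, hnl⟩ := hposnat i hi
        obtain ⟨m, hm, hml⟩ := hposnat j hj'
        have h0 := hf0 _ hl.2
        rw [hk, map_add, hn, hm] at h0
        have h' : n + m = 0 := by exact_mod_cast h0
        have li := hnl (by omega)
        have lj := hml (by omega)
        have hi1 := (levi_iff _ (mem i)).1 li
        have hj1 := (levi_iff _ (mem j)).1 lj
        have hk1 := (levi_iff _ (mem k)).1 hl
        have hk' := mem k
        rw [hk] at hk' hk1 ⊢
        rw [hx.expValue_add h𝒰 (mem i) (mem j) hk' hi1.1 hj1.1 hk1.1 hi1.2, ← hi' li,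
          LinearMap.add_apply, mul_add, Complex.exp_add]
        congr 1
        rw [hh', hφ j hj, mul_div_cancel₀ _ two_ne_zero,
          Complex.exp_log (expValue_ne_zero hj1.1 hj1.2)]
    intro α hα
    obtain ⟨i, rfl⟩ := hα.1
    rcases Base.IsPos.or_neg b i with hi | hi
    · exact hpos i hi hα
    · have e : P.root (-i) = -P.root i := P.root_reflectionPerm_self i
      have := hpos (-i) hi (by rw [e]; exact neg_mem_leviSubset_iff.2 hα)
      rw [e, expValue_neg h𝒰 hx (mem i), LinearMap.neg_apply, mul_neg, Complex.exp_neg] at this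
      exact inv_injective this
  have h𝒰Δ : 𝒰 ⊆ leviSubset H Δ := fun α hα => by
    rw [levi_iff α (h𝒰.subset_roots hα), hx.zero α hα]
    norm_num
  refine ⟨b, Δ, h, hΔ, h𝒰Δ, ?_, ?_, hx.zero, ?_, ?_⟩
  · rintro α ⟨hα, hαU⟩ ⟨k, hk⟩
    have h1 := hexp α hα
    have : Complex.exp (2 * α h) = 1 := Complex.exp_eq_one_iff.2 ⟨k, by rw [hk]; ring⟩
    simp only [expValue, hαU, if_false] at h1
    have hx1 := ((levi_iff α hα.1).1 hα).1
    rw [this, eq_comm, div_eq_one_iff_eq (fun h => hx1 (by linear_combination h / 2))] at h1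
    have : (2 : ℂ) = 0 := by linear_combination h1
    norm_num at this
  · intro α hα
    have h1 := hexp α (h𝒰Δ hα)
    simp only [expValue, hα, if_true] at h1
    obtain ⟨k, hk⟩ := Complex.exp_eq_one_iff.1 h1
    exact ⟨k, by linear_combination hk / 2⟩
  · rintro α ⟨hα, hαU⟩
    have h1 := hexp α hα
    simp only [expValue, hαU, if_false] at h1
    have hx1 := ((levi_iff α hα.1).1 hα).1
    have nz : 2 * x α - 1 ≠ 0 := fun h => hx1 (by linear_combination h / 2)
    have e1 : (2 * x α + 1) / (2 * x α - 1) + 1 = 4 * x α / (2 * x α - 1) := by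
      field_simp
      ring
    have e2 : (2 * x α + 1) / (2 * x α - 1) - 1 = 2 / (2 * x α - 1) := by
      field_simp
      ring
    rw [coth_eq_exp, h1, e1, e2, div_div_div_cancel_right₀ nz]
    ring
  · rintro α ⟨hα, hαN⟩
    obtain ⟨i, rfl⟩ := hα.1
    -- Otherwise the root and its negative would both have nonnegative degree, hence degree 0, and
    -- the root would lie in the Levi subset.
    have hi : b.IsPos i := by
      by_contra hni
      obtain ⟨n, hn, hn'⟩ := hf _ hα
      obtain ⟨m, hm, hm'⟩ := hposnat (-i) ((Base.IsPos.neg_iff_not b i).2 hni)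
      have e : P.root (-i) = -P.root i := P.root_reflectionPerm_self i
      rw [e, map_neg] at hm
      have h0 : (n : ℂ) + m = 0 := by rw [← hn, ← hm]; exact add_neg_cancel _
      have h0' : n + m = 0 := by exact_mod_cast h0
      exact hαN (hn' (by omega))
    have hne := hb i hi
    have : x (P.root i) = 1 / 2 := by
      by_contra hc
      exact hαN ((levi_iff _ (mem i)).2 ⟨hc, hne⟩)
    refine ⟨this, ?_⟩
    rw [hx.neg _ (mem i)]
    change -x (P.root i) = -1 / 2
    rw [this]
    norm_num

/-- The functions of coth type are the solutions of the four equations. -/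
theorem satisfiesEquations_iff_isCothFunction {𝒰 : Set (Module.Dual ℂ H)}
    (h𝒰 : IsReductiveSet H 𝒰) (x : Module.Dual ℂ H → ℂ) :
    SatisfiesEquations H 𝒰 x ↔ IsCothFunction H 𝒰 x :=
  ⟨fun h => h.isCothFunction h𝒰, fun h => h.satisfiesEquations h𝒰⟩

end RootFunctions


/-! ### Differentials and mixed partial derivatives on complex manifolds -/

section Calculus

variable {E : Type*} [NormedAddCommGroup E] [NormedSpace ℂ E]
  {M : Type*} [TopologicalSpace M] [ChartedSpace E M]
  {E' : Type*} [NormedAddCommGroup E'] [NormedSpace ℂ E']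
  {N : Type*} [TopologicalSpace N] [ChartedSpace E' N]

lemma HolAt.mdifferentiableAt {f : M → ℂ} {x : M} (h : HolAt E f x) :
    MDifferentiableAt 𝓘(ℂ, E) 𝓘(ℂ, ℂ) f x :=
  ContMDiffAt.mdifferentiableAt h (by simp)

lemma HolAt.congr {f g : M → ℂ} {x : M} (h : HolAt E f x) (e : g =ᶠ[nhds x] f) : HolAt E g x :=
  ContMDiffAt.congr_of_eventuallyEq h e

lemma dAt_congr {f g : M → ℂ} {x : M} (e : f =ᶠ[nhds x] g) :
    dAt (F := E) f x = dAt (F := E) g x := by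
  simp only [dAt]
  rw [e.mfderiv_eq]

lemma HolAt.eventually [IsManifold 𝓘(ℂ, E) ω M] {f : M → ℂ} {x : M} (h : HolAt E f x) :
    ∀ᶠ y in nhds x, HolAt E f y :=
  (contMDiffAt_iff_contMDiffAt_nhds (by simp)).1 h

lemma dAt_eq_fderiv {f : M → ℂ} {x : M} (h : MDifferentiableAt 𝓘(ℂ, E) 𝓘(ℂ, ℂ) f x) (v : E) :
    dAt f x v = fderiv ℂ (fun s => f ((extChartAt 𝓘(ℂ, E) x).symm s)) (extChartAt 𝓘(ℂ, E) x x) v := by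
  simp only [dAt, mfderiv, h, writtenInExtChartAt]
  simp only [modelWithCornersSelf_coe, Set.range_id, fderivWithin_univ]
  rfl

lemma dAt_const (c : ℂ) (x : M) : dAt (F := E) (fun _ : M => c) x = 0 := by
  simp only [dAt]
  rw [mfderiv_const]
  rfl

lemma dAt_mul {f g : M → ℂ} {x : M} (hf : HolAt E f x) (hg : HolAt E g x)
    (v : TangentSpace 𝓘(ℂ, E) x) :
    dAt (fun y => f y * g y) x v = dAt f x v * g x + f x * dAt g x v := by
  have h := (hf.mdifferentiableAt.hasMFDerivAt.mul hg.mdifferentiableAt.hasMFDerivAt).mfderiv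
  have h2 := congrArg (fun L : TangentSpace 𝓘(ℂ, E) x →L[ℂ] ℂ => L v) h
  change dAt (f * g) x v = _
  refine Eq.trans h2 ?_
  change f x * dAt g x v + g x * dAt f x v = _
  ring

lemma HolAt.mul {f g : M → ℂ} {x : M} (hf : HolAt E f x) (hg : HolAt E g x) :
    HolAt E (fun y => f y * g y) x := by
  have := ContMDiffAt.mul hf hg
  exact this

lemma HolAt.add {f g : M → ℂ} {x : M} (hf : HolAt E f x) (hg : HolAt E g x) :
    HolAt E (fun y => f y + g y) x := by
  have := ContMDiffAt.add hf hg
  exact this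

lemma HolAt.comp {f : N → ℂ} {g : M → N} {x : M} (hf : HolAt E' f (g x))
    (hg : ContMDiffAt 𝓘(ℂ, E) 𝓘(ℂ, E') ω g x) : HolAt E (fun y => f (g y)) x :=
  ContMDiffAt.comp x hf hg

lemma dAt_comp {f : N → ℂ} {g : M → N} {x : M}
    (hf : MDifferentiableAt 𝓘(ℂ, E') 𝓘(ℂ, ℂ) f (g x))
    (hg : MDifferentiableAt 𝓘(ℂ, E) 𝓘(ℂ, E') g x) (v : TangentSpace 𝓘(ℂ, E) x) :
    dAt (fun y => f (g y)) x v = dAt f (g x) (mfderiv 𝓘(ℂ, E) 𝓘(ℂ, E') g x v) := by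
  have := mfderiv_comp x hf hg
  exact congrArg (fun L : TangentSpace 𝓘(ℂ, E) x →L[ℂ] ℂ => L v) this

/-- `Ψ : M × N → ℂ` is holomorphic near `(x, y)`. -/
def HolAt₂ (E : Type*) [NormedAddCommGroup E] [NormedSpace ℂ E] {M : Type*} [TopologicalSpace M]
    [ChartedSpace E M] (E' : Type*) [NormedAddCommGroup E'] [NormedSpace ℂ E'] {N : Type*}
    [TopologicalSpace N] [ChartedSpace E' N] (Ψ : M → N → ℂ) (x : M) (y : N) : Prop :=
  ContMDiffAt (𝓘(ℂ, E).prod 𝓘(ℂ, E')) 𝓘(ℂ, ℂ) ω (fun p : M × N => Ψ p.1 p.2) (x, y)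

variable [IsManifold 𝓘(ℂ, E) ω M] [IsManifold 𝓘(ℂ, E') ω N]

lemma HolAt₂.contDiffAt {Ψ : M → N → ℂ} {x : M} {y : N} (h : HolAt₂ E E' Ψ x y) :
    ContDiffAt ℂ ω (fun p : E × E' => Ψ ((extChartAt 𝓘(ℂ, E) x).symm p.1)
      ((extChartAt 𝓘(ℂ, E') y).symm p.2)) (extChartAt 𝓘(ℂ, E) x x, extChartAt 𝓘(ℂ, E') y y) := by
  have h1 : ContMDiffAt 𝓘(ℂ, E) 𝓘(ℂ, E) ω (extChartAt 𝓘(ℂ, E) x).symm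
      (extChartAt 𝓘(ℂ, E) x x) :=
    (contMDiffOn_extChartAt_symm x).contMDiffAt (extChartAt_target_mem_nhds x)
  have h2 : ContMDiffAt 𝓘(ℂ, E') 𝓘(ℂ, E') ω (extChartAt 𝓘(ℂ, E') y).symm
      (extChartAt 𝓘(ℂ, E') y y) :=
    (contMDiffOn_extChartAt_symm y).contMDiffAt (extChartAt_target_mem_nhds y)
  rw [← contMDiffAt_iff_contDiffAt]
  have h3 : ContMDiffAt 𝓘(ℂ, E × E') (𝓘(ℂ, E).prod 𝓘(ℂ, E')) ω
      (fun p : E × E' => ((extChartAt 𝓘(ℂ, E) x).symm p.1, (extChartAt 𝓘(ℂ, E') y).symm p.2))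
      (extChartAt 𝓘(ℂ, E) x x, extChartAt 𝓘(ℂ, E') y y) :=
    (ContMDiffAt.comp (extChartAt 𝓘(ℂ, E) x x, extChartAt 𝓘(ℂ, E') y y) (I' := 𝓘(ℂ, E)) h1
      contDiff_fst.contMDiff.contMDiffAt).prodMk
    (ContMDiffAt.comp (extChartAt 𝓘(ℂ, E) x x, extChartAt 𝓘(ℂ, E') y y) (I' := 𝓘(ℂ, E')) h2
      contDiff_snd.contMDiff.contMDiffAt)
  have h' : ContMDiffAt (𝓘(ℂ, E).prod 𝓘(ℂ, E')) 𝓘(ℂ, ℂ) ω (fun p : M × N => Ψ p.1 p.2)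
      ((extChartAt 𝓘(ℂ, E) x).symm (extChartAt 𝓘(ℂ, E) x x),
        (extChartAt 𝓘(ℂ, E') y).symm (extChartAt 𝓘(ℂ, E') y y)) := by
    rw [extChartAt_to_inv, extChartAt_to_inv]; exact h
  exact ContMDiffAt.comp (I' := 𝓘(ℂ, E).prod 𝓘(ℂ, E'))
    (extChartAt 𝓘(ℂ, E) x x, extChartAt 𝓘(ℂ, E') y y)
    (g := fun p : M × N => Ψ p.1 p.2) (f := fun p : E × E' =>
      ((extChartAt 𝓘(ℂ, E) x).symm p.1, (extChartAt 𝓘(ℂ, E') y).symm p.2)) h' h3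

omit [IsManifold 𝓘(ℂ, E) ω M] [IsManifold 𝓘(ℂ, E') ω N] in
lemma HolAt₂.right {Ψ : M → N → ℂ} {x : M} {y : N} (h : HolAt₂ E E' Ψ x y) :
    HolAt E' (fun t => Ψ x t) y :=
  ContMDiffAt.comp (I' := 𝓘(ℂ, E).prod 𝓘(ℂ, E')) y
    (g := fun p : M × N => Ψ p.1 p.2) (f := fun t : N => (x, t)) h
    (contMDiffAt_const.prodMk contMDiffAt_id)

omit [IsManifold 𝓘(ℂ, E) ω M] [IsManifold 𝓘(ℂ, E') ω N] in
lemma HolAt₂.swap {Ψ : M → N → ℂ} {x : M} {y : N} (h : HolAt₂ E E' Ψ x y) :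
    HolAt₂ E' E (fun t s => Ψ s t) y x :=
  ContMDiffAt.comp (I' := 𝓘(ℂ, E).prod 𝓘(ℂ, E')) (y, x)
    (g := fun p : M × N => Ψ p.1 p.2) (f := fun p : N × M => (p.2, p.1)) h
    (contMDiffAt_snd.prodMk contMDiffAt_fst)

lemma HolAt₂.eventually {Ψ : M → N → ℂ} {x : M} {y : N} (h : HolAt₂ E E' Ψ x y) :
    ∀ᶠ s in nhds x, HolAt₂ E E' Ψ s y := by
  have : ∀ᶠ p in nhds (x, y), ContMDiffAt (𝓘(ℂ, E).prod 𝓘(ℂ, E')) 𝓘(ℂ, ℂ) ω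
      (fun p : M × N => Ψ p.1 p.2) p := (contMDiffAt_iff_contMDiffAt_nhds (by simp)).1 h
  have hc : Filter.Tendsto (fun s : M => (s, y)) (nhds x) (nhds (x, y)) :=
    (Continuous.prodMk_left y).tendsto x
  exact hc.eventually this

omit [IsManifold 𝓘(ℂ, E) ω M] [IsManifold 𝓘(ℂ, E') ω N] in
-- In product charts the partial derivative is the total derivative applied to (0, v), so its
-- holomorphy and its further derivatives follow from calculus in a normed space.
lemma HolAt₂.comp_chart {Ψ : M → N → ℂ} {x : M} {y : N} (v : E')
    (hd : ∀ᶠ s in nhds x, MDifferentiableAt 𝓘(ℂ, E') 𝓘(ℂ, ℂ) (fun t => Ψ s t) y)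
    (h : ContDiffAt ℂ ω (fun p : E × E' => Ψ ((extChartAt 𝓘(ℂ, E) x).symm p.1)
      ((extChartAt 𝓘(ℂ, E') y).symm p.2))
      (extChartAt 𝓘(ℂ, E) x x, extChartAt 𝓘(ℂ, E') y y)) :
    (fun s : E => dAt (F := E') (fun t => Ψ ((extChartAt 𝓘(ℂ, E) x).symm s) t) y v) =ᶠ[nhds
      (extChartAt 𝓘(ℂ, E) x x)] fun s => fderiv ℂ (fun p : E × E' =>
        Ψ ((extChartAt 𝓘(ℂ, E) x).symm p.1) ((extChartAt 𝓘(ℂ, E') y).symm p.2))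
        (s, extChartAt 𝓘(ℂ, E') y y) (0, v) := by
  have hcont : Filter.Tendsto (extChartAt 𝓘(ℂ, E) x).symm (nhds (extChartAt 𝓘(ℂ, E) x x))
      (nhds x) := by
    have := continuousAt_extChartAt_symm (I := 𝓘(ℂ, E)) x
    rwa [ContinuousAt, extChartAt_to_inv] at this
  have hd' := hcont.eventually hd
  have h2 : ∀ᶠ p in nhds (extChartAt 𝓘(ℂ, E) x x, extChartAt 𝓘(ℂ, E') y y),
      DifferentiableAt ℂ (fun p : E × E' => Ψ ((extChartAt 𝓘(ℂ, E) x).symm p.1)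
        ((extChartAt 𝓘(ℂ, E') y).symm p.2)) p := by
    filter_upwards [h.eventually (by simp)] with p hp using hp.differentiableAt (by simp)
  have hc : Filter.Tendsto (fun s : E => (s, extChartAt 𝓘(ℂ, E') y y))
      (nhds (extChartAt 𝓘(ℂ, E) x x)) (nhds (extChartAt 𝓘(ℂ, E) x x, extChartAt 𝓘(ℂ, E') y y)) :=
    (Continuous.prodMk_left _).tendsto _
  filter_upwards [hd', hc.eventually h2] with s hs hs2
  refine (dAt_eq_fderiv hs v).trans ?_
  have h3 : HasFDerivAt (fun t : E' => (s, t)) (ContinuousLinearMap.inr ℂ E E')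
      (extChartAt 𝓘(ℂ, E') y y) := hasFDerivAt_prodMk_right s _
  have := (HasFDerivAt.comp (extChartAt 𝓘(ℂ, E') y y) (f := fun t : E' => (s, t))
    hs2.hasFDerivAt h3).fderiv
  have h4 := congrArg (fun L : E' →L[ℂ] ℂ => L v) this
  refine h4.trans ?_
  simp

omit [IsManifold 𝓘(ℂ, E) ω M] [IsManifold 𝓘(ℂ, E') ω N] in
lemma HolAt₂.comp_chart_left {Ψ : M → N → ℂ} {x : M} {y : N} (u : E)
    (hd : ∀ᶠ t in nhds y, MDifferentiableAt 𝓘(ℂ, E) 𝓘(ℂ, ℂ) (fun s => Ψ s t) x)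
    (h : ContDiffAt ℂ ω (fun p : E × E' => Ψ ((extChartAt 𝓘(ℂ, E) x).symm p.1)
      ((extChartAt 𝓘(ℂ, E') y).symm p.2))
      (extChartAt 𝓘(ℂ, E) x x, extChartAt 𝓘(ℂ, E') y y)) :
    (fun t : E' => dAt (F := E) (fun s => Ψ s ((extChartAt 𝓘(ℂ, E') y).symm t)) x u) =ᶠ[nhds
      (extChartAt 𝓘(ℂ, E') y y)] fun t => fderiv ℂ (fun p : E × E' =>
        Ψ ((extChartAt 𝓘(ℂ, E) x).symm p.1) ((extChartAt 𝓘(ℂ, E') y).symm p.2))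
        (extChartAt 𝓘(ℂ, E) x x, t) (u, 0) := by
  have hcont : Filter.Tendsto (extChartAt 𝓘(ℂ, E') y).symm (nhds (extChartAt 𝓘(ℂ, E') y y))
      (nhds y) := by
    have := continuousAt_extChartAt_symm (I := 𝓘(ℂ, E')) y
    rwa [ContinuousAt, extChartAt_to_inv] at this
  have hd' := hcont.eventually hd
  have h2 : ∀ᶠ p in nhds (extChartAt 𝓘(ℂ, E) x x, extChartAt 𝓘(ℂ, E') y y),
      DifferentiableAt ℂ (fun p : E × E' => Ψ ((extChartAt 𝓘(ℂ, E) x).symm p.1)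
        ((extChartAt 𝓘(ℂ, E') y).symm p.2)) p := by
    filter_upwards [h.eventually (by simp)] with p hp using hp.differentiableAt (by simp)
  have hc : Filter.Tendsto (fun t : E' => (extChartAt 𝓘(ℂ, E) x x, t))
      (nhds (extChartAt 𝓘(ℂ, E') y y)) (nhds (extChartAt 𝓘(ℂ, E) x x, extChartAt 𝓘(ℂ, E') y y)) :=
    (Continuous.prodMk_right _).tendsto _
  filter_upwards [hd', hc.eventually h2] with t hs hs2
  refine (dAt_eq_fderiv hs u).trans ?_
  have h3 : HasFDerivAt (fun s : E => (s, t)) (ContinuousLinearMap.inl ℂ E E')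
      (extChartAt 𝓘(ℂ, E) x x) := hasFDerivAt_prodMk_left _ t
  have := (HasFDerivAt.comp (extChartAt 𝓘(ℂ, E) x x) (f := fun s : E => (s, t))
    hs2.hasFDerivAt h3).fderiv
  have h4 := congrArg (fun L : E →L[ℂ] ℂ => L u) this
  refine h4.trans ?_
  simp

omit [IsManifold 𝓘(ℂ, E) ω M] in
lemma eventually_chart_inv (x : M) : ∀ᶠ s in nhds x,
    (extChartAt 𝓘(ℂ, E) x).symm (extChartAt 𝓘(ℂ, E) x s) = s := by
  filter_upwards [extChartAt_source_mem_nhds (I := 𝓘(ℂ, E)) x] with s hs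
  exact (extChartAt 𝓘(ℂ, E) x).left_inv hs

lemma HolAt₂.eventually_mdifferentiableAt {Ψ : M → N → ℂ} {x : M} {y : N}
    (h : HolAt₂ E E' Ψ x y) :
    ∀ᶠ s in nhds x, MDifferentiableAt 𝓘(ℂ, E') 𝓘(ℂ, ℂ) (fun t => Ψ s t) y :=
  h.eventually.mono fun _ hs => hs.right.mdifferentiableAt

/-- The partial derivative of a holomorphic function is holomorphic. -/
lemma HolAt₂.dAt_right {Ψ : M → N → ℂ} {x : M} {y : N} (h : HolAt₂ E E' Ψ x y)
    (v : TangentSpace 𝓘(ℂ, E') y) : HolAt E (fun s => dAt (fun t => Ψ s t) y v) x := by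
  have key : ∀ v : E', HolAt E (fun s => dAt (F := E') (fun t => Ψ s t) y v) x := by
    clear v
    intro v
    have hc := h.contDiffAt
    have h1 : ContDiffAt ℂ ω (fun s : E =>
        dAt (F := E') (fun t => Ψ ((extChartAt 𝓘(ℂ, E) x).symm s) t) y v)
        (extChartAt 𝓘(ℂ, E) x x) := by
      refine ContDiffAt.congr_of_eventuallyEq ?_
        (HolAt₂.comp_chart v h.eventually_mdifferentiableAt hc)
      have h3 := hc.fderiv_right (m := ω) (by simp)
      have h4 : ContDiffAt ℂ ω (fun s : E => (s, extChartAt 𝓘(ℂ, E') y y))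
        (extChartAt 𝓘(ℂ, E) x x) := contDiffAt_id.prodMk contDiffAt_const
      exact (ContDiffAt.comp (extChartAt 𝓘(ℂ, E) x x) h3 h4).clm_apply contDiffAt_const
    have h2 : HolAt E (fun s => dAt (F := E') (fun t => Ψ ((extChartAt 𝓘(ℂ, E) x).symm
        (extChartAt 𝓘(ℂ, E) x s)) t) y v) x :=
      ContMDiffAt.comp x h1.contMDiffAt (contMDiffAt_extChartAt (n := ω))
    refine h2.congr ?_
    filter_upwards [eventually_chart_inv (E := E) x] with s hs
    rw [hs]
  exact key v

/-- Symmetry of mixed partial derivatives. -/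
lemma HolAt₂.dAt_dAt_comm {Ψ : M → N → ℂ} {x : M} {y : N} (h : HolAt₂ E E' Ψ x y)
    (u : TangentSpace 𝓘(ℂ, E) x) (v : TangentSpace 𝓘(ℂ, E') y) :
    dAt (fun s => dAt (fun t => Ψ s t) y v) x u = dAt (fun t => dAt (fun s => Ψ s t) x u) y v := by
  have key : ∀ (u : E) (v : E'), dAt (F := E) (fun s => dAt (F := E') (fun t => Ψ s t) y v) x u =
      dAt (F := E') (fun t => dAt (F := E) (fun s => Ψ s t) x u) y v := by
    clear u v
    intro u v
    have hc := h.contDiffAt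
    set a := extChartAt 𝓘(ℂ, E) x x
    set b := extChartAt 𝓘(ℂ, E') y y
    set ψ : E × E' → ℂ := fun p => Ψ ((extChartAt 𝓘(ℂ, E) x).symm p.1)
      ((extChartAt 𝓘(ℂ, E') y).symm p.2) with hψ
    -- Both iterated derivatives are values of the second derivative of the chart expression on the
    -- pair (u, 0), (0, v), and that derivative is symmetric.
    have hsymm : IsSymmSndFDerivAt ℂ ψ (a, b) := hc.isSymmSndFDerivAt (by simp)
    have hdiff : DifferentiableAt ℂ (fderiv ℂ ψ) (a, b) :=
      (hc.fderiv_right (m := ω) (by simp)).differentiableAt (by simp)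
    have e1 : dAt (F := E) (fun s => dAt (F := E') (fun t => Ψ s t) y v) x u =
        fderiv ℂ (fderiv ℂ ψ) (a, b) (u, 0) (0, v) := by
      refine (dAt_eq_fderiv (h.dAt_right v).mdifferentiableAt u).trans ?_
      rw [(HolAt₂.comp_chart v h.eventually_mdifferentiableAt hc).fderiv_eq]
      have h3 : HasFDerivAt (fun s : E => (s, b)) (ContinuousLinearMap.inl ℂ E E') a :=
        hasFDerivAt_prodMk_left _ _
      have h4 := (HasFDerivAt.comp a (f := fun s : E => (s, b)) hdiff.hasFDerivAt h3).clm_apply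
        (hasFDerivAt_const ((0, v) : E × E') a)
      refine (congrArg (fun L : E →L[ℂ] ℂ => L u) h4.fderiv).trans ?_
      simp
    have e2 : dAt (F := E') (fun t => dAt (F := E) (fun s => Ψ s t) x u) y v =
        fderiv ℂ (fderiv ℂ ψ) (a, b) (0, v) (u, 0) := by
      refine (dAt_eq_fderiv (h.swap.dAt_right u).mdifferentiableAt v).trans ?_
      rw [(HolAt₂.comp_chart_left u h.swap.eventually_mdifferentiableAt hc).fderiv_eq]
      have h3 : HasFDerivAt (fun t : E' => (a, t)) (ContinuousLinearMap.inr ℂ E E') b :=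
        hasFDerivAt_prodMk_right _ _
      have h4 := (HasFDerivAt.comp b (f := fun t : E' => (a, t)) hdiff.hasFDerivAt h3).clm_apply
        (hasFDerivAt_const ((u, 0) : E × E') b)
      refine (congrArg (fun L : E' →L[ℂ] ℂ => L v) h4.fderiv).trans ?_
      simp
    rw [e1, e2]
    exact hsymm.eq _ _
  exact key u v

end Calculus


/-! ### Invariant vector fields on a Lie group and their commutators -/

section LieGroupCalculus

variable {E : Type*} [NormedAddCommGroup E] [NormedSpace ℂ E]
  {G : Type*} [Group G] [TopologicalSpace G] [ChartedSpace E G] [LieGroup 𝓘(ℂ, E) ω G]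

/-- The derivative of a function along a left-invariant vector field. -/
def LD (v : GroupLieAlgebra 𝓘(ℂ, E) G) (f : G → ℂ) (g : G) : ℂ := dAt f g (dLeft g v)

/-- The derivative of a function along a right-invariant vector field. -/
def RD (v : GroupLieAlgebra 𝓘(ℂ, E) G) (f : G → ℂ) (g : G) : ℂ := dAt f g (dRight g v)

lemma contMDiffAt_mul_left' (g x : G) :
    ContMDiffAt 𝓘(ℂ, E) 𝓘(ℂ, E) ω (fun a : G => g * a) x := contMDiffAt_mul_left

lemma contMDiffAt_mul_right' (g x : G) :
    ContMDiffAt 𝓘(ℂ, E) 𝓘(ℂ, E) ω (fun a : G => a * g) x := contMDiffAt_mul_right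

/-- The base point of the differentiation moves to 1. Iterated invariant derivatives thereby become
mixed partial derivatives of a function on G × G at a fixed point. -/
lemma LD_eq {f : G → ℂ} {g : G} (hf : HolAt E f g) (v : GroupLieAlgebra 𝓘(ℂ, E) G) :
    LD v f g = dAt (fun t => f (g * t)) (1 : G) v := by
  have hf' : MDifferentiableAt 𝓘(ℂ, E) 𝓘(ℂ, ℂ) f (g * 1) := by
    rw [mul_one]; exact hf.mdifferentiableAt
  have h := dAt_comp (g := fun t : G => g * t) hf'
    ((contMDiffAt_mul_left' g 1).mdifferentiableAt (by simp)) v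
  rw [h]
  have e : g * 1 = g := mul_one g
  simp only [LD, dLeft]
  rw! [e]
  rfl

lemma RD_eq {f : G → ℂ} {g : G} (hf : HolAt E f g) (v : GroupLieAlgebra 𝓘(ℂ, E) G) :
    RD v f g = dAt (fun t => f (t * g)) (1 : G) v := by
  have hf' : MDifferentiableAt 𝓘(ℂ, E) 𝓘(ℂ, ℂ) f (1 * g) := by
    rw [one_mul]; exact hf.mdifferentiableAt
  have h := dAt_comp (g := fun t : G => t * g) hf'
    ((contMDiffAt_mul_right' g 1).mdifferentiableAt (by simp)) v
  rw [h]
  have e : 1 * g = g := one_mul g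
  simp only [RD, dRight]
  rw! [e]
  rfl

lemma LD_congr {f f' : G → ℂ} {g : G} (h : f =ᶠ[nhds g] f') (v : GroupLieAlgebra 𝓘(ℂ, E) G) :
    LD v f g = LD v f' g := by
  simp only [LD]
  rw [dAt_congr h]

lemma RD_congr {f f' : G → ℂ} {g : G} (h : f =ᶠ[nhds g] f') (v : GroupLieAlgebra 𝓘(ℂ, E) G) :
    RD v f g = RD v f' g := by
  simp only [RD]
  rw [dAt_congr h]

lemma holAt₂_comp {f : G → ℂ} (φ : G × G → G) {x y : G} (hf : HolAt E f (φ (x, y)))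
    (hφ : ContMDiffAt (𝓘(ℂ, E).prod 𝓘(ℂ, E)) 𝓘(ℂ, E) ω φ (x, y)) :
    HolAt₂ E E (fun s t => f (φ (s, t))) x y :=
  ContMDiffAt.comp (I' := 𝓘(ℂ, E)) (x, y) hf hφ

lemma contMDiffAt_mul_mul (a : G) (x y : G) :
    ContMDiffAt (𝓘(ℂ, E).prod 𝓘(ℂ, E)) 𝓘(ℂ, E) ω (fun p : G × G => p.1 * a * p.2) (x, y) :=
  ((contMDiffAt_fst.mul contMDiffAt_const).mul contMDiffAt_snd)

lemma contMDiffAt_mul_pair (x y : G) :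
    ContMDiffAt (𝓘(ℂ, E).prod 𝓘(ℂ, E)) 𝓘(ℂ, E) ω (fun p : G × G => p.1 * p.2) (x, y) :=
  contMDiffAt_fst.mul contMDiffAt_snd

lemma contMDiffAt_mul_pair_swap (x y : G) :
    ContMDiffAt (𝓘(ℂ, E).prod 𝓘(ℂ, E)) 𝓘(ℂ, E) ω (fun p : G × G => p.2 * p.1) (x, y) :=
  contMDiffAt_snd.mul contMDiffAt_fst

lemma LD_eventuallyEq {f : G → ℂ} {g : G} (hf : HolAt E f g) (v : GroupLieAlgebra 𝓘(ℂ, E) G) :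
    LD v f =ᶠ[nhds g] fun x => dAt (fun t => f (x * t)) (1 : G) v :=
  hf.eventually.mono fun _ hx => LD_eq hx v

lemma RD_eventuallyEq {f : G → ℂ} {g : G} (hf : HolAt E f g) (v : GroupLieAlgebra 𝓘(ℂ, E) G) :
    RD v f =ᶠ[nhds g] fun x => dAt (fun t => f (t * x)) (1 : G) v :=
  hf.eventually.mono fun _ hx => RD_eq hx v

lemma HolAt.LD {f : G → ℂ} {g : G} (hf : HolAt E f g) (v : GroupLieAlgebra 𝓘(ℂ, E) G) :
    HolAt E (LD v f) g := by
  have h : HolAt₂ E E (fun s t => f (s * t)) g 1 :=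
    holAt₂_comp (fun p => p.1 * p.2) (by simpa using hf) (contMDiffAt_mul_pair _ _)
  exact (h.dAt_right v).congr (LD_eventuallyEq hf v)

lemma HolAt.RD {f : G → ℂ} {g : G} (hf : HolAt E f g) (v : GroupLieAlgebra 𝓘(ℂ, E) G) :
    HolAt E (RD v f) g := by
  have h : HolAt₂ E E (fun s t => f (t * s)) g 1 :=
    holAt₂_comp (fun p => p.2 * p.1) (by simpa using hf) (contMDiffAt_mul_pair_swap _ _)
  exact (h.dAt_right v).congr (RD_eventuallyEq hf v)

lemma tendsto_mul_left_one (E : Type*) [NormedAddCommGroup E] [NormedSpace ℂ E]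
    {G : Type*} [Group G] [TopologicalSpace G] [ChartedSpace E G] [LieGroup 𝓘(ℂ, E) ω G] (g : G) :
    Filter.Tendsto (fun s : G => g * s) (nhds 1) (nhds g) := by
  have := (contMDiffAt_mul_left' (E := E) g 1).continuousAt
  rwa [ContinuousAt, mul_one] at this

lemma tendsto_mul_right_one (E : Type*) [NormedAddCommGroup E] [NormedSpace ℂ E]
    {G : Type*} [Group G] [TopologicalSpace G] [ChartedSpace E G] [LieGroup 𝓘(ℂ, E) ω G] (g : G) :
    Filter.Tendsto (fun s : G => s * g) (nhds 1) (nhds g) := by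
  have := (contMDiffAt_mul_right' (E := E) g 1).continuousAt
  rwa [ContinuousAt, one_mul] at this

variable {f : G → ℂ} {g : G} (hf : HolAt E f g) (u v : GroupLieAlgebra 𝓘(ℂ, E) G)

include hf in
lemma LD_LD_eq : LD u (LD v f) g =
    dAt (fun s => dAt (fun t => f (g * s * t)) (1 : G) v) (1 : G) u := by
  rw [LD_eq (hf.LD v) u]
  exact congrArg (fun L => L u) (dAt_congr ((tendsto_mul_left_one E g).eventually
    (LD_eventuallyEq hf v)))

include hf in
lemma LD_RD_eq : LD u (RD v f) g =
    dAt (fun s => dAt (fun t => f (t * (g * s))) (1 : G) v) (1 : G) u := by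
  rw [LD_eq (hf.RD v) u]
  exact congrArg (fun L => L u) (dAt_congr ((tendsto_mul_left_one E g).eventually
    (RD_eventuallyEq hf v)))

include hf in
lemma RD_LD_eq : RD u (LD v f) g =
    dAt (fun s => dAt (fun t => f (s * g * t)) (1 : G) v) (1 : G) u := by
  rw [RD_eq (hf.LD v) u]
  exact congrArg (fun L => L u) (dAt_congr ((tendsto_mul_right_one E g).eventually
    (LD_eventuallyEq hf v)))

include hf in
lemma RD_RD_eq : RD u (RD v f) g =
    dAt (fun s => dAt (fun t => f (t * (s * g))) (1 : G) v) (1 : G) u := by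
  rw [RD_eq (hf.RD v) u]
  exact congrArg (fun L => L u) (dAt_congr ((tendsto_mul_right_one E g).eventually
    (RD_eventuallyEq hf v)))

include hf in
/-- Left- and right-invariant vector fields commute. -/
theorem LD_RD_comm : LD u (RD v f) g = RD v (LD u f) g := by
  rw [LD_RD_eq hf, RD_LD_eq hf]
  -- Both sides are mixed derivatives of f(s g t) at s = t = 1.
  have h : HolAt₂ E E (fun s t => f (s * g * t)) 1 1 :=
    holAt₂_comp (fun p => p.1 * g * p.2) (by simpa using hf) (contMDiffAt_mul_mul _ _ _)
  rw [h.dAt_dAt_comm v u]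
  simp only [mul_assoc]

include hf in
lemma HolAt.comp_mul_left : HolAt E (fun t => f (g * t)) 1 :=
  HolAt.comp (g := fun t : G => g * t) (by simpa using hf) (contMDiffAt_mul_left' g 1)

include hf in
lemma HolAt.comp_mul_right : HolAt E (fun t => f (t * g)) 1 :=
  HolAt.comp (g := fun t : G => t * g) (by simpa using hf) (contMDiffAt_mul_right' g 1)

lemma dLeft_one_apply (v : GroupLieAlgebra 𝓘(ℂ, E) G) :
    (dLeft (1 : G) v : E) = v := by
  have key : ∀ h : G → G, h = id → ∀ v : E, (mfderiv 𝓘(ℂ, E) 𝓘(ℂ, E) h (1 : G) v : E) = v := by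
    rintro _ rfl v
    rw [mfderiv_id]
    rfl
  exact key _ (by ext; simp) v

lemma dRight_one_apply (v : GroupLieAlgebra 𝓘(ℂ, E) G) :
    (dRight (1 : G) v : E) = v := by
  have key : ∀ h : G → G, h = id → ∀ v : E, (mfderiv 𝓘(ℂ, E) 𝓘(ℂ, E) h (1 : G) v : E) = v := by
    rintro _ rfl v
    rw [mfderiv_id]
    rfl
  exact key _ (by ext; simp) v

lemma LD_one (f : G → ℂ) : LD v f 1 = dAt f (1 : G) v :=
  congrArg (dAt f (1 : G)) (dLeft_one_apply v)

lemma RD_one (f : G → ℂ) : RD v f 1 = dAt f (1 : G) v :=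
  congrArg (dAt f (1 : G)) (dRight_one_apply v)

section Bracket

variable [FiniteDimensional ℂ E]

omit [FiniteDimensional ℂ E] in
include hf in
lemma LD_LD_mul_left : LD u (LD v f) g = LD u (LD v fun t => f (g * t)) 1 := by
  rw [LD_LD_eq hf, LD_LD_eq hf.comp_mul_left]
  simp only [one_mul, mul_assoc]

open VectorField in
/-- A left-invariant vector field in the chart at `1`. -/
def chartField (v : GroupLieAlgebra 𝓘(ℂ, E) G) : E → E :=
  mpullbackWithin 𝓘(ℂ, E) 𝓘(ℂ, E) (extChartAt 𝓘(ℂ, E) (1 : G)).symm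
    (mulInvariantVectorField v) (Set.range 𝓘(ℂ, E))

omit [FiniteDimensional ℂ E] in
lemma LD_eq_fderiv_chartField {f : G → ℂ} (hf : HolAt E f 1) :
    (fun s => LD v f ((extChartAt 𝓘(ℂ, E) (1 : G)).symm s)) =ᶠ[nhds (extChartAt 𝓘(ℂ, E) (1 : G) 1)]
      fun s => fderiv ℂ (fun s => f ((extChartAt 𝓘(ℂ, E) (1 : G)).symm s)) s (chartField v s) := by
  set φ := extChartAt 𝓘(ℂ, E) (1 : G)
  have hcont : Filter.Tendsto φ.symm (nhds (φ 1)) (nhds 1) := by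
    have := continuousAt_extChartAt_symm (I := 𝓘(ℂ, E)) (1 : G)
    rwa [ContinuousAt, extChartAt_to_inv] at this
  filter_upwards [hcont.eventually hf.eventually,
    extChartAt_target_mem_nhds (I := 𝓘(ℂ, E)) (1 : G)] with s hs hst
  have hφ : MDifferentiableAt 𝓘(ℂ, E) 𝓘(ℂ, E) φ.symm s :=
    ((contMDiffOn_extChartAt_symm (n := ω) (1 : G)).contMDiffAt
      ((isOpen_extChartAt_target (I := 𝓘(ℂ, E)) (1 : G)).mem_nhds hst)).mdifferentiableAt (by simp)
  have h1 := mfderiv_comp s hs.mdifferentiableAt hφ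
  have h2 : fderiv ℂ (fun s => f (φ.symm s)) s =
      mfderiv 𝓘(ℂ, E) 𝓘(ℂ, ℂ) (f ∘ φ.symm) s := by rw [mfderiv_eq_fderiv]; rfl
  have hinv := isInvertible_mfderivWithin_extChartAt_symm (I := 𝓘(ℂ, E)) (x := (1 : G)) hst
  have hr : mfderivWithin 𝓘(ℂ, E) 𝓘(ℂ, E) φ.symm (Set.range 𝓘(ℂ, E)) s =
      mfderiv 𝓘(ℂ, E) 𝓘(ℂ, E) φ.symm s := by
    simp only [modelWithCornersSelf_coe, Set.range_id, mfderivWithin_univ]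
  have h3 : mfderiv 𝓘(ℂ, E) 𝓘(ℂ, E) φ.symm s (chartField (E := E) v s) =
      mulInvariantVectorField v (φ.symm s) := by
    rw [← hr]
    exact congrArg (fun L => L (mulInvariantVectorField v (φ.symm s))) hinv.self_comp_inverse
  rw [h2, h1]
  exact (congrArg (dAt f (φ.symm s)) h3).symm

lemma differentiableAt_chartField :
    DifferentiableAt ℂ (chartField v) (extChartAt 𝓘(ℂ, E) (1 : G) 1) := by
  have := (mdifferentiableAt_mulInvariantVectorField v (g := (1 : G))).mdifferentiableWithinAt
    (s := Set.univ) |>.differentiableWithinAt_mpullbackWithin_vectorField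
  rw [← differentiableWithinAt_univ]
  convert! this using 2
  simp

/-- In the chart at 1 each iterated derivative is a second-derivative term plus the derivative of f
along the derivative of a field. The former cancels by symmetry; the latter leaves the Lie bracket
of the fields at 1, which is by definition the bracket of 𝔤. -/
lemma LD_LD_sub_one {f : G → ℂ} (hf : HolAt E f 1) :
    LD u (LD v f) 1 - LD v (LD u f) 1 = dAt f (1 : G) ⁅u, v⁆ := by
  set φ := extChartAt 𝓘(ℂ, E) (1 : G) with hφ
  set F : E → ℂ := fun s => f (φ.symm s) with hF
  have hφ1 : φ.symm (φ 1) = 1 := extChartAt_to_inv 1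
  have hFc : ContDiffAt ℂ ω F (φ 1) := by
    rw [← contMDiffAt_iff_contDiffAt]
    refine ContMDiffAt.comp (φ 1) (I' := 𝓘(ℂ, E)) (g := f) (by rw [hφ1]; exact hf) ?_
    exact (contMDiffOn_extChartAt_symm (1 : G)).contMDiffAt (extChartAt_target_mem_nhds (1 : G))
  have hFd : DifferentiableAt ℂ (fderiv ℂ F) (φ 1) :=
    (hFc.fderiv_right (m := ω) (by simp)).differentiableAt (by simp)
  have hsymm : IsSymmSndFDerivAt ℂ F (φ 1) := hFc.isSymmSndFDerivAt (by simp)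
  have key : ∀ u v : GroupLieAlgebra 𝓘(ℂ, E) G, LD u (LD v f) 1 =
      fderiv ℂ (fderiv ℂ F) (φ 1) (chartField u (φ 1)) (chartField v (φ 1)) +
        fderiv ℂ F (φ 1) (fderiv ℂ (chartField v) (φ 1) (chartField u (φ 1))) := by
    intro u v
    have h1 := (LD_eq_fderiv_chartField u (hf.LD v)).self_of_nhds
    simp only [← hφ, hφ1] at h1
    rw [h1, (LD_eq_fderiv_chartField v hf).fderiv_eq]
    have h4 := hFd.hasFDerivAt.clm_apply (differentiableAt_chartField v).hasFDerivAt
    refine (congrArg (fun L : E →L[ℂ] ℂ => L (chartField u (φ 1))) h4.fderiv).trans ?_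
    simp only [add_apply, ContinuousLinearMap.comp_apply,
      ContinuousLinearMap.flip_apply]
    exact add_comm _ _
  rw [key, key, hsymm.eq]
  have hb : dAt f (1 : G) ⁅u, v⁆ = fderiv ℂ F (φ 1) (VectorField.lieBracket ℂ (chartField u)
      (chartField v) (φ 1)) := by
    set w : E := VectorField.lieBracket ℂ (chartField u) (chartField v) (φ 1) with hw
    have hinv := isInvertible_mfderiv_extChartAt (I := 𝓘(ℂ, E))
      (mem_extChartAt_source (I := 𝓘(ℂ, E)) (1 : G))
    have h1 : ⁅u, v⁆ = (mfderiv 𝓘(ℂ, E) 𝓘(ℂ, E) φ (1 : G)).inverse w := by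
      have hset : φ.symm ⁻¹' Set.univ ∩ Set.range 𝓘(ℂ, E) = Set.univ := by simp
      rw [GroupLieAlgebra.bracket_def, ← VectorField.mlieBracketWithin_univ,
        VectorField.mlieBracketWithin_apply, hw, ← VectorField.lieBracketWithin_univ, ← hset]
      rfl
    have h2 : mfderiv 𝓘(ℂ, E) 𝓘(ℂ, E) φ (1 : G) ⁅u, v⁆ = w := by
      rw [h1]
      exact congrArg (fun L => L w) hinv.self_comp_inverse
    have h3 : (fun y => F (φ y)) =ᶠ[nhds 1] f := by
      filter_upwards [eventually_chart_inv (E := E) (1 : G)] with y hy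
      simp only [hF, hφ, hy]
    rw [← dAt_congr h3, dAt_comp (E' := E) (hFc.differentiableAt (by simp)).mdifferentiableAt
      ((contMDiffAt_extChartAt (n := ω)).mdifferentiableAt (by simp)), h2]
    simp only [dAt, mfderiv_eq_fderiv]
    rfl
  rw [hb, VectorField.lieBracket, map_sub]
  ring

include hf in
/-- The commutator of left-invariant vector fields. -/
theorem LD_LD_sub : LD u (LD v f) g - LD v (LD u f) g = LD ⁅u, v⁆ f g := by
  rw [LD_LD_mul_left hf, LD_LD_mul_left hf, LD_LD_sub_one _ _ hf.comp_mul_left, LD_eq hf]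

include hf in
/-- The commutator of right-invariant vector fields. -/
theorem RD_RD_sub : RD u (RD v f) g - RD v (RD u f) g = -RD ⁅u, v⁆ f g := by
  have h : HolAt₂ E E (fun s t => f (s * t * g)) 1 1 :=
    holAt₂_comp (fun p => p.1 * p.2 * g) (by simpa using hf)
      ((contMDiffAt_mul_pair _ _).mul contMDiffAt_const)
  -- Differentiating f(t s g) in t along v and in s along u gives an iterated left derivative at 1
  -- in the opposite order. This is the source of the minus sign.
  have key : ∀ u v : GroupLieAlgebra 𝓘(ℂ, E) G,
      RD u (RD v f) g = LD v (LD u fun t => f (t * g)) 1 := by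
    intro u v
    rw [RD_RD_eq hf, LD_LD_eq hf.comp_mul_right]
    simp only [one_mul]
    rw [h.dAt_dAt_comm v u]
    simp only [mul_assoc]
  rw [key, key, ← neg_sub, LD_LD_sub_one _ _ hf.comp_mul_right, RD_eq hf]

end Bracket

end LieGroupCalculus


/-! ### Prescribed differentials and local constancy -/

section Calculus

variable {E : Type*} [NormedAddCommGroup E] [NormedSpace ℂ E]
  {M : Type*} [TopologicalSpace M] [ChartedSpace E M]

lemma holAt_const (c : ℂ) (x : M) : HolAt E (fun _ : M => c) x := contMDiffAt_const

lemma dAt_add {f g : M → ℂ} {x : M} (hf : HolAt E f x) (hg : HolAt E g x)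
    (v : TangentSpace 𝓘(ℂ, E) x) :
    dAt (fun y => f y + g y) x v = dAt f x v + dAt g x v := by
  have h := (hf.mdifferentiableAt.hasMFDerivAt.add hg.mdifferentiableAt.hasMFDerivAt).mfderiv
  exact congrArg (fun L : TangentSpace 𝓘(ℂ, E) x →L[ℂ] ℂ => L v) h

lemma HolAt.sum {ι : Type*} {s : Finset ι} {f : ι → M → ℂ} {x : M}
    (hf : ∀ i ∈ s, HolAt E (f i) x) : HolAt E (fun y => ∑ i ∈ s, f i y) x := by
  classical
  induction s using Finset.induction_on with
  | empty => simpa using holAt_const 0 x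
  | insert a s ha ih =>
    simp only [Finset.sum_insert ha]
    exact (hf a (Finset.mem_insert_self a s)).add
      (ih fun i hi => hf i (Finset.mem_insert_of_mem hi))

lemma dAt_sum {ι : Type*} {s : Finset ι} {f : ι → M → ℂ} {x : M}
    (hf : ∀ i ∈ s, HolAt E (f i) x) (v : TangentSpace 𝓘(ℂ, E) x) :
    dAt (fun y => ∑ i ∈ s, f i y) x v = ∑ i ∈ s, dAt (f i) x v := by
  classical
  induction s using Finset.induction_on with
  | empty => simp [dAt_const]
  | insert a s ha ih =>
    have h : ∀ i ∈ s, HolAt E (f i) x := fun i hi => hf i (Finset.mem_insert_of_mem hi)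
    simp only [Finset.sum_insert ha]
    rw [dAt_add (hf a (Finset.mem_insert_self a s)) (HolAt.sum h), ih h]

lemma HolAt.mul_const {f : M → ℂ} {x : M} (hf : HolAt E f x) (c : ℂ) :
    HolAt E (fun y => f y * c) x := hf.mul (holAt_const c x)

lemma dAt_mul_const {f : M → ℂ} {x : M} (hf : HolAt E f x) (c : ℂ)
    (v : TangentSpace 𝓘(ℂ, E) x) : dAt (fun y => f y * c) x v = dAt f x v * c := by
  rw [dAt_mul hf (holAt_const c x), dAt_const]
  simp

/-- Every covector is the differential of a holomorphic function. -/
lemma exists_holAt_dAt_eq [FiniteDimensional ℂ E] [IsManifold 𝓘(ℂ, E) ω M] (x : M)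
    (l : TangentSpace 𝓘(ℂ, E) x →ₗ[ℂ] ℂ) :
    ∃ f : M → ℂ, HolAt E f x ∧ dAt f x = l := by
  have hinv := isInvertible_mfderiv_extChartAt (I := 𝓘(ℂ, E))
      (mem_extChartAt_source (I := 𝓘(ℂ, E)) x)
  set D := mfderiv 𝓘(ℂ, E) 𝓘(ℂ, E) (extChartAt 𝓘(ℂ, E) x) x
  let l' : E →ₗ[ℂ] ℂ := l ∘ₗ D.inverse.toLinearMap
  let L : E →L[ℂ] ℂ := LinearMap.toContinuousLinearMap l'
  have hφ : ContMDiffAt 𝓘(ℂ, E) 𝓘(ℂ, E) ω (extChartAt 𝓘(ℂ, E) x) x := contMDiffAt_extChartAt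
  refine ⟨fun y => L (extChartAt 𝓘(ℂ, E) x y), ?_, ?_⟩
  · exact HolAt.comp (E' := E) (f := fun y : E => L y) (L.contDiff.contMDiff.contMDiffAt) hφ
  · ext v
    rw [dAt_comp (E' := E) (f := fun y : E => L y) L.differentiableAt.mdifferentiableAt
      (hφ.mdifferentiableAt (by simp))]
    have h1 : dAt (F := E) (fun y : E => L y) (extChartAt 𝓘(ℂ, E) x x) = l' := by
      simp only [dAt, mfderiv_eq_fderiv]
      ext w
      exact congrArg (fun T : E →L[ℂ] ℂ => T w) L.fderiv
    rw [h1]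
    exact congrArg l (hinv.inverse_apply_self v)

/-- A function whose differential vanishes near a point is constant near that point. -/
lemma eventually_eq_of_dAt_eq_zero [IsManifold 𝓘(ℂ, E) ω M] {f : M → ℂ} {x : M}
    (hf : ∀ᶠ y in nhds x, HolAt E f y) (h0 : ∀ᶠ y in nhds x, dAt (F := E) f y = 0) :
    ∀ᶠ y in nhds x, f y = f x := by
  set φ := extChartAt 𝓘(ℂ, E) x with hφ
  have hφx : φ.symm (φ x) = x := extChartAt_to_inv x
  have hcont : Filter.Tendsto φ.symm (nhds (φ x)) (nhds x) := by
    have := continuousAt_extChartAt_symm (I := 𝓘(ℂ, E)) x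
    rwa [ContinuousAt, extChartAt_to_inv] at this
  have h1 : ∀ᶠ s in nhds (φ x), HasFDerivAt (fun s => f (φ.symm s)) (0 : E →L[ℂ] ℂ) s := by
    filter_upwards [hcont.eventually hf, hcont.eventually h0,
      extChartAt_target_mem_nhds (I := 𝓘(ℂ, E)) x] with s hs hs0 hst
    have hφs : ContMDiffAt 𝓘(ℂ, E) 𝓘(ℂ, E) ω φ.symm s :=
      (contMDiffOn_extChartAt_symm (n := ω) x).contMDiffAt
        ((isOpen_extChartAt_target (I := 𝓘(ℂ, E)) x).mem_nhds hst)
    have h3 : HolAt E (fun s => f (φ.symm s)) s := hs.comp hφs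
    have h4 := h3.mdifferentiableAt.differentiableAt.hasFDerivAt
    have h5 : fderiv ℂ (fun s => f (φ.symm s)) s = 0 := by
      ext w
      have := dAt_comp hs.mdifferentiableAt (hφs.mdifferentiableAt (by simp)) w
      rw [hs0] at this
      simp only [dAt, mfderiv_eq_fderiv] at this
      exact this
    rwa [h5] at h4
  obtain ⟨r, hr, hball⟩ := Metric.eventually_nhds_iff_ball.1 h1
  have h2 : ∀ s ∈ Metric.ball (φ x) r, f (φ.symm s) = f (φ.symm (φ x)) := by
    intro s hs
    refine (convex_ball (φ x) r).is_const_of_fderivWithin_eq_zero (𝕜 := ℂ)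
      (f := fun s => f (φ.symm s)) (fun t ht => (hball t ht).differentiableAt.differentiableWithinAt)
      (fun t ht => ?_) hs (Metric.mem_ball_self hr)
    rw [fderivWithin_of_isOpen Metric.isOpen_ball ht, (hball t ht).fderiv]
  have h3 : ∀ᶠ y in nhds x, φ y ∈ Metric.ball (φ x) r :=
    (continuousAt_extChartAt (I := 𝓘(ℂ, E)) x).eventually (Metric.ball_mem_nhds _ hr)
  filter_upwards [h3, eventually_chart_inv (E := E) x] with y hy hy'
  rw [← hφ] at hy'
  rw [← hy', h2 _ hy, hφx]

lemma apply_eq_of_dAt_eq_zero [IsManifold 𝓘(ℂ, E) ω M] [PreconnectedSpace M] {f : M → ℂ}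
    (hf : ∀ y, HolAt E f y) (h0 : ∀ y, dAt (F := E) f y = 0) (x y : M) : f x = f y := by
  have : IsLocallyConstant f := (IsLocallyConstant.iff_eventually_eq f).2 fun z =>
    eventually_eq_of_dAt_eq_zero (Filter.Eventually.of_forall hf) (Filter.Eventually.of_forall h0)
  exact this.apply_eq_of_preconnectedSpace x y

end Calculus

/-! ### The adjoint representation and its differential -/

section Adjoint

variable {E : Type*} [NormedAddCommGroup E] [NormedSpace ℂ E]
  {G : Type*} [Group G] [TopologicalSpace G] [ChartedSpace E G] [LieGroup 𝓘(ℂ, E) ω G]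

lemma contMDiffAt_conj (g x : G) :
    ContMDiffAt 𝓘(ℂ, E) 𝓘(ℂ, E) ω (fun a : G => g * a * g⁻¹) x :=
  (contMDiffAt_const.mul contMDiffAt_id).mul contMDiffAt_const

lemma dAt_Ad {f : G → ℂ} (hf : HolAt E f 1) (g : G) (v : GroupLieAlgebra 𝓘(ℂ, E) G) :
    dAt f (1 : G) (Ad g v) = dAt (fun t => f (g * t * g⁻¹)) (1 : G) v := by
  have e : g * 1 * g⁻¹ = 1 := by simp
  have hf' : MDifferentiableAt 𝓘(ℂ, E) 𝓘(ℂ, ℂ) f (g * 1 * g⁻¹) := by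
    rw [e]; exact hf.mdifferentiableAt
  have h := dAt_comp (g := fun t : G => g * t * g⁻¹) hf'
    ((contMDiffAt_conj g 1).mdifferentiableAt (by simp)) v
  rw [h]
  simp only [Ad]
  rw! [e]
  rfl

variable [FiniteDimensional ℂ E]

/-- Linear functionals separate vectors, and each is the differential of a holomorphic function.
Identities between tangent vectors can thus be verified on functions. -/
lemma eq_of_forall_dAt_eq {x : G} {v w : TangentSpace 𝓘(ℂ, E) x}
    (h : ∀ f : G → ℂ, HolAt E f x → dAt f x v = dAt f x w) : v = w := by
  by_contra hne
  have hne' : (v - w : E) ≠ 0 := sub_ne_zero.2 hne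
  obtain ⟨l, hl⟩ : ∃ l : E →ₗ[ℂ] ℂ, l (v - w : E) ≠ 0 := by
    by_contra hc
    push Not at hc
    exact hne' ((Module.forall_dual_apply_eq_zero_iff ℂ (v - w : E)).1 hc)
  obtain ⟨f, hf, hfl⟩ := exists_holAt_dAt_eq (E := E) x l
  have := h f hf
  rw [hfl] at this
  exact hl ((map_sub l (v : E) (w : E)).trans (sub_eq_zero.2 this))

lemma Ad_one_apply (v : GroupLieAlgebra 𝓘(ℂ, E) G) : Ad (1 : G) v = v := by
  refine eq_of_forall_dAt_eq (x := (1 : G)) fun f hf => ?_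
  rw [dAt_Ad hf]
  simp

lemma HolAt.comp_conj {f : G → ℂ} (hf : HolAt E f 1) (g : G) :
    HolAt E (fun t => f (g * t * g⁻¹)) 1 :=
  HolAt.comp (g := fun t : G => g * t * g⁻¹) (by simpa using hf) (contMDiffAt_conj g 1)

lemma Ad_mul_apply (g h : G) (v : GroupLieAlgebra 𝓘(ℂ, E) G) : Ad (g * h) v = Ad g (Ad h v) := by
  refine eq_of_forall_dAt_eq (x := (1 : G)) fun f hf => ?_
  rw [dAt_Ad hf, dAt_Ad hf, dAt_Ad (hf.comp_conj g)]
  simp [mul_assoc]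

/-- Both sides differentiate f(g t g⁻¹ · g) = f(g t) at t = 1. -/
lemma RD_Ad {f : G → ℂ} {g : G} (hf : HolAt E f g) (v : GroupLieAlgebra 𝓘(ℂ, E) G) :
    RD (Ad g v) f g = LD v f g := by
  rw [RD_eq hf, LD_eq hf, dAt_Ad hf.comp_mul_right]
  simp [mul_assoc]

lemma dRight_Ad (g : G) (v : GroupLieAlgebra 𝓘(ℂ, E) G) : dRight g (Ad g v) = dLeft g v :=
  eq_of_forall_dAt_eq fun _ hf => RD_Ad hf v

lemma dRight_surjective (g : G) : Function.Surjective (dRight (E := E) g) := by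
  intro w
  have h1 : MDifferentiableAt 𝓘(ℂ, E) 𝓘(ℂ, E) (fun a : G => a * g⁻¹) g :=
    (contMDiffAt_mul_right' g⁻¹ g).mdifferentiableAt (by simp)
  let u : GroupLieAlgebra 𝓘(ℂ, E) G := mfderiv 𝓘(ℂ, E) 𝓘(ℂ, E) (fun a : G => a * g⁻¹) g w
  refine ⟨u, eq_of_forall_dAt_eq fun f hf => ?_⟩
  have h2 : MDifferentiableAt 𝓘(ℂ, E) 𝓘(ℂ, ℂ) (fun t => f (t * g)) (g * g⁻¹) := by
    rw [mul_inv_cancel]; exact hf.comp_mul_right.mdifferentiableAt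
  have h3 := dAt_comp (f := fun t => f (t * g)) (g := fun a : G => a * g⁻¹) h2 h1 w
  simp only [inv_mul_cancel_right] at h3
  change RD u f g = _
  rw [RD_eq hf, h3]
  rw! [mul_inv_cancel g]
  rfl

/-- If l is the differential of f at 1, then l(Ad_x v) is a partial derivative of (s, t) ↦ f(s t
s⁻¹). -/
lemma holAt_apply_Ad (l : GroupLieAlgebra 𝓘(ℂ, E) G →ₗ[ℂ] ℂ) (v : GroupLieAlgebra 𝓘(ℂ, E) G)
    (g : G) : HolAt E (fun x : G => l (Ad x v)) g := by
  obtain ⟨f, hf, hfl⟩ := exists_holAt_dAt_eq (E := E) (1 : G) l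
  have h : HolAt₂ E E (fun s t => f (s * t * s⁻¹)) g 1 :=
    holAt₂_comp (fun p => p.1 * p.2 * p.1⁻¹) (by simpa using hf)
      ((contMDiffAt_fst.mul contMDiffAt_snd).mul contMDiffAt_fst.inv)
  refine (h.dAt_right v).congr (Filter.Eventually.of_forall fun x => ?_)
  simp only [← hfl]
  exact dAt_Ad hf x v

/-- The differential of `Ad` at `1` is `ad`. -/
lemma dAt_apply_Ad_one (l : GroupLieAlgebra 𝓘(ℂ, E) G →ₗ[ℂ] ℂ) (u v : GroupLieAlgebra 𝓘(ℂ, E) G) :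
    dAt (fun x : G => l (Ad x v)) 1 u = l ⁅u, v⁆ := by
  obtain ⟨f, hf, hfl⟩ := exists_holAt_dAt_eq (E := E) (1 : G) l
  let e := Module.finBasis ℂ (GroupLieAlgebra 𝓘(ℂ, E) G)
  have hexp : ∀ w : GroupLieAlgebra 𝓘(ℂ, E) G, w = ∑ i, e.coord i w • e i := fun w =>
    (e.sum_repr w).symm
  have hRD : ∀ (w : GroupLieAlgebra 𝓘(ℂ, E) G) (F : G → ℂ) (x : G),
      RD w F x = ∑ i, e.coord i w * RD (e i) F x := by
    intro w F x
    conv_lhs => rw [hexp w]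
    simp only [RD, map_sum, map_smul, smul_eq_mul]
  -- The left-invariant field of v is expanded in the right-invariant frame, with the coordinates of
  -- Ad_x v as coefficients. Left and right derivatives commute, so in the commutator with u only
  -- the derivatives of the coefficients remain.
  have h1 : LD v f =ᶠ[nhds 1] fun x => ∑ i, e.coord i (Ad x v) * RD (e i) f x := by
    filter_upwards [hf.eventually] with x hx
    rw [← RD_Ad hx, hRD]
  have h2 : LD u (LD v f) 1 = ∑ i, (dAt (fun x : G => e.coord i (Ad x v)) 1 u * l (e i) +
      e.coord i v * LD u (RD (e i) f) 1) := by
    rw [LD_congr h1, LD_one, dAt_sum fun i _ => (holAt_apply_Ad _ _ _).mul (hf.RD _)]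
    refine Finset.sum_congr rfl fun i _ => ?_
    rw [dAt_mul (holAt_apply_Ad _ _ _) (hf.RD _), RD_one, hfl, Ad_one_apply, ← LD_one u (RD (e i) f)]
  have h3 : LD v (LD u f) 1 = ∑ i, e.coord i v * LD u (RD (e i) f) 1 := by
    rw [LD_one, ← RD_one, hRD]
    simp only [LD_RD_comm hf]
  have h4 : dAt (fun x : G => l (Ad x v)) 1 u =
      ∑ i, dAt (fun x : G => e.coord i (Ad x v)) 1 u * l (e i) := by
    have : (fun x : G => l (Ad x v)) = fun x => ∑ i, e.coord i (Ad x v) * l (e i) := by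
      ext x
      conv_lhs => rw [hexp (Ad x v)]
      simp only [map_sum, map_smul, smul_eq_mul]
    rw [this, dAt_sum fun i _ => (holAt_apply_Ad _ _ _).mul_const _]
    exact Finset.sum_congr rfl fun i _ => dAt_mul_const (holAt_apply_Ad _ _ _) _ _
  rw [h4, ← hfl, ← LD_LD_sub_one u v hf, h2, h3, Finset.sum_add_distrib, hfl]
  ring

lemma LD_apply_Ad (l : GroupLieAlgebra 𝓘(ℂ, E) G →ₗ[ℂ] ℂ) (u v : GroupLieAlgebra 𝓘(ℂ, E) G)
    (g : G) : LD u (fun x : G => l (Ad x v)) g = l (Ad g ⁅u, v⁆) := by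
  rw [LD_eq (holAt_apply_Ad _ _ _)]
  simp only [Ad_mul_apply]
  exact dAt_apply_Ad_one (l ∘ₗ Ad g) u v

lemma RD_apply_Ad (l : GroupLieAlgebra 𝓘(ℂ, E) G →ₗ[ℂ] ℂ) (u v : GroupLieAlgebra 𝓘(ℂ, E) G)
    (g : G) : RD u (fun x : G => l (Ad x v)) g = l ⁅u, Ad g v⁆ := by
  rw [RD_eq (holAt_apply_Ad _ _ _)]
  simp only [Ad_mul_apply]
  exact dAt_apply_Ad_one l u (Ad g v)

/-- An invariant form on a connected Lie group is `Ad`-invariant. -/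
theorem form_Ad_of_connected [ConnectedSpace G] (B : LinearMap.BilinForm ℂ (GroupLieAlgebra 𝓘(ℂ, E) G))
    (hB : B.lieInvariant (GroupLieAlgebra 𝓘(ℂ, E) G)) (g : G)
    (v w : GroupLieAlgebra 𝓘(ℂ, E) G) : B (Ad g v) (Ad g w) = B v w := by
  let e := Module.finBasis ℂ (GroupLieAlgebra 𝓘(ℂ, E) G)
  have hfun : ∀ y z : GroupLieAlgebra 𝓘(ℂ, E) G, B y z = ∑ i, e.coord i y * B (e i) z := by
    intro y z
    conv_lhs => rw [← e.sum_repr y]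
    simp only [map_sum, map_smul, LinearMap.sum_apply, LinearMap.smul_apply, smul_eq_mul]
    rfl
  have hhol : ∀ x : G, HolAt E (fun x : G => B (Ad x v) (Ad x w)) x := by
    intro x
    simp only [hfun (Ad _ v)]
    exact HolAt.sum fun i _ => (holAt_apply_Ad _ _ _).mul (holAt_apply_Ad (B (e i)) _ _)
  -- By the Leibniz rule the derivative along u is B([u, Ad v], Ad w) + B(Ad v, [u, Ad w]), which
  -- vanishes by invariance. The right-invariant fields span every tangent space, so connectedness
  -- gives a constant function.
  have hRD : ∀ (u : GroupLieAlgebra 𝓘(ℂ, E) G) (x : G),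
      RD u (fun x : G => B (Ad x v) (Ad x w)) x = 0 := by
    intro u x
    have h1 : RD u (fun x : G => B (Ad x v) (Ad x w)) x =
        B ⁅u, Ad x v⁆ (Ad x w) + B (Ad x v) ⁅u, Ad x w⁆ := by
      simp only [hfun (Ad _ v), hfun ⁅u, Ad x v⁆]
      rw [RD, dAt_sum fun i _ => (holAt_apply_Ad _ _ _).mul (holAt_apply_Ad (B (e i)) _ _),
        ← Finset.sum_add_distrib]
      refine Finset.sum_congr rfl fun i _ => ?_
      rw [dAt_mul (holAt_apply_Ad _ _ _) (holAt_apply_Ad (B (e i)) _ _)]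
      change RD u _ x * _ + _ * RD u _ x = _
      rw [RD_apply_Ad, RD_apply_Ad]
    rw [h1, hB u (Ad x v) (Ad x w)]
    ring
  have h0 : ∀ x : G, dAt (F := E) (fun x : G => B (Ad x v) (Ad x w)) x = 0 := by
    intro x
    ext t
    obtain ⟨u, rfl⟩ := dRight_surjective (E := E) x t
    exact hRD u x
  have := apply_eq_of_dAt_eq_zero hhol h0 g 1
  simpa only [Ad_one_apply] using this

end Adjoint


/-! ### Submersions: local sections, fibres, curves in fibres -/

section Submersion

universe u

variable {E : Type u} [NormedAddCommGroup E] [NormedSpace ℂ E]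
  {M : Type*} [TopologicalSpace M] [ChartedSpace E M]
  {F : Type*} [NormedAddCommGroup F] [NormedSpace ℂ F]
  {N : Type*} [TopologicalSpace N] [ChartedSpace F N]

/-- A submersion is a projection in suitable holomorphic coordinates. -/
lemma exists_submersion_coordinates [IsManifold 𝓘(ℂ, E) ω M] [IsManifold 𝓘(ℂ, F) ω N] {f : M → N}
    {x : M} (h : Manifold.IsSubmersionAt 𝓘(ℂ, E) 𝓘(ℂ, F) ω f x) :
    ∃ (K : Type u) (_ : NormedAddCommGroup K) (_ : NormedSpace ℂ K)
      (φ : OpenPartialHomeomorph M (F × K)) (χ : OpenPartialHomeomorph N F),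
      x ∈ φ.source ∧ f x ∈ χ.source ∧ (∀ y ∈ φ.source, f y ∈ χ.source ∧ χ (f y) = (φ y).1) ∧
      (∀ y ∈ φ.source, ContMDiffAt 𝓘(ℂ, E) 𝓘(ℂ, F × K) ω φ y) ∧
      (∀ y ∈ φ.target, ContMDiffAt 𝓘(ℂ, F × K) 𝓘(ℂ, E) ω φ.symm y) ∧
      (∀ y ∈ χ.source, ContMDiffAt 𝓘(ℂ, F) 𝓘(ℂ, F) ω χ y) ∧
      (∀ y ∈ χ.target, ContMDiffAt 𝓘(ℂ, F) 𝓘(ℂ, F) ω χ.symm y) := by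
  refine ⟨h.complement, inferInstance, inferInstance,
    h.domChart.trans h.equiv.toHomeomorph.toOpenPartialHomeomorph, h.codChart, ?_, ?_, ?_, ?_, ?_,
    ?_, ?_⟩
  · simpa using h.mem_domChart_source
  · exact h.mem_codChart_source
  · intro y hy
    have hy' : y ∈ h.domChart.source := by simpa using hy
    refine ⟨h.source_subset_preimage_source hy', ?_⟩
    have h1 : h.domChart.extend 𝓘(ℂ, E) y ∈ (h.domChart.extend 𝓘(ℂ, E)).target :=
      (h.domChart.extend 𝓘(ℂ, E)).map_source (by simpa using hy')
    have h2 := h.writtenInCharts h1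
    simp only [Function.comp_apply] at h2
    rw [(h.domChart.extend 𝓘(ℂ, E)).left_inv (by simpa using hy')] at h2
    exact h2
  · intro y hy
    have hy' : y ∈ h.domChart.source := by simpa using hy
    have h1 : ContMDiffAt 𝓘(ℂ, E) 𝓘(ℂ, E) ω h.domChart y :=
      contMDiffAt_of_mem_maximalAtlas h.domChart_mem_maximalAtlas hy'
    exact (h.equiv.contDiff.contMDiff.contMDiffAt).comp y h1
  · intro y hy
    have hy' : h.equiv.symm y ∈ h.domChart.target := by simpa using hy
    have h1 : ContMDiffAt 𝓘(ℂ, E) 𝓘(ℂ, E) ω h.domChart.symm (h.equiv.symm y) :=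
      contMDiffAt_symm_of_mem_maximalAtlas h.domChart_mem_maximalAtlas hy'
    exact h1.comp y (h.equiv.symm.contDiff.contMDiff.contMDiffAt)
  · intro y hy
    exact contMDiffAt_of_mem_maximalAtlas h.codChart_mem_maximalAtlas hy
  · intro y hy
    exact contMDiffAt_symm_of_mem_maximalAtlas h.codChart_mem_maximalAtlas hy

variable [IsManifold 𝓘(ℂ, E) ω M] [IsManifold 𝓘(ℂ, F) ω N] {f : M → N} {x : M}

/-- A submersion has local holomorphic sections. -/
lemma exists_local_section (h : Manifold.IsSubmersionAt 𝓘(ℂ, E) 𝓘(ℂ, F) ω f x) :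
    ∃ s : N → M, ContMDiffAt 𝓘(ℂ, F) 𝓘(ℂ, E) ω s (f x) ∧ s (f x) = x ∧
      ∀ᶠ y in nhds (f x), f (s y) = y := by
  obtain ⟨K, _, _, φ, χ, hx, hfx, hφχ, hφ, hφs, hχ, -⟩ := exists_submersion_coordinates h
  have e : (χ (f x), (φ x).2) = φ x := by rw [(hφχ x hx).2]
  have hin : ContMDiffAt 𝓘(ℂ, F) 𝓘(ℂ, F × K) ω (fun y => (χ y, (φ x).2)) (f x) :=
    (hχ _ hfx).prodMk_space contMDiffAt_const
  have htar : ∀ᶠ y in nhds (f x), (χ y, (φ x).2) ∈ φ.target := by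
    refine hin.continuousAt.eventually_mem (φ.open_target.mem_nhds ?_)
    rw [e]; exact φ.map_source hx
  refine ⟨fun y => φ.symm (χ y, (φ x).2), ?_, ?_, ?_⟩
  · refine ContMDiffAt.comp (I' := 𝓘(ℂ, F × K)) (f x) (g := φ.symm)
      (f := fun y => (χ y, (φ x).2)) (hφs _ ?_) hin
    rw [e]; exact φ.map_source hx
  · change φ.symm (χ (f x), (φ x).2) = x
    rw [e, φ.left_inv hx]
  · filter_upwards [htar, χ.open_source.mem_nhds hfx] with y hy hy'
    have h1 := hφχ _ (φ.map_target hy)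
    rw [φ.right_inv hy] at h1
    exact χ.injOn h1.1 hy' h1.2

/-- A function whose differential vanishes on the kernel of the differential of a submersion is
locally constant along the fibres. -/
lemma eventually_eq_of_dAt_eq_zero_of_mfderiv
    (h : Manifold.IsSubmersionAt 𝓘(ℂ, E) 𝓘(ℂ, F) ω f x) (hf : ContMDiff 𝓘(ℂ, E) 𝓘(ℂ, F) ω f)
    {q : M → ℂ} (hq : ∀ y, HolAt E q y)
    (hq0 : ∀ y, f y = f x → ∀ v : E, mfderiv 𝓘(ℂ, E) 𝓘(ℂ, F) f y v = (0 : F) →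
      dAt (F := E) q y v = 0) :
    ∀ᶠ y in nhds x, f y = f x → q y = q x := by
  obtain ⟨K, _, _, φ, χ, hx, hfx, hφχ, hφ, hφs, hχ, -⟩ := exists_submersion_coordinates h
  -- In coordinates adapted to the submersion, the fibre through x is the slice with first component
  -- fixed.
  set j : K → F × K := fun k => ((φ x).1, k) with hj
  have hjc : ContMDiff 𝓘(ℂ, K) 𝓘(ℂ, F × K) ω j := contMDiff_const.prodMk_space contMDiff_id
  have hjx : j (φ x).2 = φ x := rfl
  have htar : ∀ᶠ k in nhds (φ x).2, j k ∈ φ.target :=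
    (hjc.continuous.tendsto _).eventually_mem
      (φ.open_target.mem_nhds (by rw [hjx]; exact φ.map_source hx))
  have hψ : ∀ k, j k ∈ φ.target → ContMDiffAt 𝓘(ℂ, K) 𝓘(ℂ, E) ω (fun k => φ.symm (j k)) k :=
    fun k hk => ContMDiffAt.comp (I' := 𝓘(ℂ, F × K)) k (g := φ.symm) (f := j) (hφs _ hk)
      (hjc k)
  have hfψ : ∀ k, j k ∈ φ.target → f (φ.symm (j k)) = f x := by
    intro k hk
    have h1 := hφχ _ (φ.map_target hk)
    rw [φ.right_inv hk] at h1
    exact χ.injOn h1.1 hfx (h1.2.trans (hφχ x hx).2.symm)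
  have hloc := eventually_eq_of_dAt_eq_zero (E := K) (f := fun k => q (φ.symm (j k)))
    (x := (φ x).2) (htar.mono fun k hk => (hq _).comp (hψ k hk)) ?_
  · have hφc : ContinuousAt (fun y => (φ y).2) x := (hφ x hx).continuousAt.snd
    filter_upwards [hφc.eventually hloc, φ.open_source.mem_nhds hx] with y hy hys hfy
    have e : j (φ y).2 = φ y := by
      refine Prod.ext ?_ rfl
      change (φ x).1 = (φ y).1
      rw [← (hφχ x hx).2, ← (hφχ y hys).2, hfy]
    rw [e, hjx, φ.left_inv hys, φ.left_inv hx] at hy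
    exact hy
  · filter_upwards [eventually_eventually_nhds.2 htar] with k hk
    have hk0 := hk.self_of_nhds
    have key : ∀ v : K, dAt (F := K) (fun k => q (φ.symm (j k))) k v = 0 := by
      intro v
      refine (dAt_comp (g := fun k => φ.symm (j k)) (hq _).mdifferentiableAt
        ((hψ k hk0).mdifferentiableAt (by simp)) v).trans ?_
      refine hq0 _ (hfψ k hk0) _ ?_
      have h2 := mfderiv_comp (I := 𝓘(ℂ, K)) (I' := 𝓘(ℂ, E)) (I'' := 𝓘(ℂ, F)) k
        (g := f) (f := fun k => φ.symm (j k)) ((hf _).mdifferentiableAt (by simp))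
        ((hψ k hk0).mdifferentiableAt (by simp))
      have h3 : mfderiv 𝓘(ℂ, K) 𝓘(ℂ, F) (f ∘ fun k => φ.symm (j k)) k = (0 : K →L[ℂ] F) := by
        have : (f ∘ fun k => φ.symm (j k)) =ᶠ[nhds k] fun _ => f x := hk.mono fun k hk => hfψ k hk
        refine this.mfderiv_eq.trans mfderiv_const
      exact (congrArg (fun L : K →L[ℂ] F => L v) h2).symm.trans
        (congrArg (fun L : K →L[ℂ] F => L v) h3)
    exact LinearMap.ext key

/-- Every vector in the kernel of the differential of a submersion is the velocity of a holomorphic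
curve in the fibre. -/
lemma exists_curve_of_mfderiv_eq_zero
    (h : Manifold.IsSubmersionAt 𝓘(ℂ, E) 𝓘(ℂ, F) ω f x) (hf : ContMDiff 𝓘(ℂ, E) 𝓘(ℂ, F) ω f)
    {v : E} (hv : mfderiv 𝓘(ℂ, E) 𝓘(ℂ, F) f x v = (0 : F)) :
    ∃ c : ℂ → M, ContMDiffAt 𝓘(ℂ, ℂ) 𝓘(ℂ, E) ω c 0 ∧ c 0 = x ∧
      (∀ᶠ z in nhds (0 : ℂ), f (c z) = f x) ∧ mfderiv 𝓘(ℂ, ℂ) 𝓘(ℂ, E) c 0 (1 : ℂ) = v := by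
  obtain ⟨K, _, _, φ, χ, hx, hfx, hφχ, hφ, hφs, hχ, -⟩ := exists_submersion_coordinates h
  -- The curve is the straight line in direction w in adapted coordinates. The first component of w
  -- is the image of df(v) = 0 under the chart, so the line stays in the fibre.
  set w : F × K := mfderiv 𝓘(ℂ, E) 𝓘(ℂ, F × K) φ x v with hw
  have hφd := (hφ x hx).mdifferentiableAt (by simp)
  have hw1 : w.1 = 0 := by
    have e1 : (fun y => χ (f y)) =ᶠ[nhds x] fun y => (φ y).1 :=
      Filter.eventually_of_mem (φ.open_source.mem_nhds hx) fun y hy => (hφχ y hy).2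
    have h1 := mfderiv_comp (I := 𝓘(ℂ, E)) (I' := 𝓘(ℂ, F)) (I'' := 𝓘(ℂ, F)) x (g := χ) (f := f)
      ((hχ _ hfx).mdifferentiableAt (by simp)) ((hf x).mdifferentiableAt (by simp))
    have h2 := mfderiv_comp (I := 𝓘(ℂ, E)) (I' := 𝓘(ℂ, F × K)) (I'' := 𝓘(ℂ, F)) x
      (g := Prod.fst) (f := φ) (contDiff_fst.contMDiff.mdifferentiable (n := ω) (by simp) _) hφd
    have h3 : mfderiv 𝓘(ℂ, F × K) 𝓘(ℂ, F) (Prod.fst : F × K → F) (φ x) =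
        ContinuousLinearMap.fst ℂ F K := by
      rw [mfderiv_eq_fderiv]; exact fderiv_fst
    rw [h3] at h2
    have h4 := congrArg (fun L : E →L[ℂ] F => L v) (h1.symm.trans (e1.mfderiv_eq.trans h2))
    refine Eq.trans ?_ (h4.symm.trans ?_)
    · rfl
    · change mfderiv 𝓘(ℂ, F) 𝓘(ℂ, F) χ (f x) (mfderiv 𝓘(ℂ, E) 𝓘(ℂ, F) f x v) = _
      exact (congrArg _ hv).trans (map_zero _)
  set l : ℂ → F × K := fun z => φ x + z • w with hl
  have hlc : ContMDiff 𝓘(ℂ, ℂ) 𝓘(ℂ, F × K) ω l :=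
    (contDiff_const.add (contDiff_id.smul contDiff_const)).contMDiff
  have hl0 : l 0 = φ x := by simp [hl]
  have htar : ∀ᶠ z in nhds (0 : ℂ), l z ∈ φ.target :=
    (hlc.continuous.tendsto _).eventually_mem
      (φ.open_target.mem_nhds (by rw [hl0]; exact φ.map_source hx))
  have hsx : ContMDiffAt 𝓘(ℂ, F × K) 𝓘(ℂ, E) ω φ.symm (φ x) := hφs _ (φ.map_source hx)
  refine ⟨fun z => φ.symm (l z), ?_, ?_, ?_, ?_⟩
  · refine ContMDiffAt.comp (I' := 𝓘(ℂ, F × K)) 0 (g := φ.symm) (f := l) ?_ (hlc 0)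
    rw [hl0]; exact hsx
  · change φ.symm (l 0) = x
    rw [hl0, φ.left_inv hx]
  · filter_upwards [htar] with z hz
    have h1 := hφχ _ (φ.map_target hz)
    rw [φ.right_inv hz] at h1
    refine χ.injOn h1.1 hfx (h1.2.trans ?_)
    rw [(hφχ x hx).2]
    simp [hl, hw1]
  · have h1 : MDifferentiableAt 𝓘(ℂ, F × K) 𝓘(ℂ, E) φ.symm (l 0) := by
      rw [hl0]; exact hsx.mdifferentiableAt (by simp)
    have h2 := mfderiv_comp (I := 𝓘(ℂ, ℂ)) (I' := 𝓘(ℂ, F × K)) (I'' := 𝓘(ℂ, E)) (0 : ℂ)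
      (g := φ.symm) (f := l) h1 ((hlc 0).mdifferentiableAt (by simp))
    have h3 : mfderiv 𝓘(ℂ, ℂ) 𝓘(ℂ, F × K) l 0 (1 : ℂ) = w := by
      rw [mfderiv_eq_fderiv]
      have h7 := ((hasDerivAt_id (0 : ℂ)).smul_const w).const_add (φ x)
      rw [one_smul] at h7
      exact (congrArg (fun L : ℂ →L[ℂ] F × K => L 1) h7.hasFDerivAt.fderiv).trans
        (one_smul ℂ w)
    have h4 := mfderiv_comp (I := 𝓘(ℂ, E)) (I' := 𝓘(ℂ, F × K)) (I'' := 𝓘(ℂ, E)) x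
      (g := φ.symm) (f := φ) (hsx.mdifferentiableAt (by simp)) hφd
    have h5 : (φ.symm ∘ φ) =ᶠ[nhds x] id :=
      Filter.eventually_of_mem (φ.open_source.mem_nhds hx) fun y hy => φ.left_inv hy
    have h6 := congrArg (fun L : E →L[ℂ] E => L v)
      (h4.symm.trans (h5.mfderiv_eq.trans mfderiv_id))
    refine (congrArg (fun L : ℂ →L[ℂ] E => L 1) h2).trans ?_
    refine Eq.trans ?_ h6
    change mfderiv 𝓘(ℂ, F × K) 𝓘(ℂ, E) φ.symm (l 0) (mfderiv 𝓘(ℂ, ℂ) 𝓘(ℂ, F × K) l 0 (1 : ℂ)) =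
      mfderiv 𝓘(ℂ, F × K) 𝓘(ℂ, E) φ.symm (φ x) w
    rw [h3]
    exact congrArg (fun y : F × K => (mfderiv 𝓘(ℂ, F × K) 𝓘(ℂ, E) φ.symm y : F × K →L[ℂ] E) w) hl0

end Submersion


/-! ### The Jacobiator of a bracket given by vector fields -/

section Jacobi

variable {E : Type*} [NormedAddCommGroup E] [NormedSpace ℂ E]
  {M : Type*} [TopologicalSpace M] [ChartedSpace E M] [IsManifold 𝓘(ℂ, E) ω M]

/-- The derivative of a function along a vector field. -/
def fieldDeriv (p : ∀ x : M, TangentSpace 𝓘(ℂ, E) x) (f : M → ℂ) (x : M) : ℂ := dAt f x (p x)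

/-- The bracket `∑ (p_i f) (q_i g)`. -/
def fieldBracket {ι : Type*} [Fintype ι] (p q : ι → ∀ x : M, TangentSpace 𝓘(ℂ, E) x)
    (f g : M → ℂ) (x : M) : ℂ := ∑ i, fieldDeriv (p i) f x * fieldDeriv (q i) g x

variable {ι : Type*} [Fintype ι] {p q : ι → ∀ x : M, TangentSpace 𝓘(ℂ, E) x}

lemma fieldDeriv_congr {f g : M → ℂ} {x : M} (e : f =ᶠ[nhds x] g)
    (p : ∀ x : M, TangentSpace 𝓘(ℂ, E) x) : fieldDeriv p f x = fieldDeriv p g x := by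
  simp only [fieldDeriv]
  rw [dAt_congr e]

lemma fieldDeriv_neg {f : M → ℂ} {x : M} (hf : HolAt E f x)
    (p : ∀ x : M, TangentSpace 𝓘(ℂ, E) x) :
    fieldDeriv p (fun y => -f y) x = -fieldDeriv p f x := by
  have h := dAt_mul_const hf (-1) (p x)
  simp only [mul_neg, mul_one] at h
  exact h

lemma fieldDeriv_fieldBracket (hp : ∀ i (f : M → ℂ) x, HolAt E f x → HolAt E (fieldDeriv (p i) f) x)
    (hq : ∀ i (f : M → ℂ) x, HolAt E f x → HolAt E (fieldDeriv (q i) f) x)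
    {f g : M → ℂ} {x : M} (hf : HolAt E f x) (hg : HolAt E g x)
    (r : ∀ x : M, TangentSpace 𝓘(ℂ, E) x) :
    fieldDeriv r (fieldBracket p q f g) x =
      ∑ k, (fieldDeriv r (fieldDeriv (p k) f) x * fieldDeriv (q k) g x +
        fieldDeriv (p k) f x * fieldDeriv r (fieldDeriv (q k) g) x) := by
  refine (dAt_sum (f := fun k y => fieldDeriv (p k) f y * fieldDeriv (q k) g y)
    (fun k _ => (hp k f x hf).mul (hq k g x hg)) (r x)).trans ?_
  exact Finset.sum_congr rfl fun k _ => dAt_mul (hp k f x hf) (hq k g x hg) (r x)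

/-- The Jacobiator of a skew-symmetric bracket in terms of commutators of vector fields. -/
theorem fieldBracket_jacobiator
    (hp : ∀ i (f : M → ℂ) x, HolAt E f x → HolAt E (fieldDeriv (p i) f) x)
    (hq : ∀ i (f : M → ℂ) x, HolAt E f x → HolAt E (fieldDeriv (q i) f) x)
    (hskew : ∀ (f g : M → ℂ) x, HolAt E f x → HolAt E g x →
      fieldBracket p q f g x = -fieldBracket p q g f x)
    {f g h : M → ℂ} {x : M} (hf : HolAt E f x) (hg : HolAt E g x) (hh : HolAt E h x) :
    fieldBracket p q f (fieldBracket p q g h) x + fieldBracket p q g (fieldBracket p q h f) x +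
        fieldBracket p q h (fieldBracket p q f g) x =
      ∑ i, ∑ k,
        ((fieldDeriv (p i) (fieldDeriv (p k) f) x - fieldDeriv (p k) (fieldDeriv (p i) f) x) *
            (fieldDeriv (q i) g x * fieldDeriv (q k) h x) +
          fieldDeriv (p i) f x *
            ((fieldDeriv (q i) (fieldDeriv (p k) g) x - fieldDeriv (p k) (fieldDeriv (q i) g) x) *
              fieldDeriv (q k) h x) +
          fieldDeriv (p i) f x * (fieldDeriv (p k) g x *
            (fieldDeriv (q i) (fieldDeriv (q k) h) x - fieldDeriv (q k) (fieldDeriv (q i) h) x))) := by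
  have hbr : ∀ {f g : M → ℂ} {x}, HolAt E f x → HolAt E g x →
      HolAt E (fieldBracket p q f g) x := fun hf hg =>
    HolAt.sum fun k _ => (hp k _ _ hf).mul (hq k _ _ hg)
  -- The inner bracket of the second cyclic term and the outer bracket of the third are reversed by
  -- skew-symmetry. Second derivatives then occur in pairs with the two fields in opposite order.
  have e2 : fieldBracket p q h f =ᶠ[nhds x] fun y => -fieldBracket p q f h y := by
    filter_upwards [hf.eventually, hh.eventually] with y hfy hhy using hskew h f y hhy hfy
  have t1 : fieldBracket p q f (fieldBracket p q g h) x = ∑ i, ∑ k, fieldDeriv (p i) f x *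
      (fieldDeriv (q i) (fieldDeriv (p k) g) x * fieldDeriv (q k) h x +
        fieldDeriv (p k) g x * fieldDeriv (q i) (fieldDeriv (q k) h) x) :=
    Finset.sum_congr rfl fun i _ => by
      rw [fieldDeriv_fieldBracket hp hq hg hh, Finset.mul_sum]
  have t2 : fieldBracket p q g (fieldBracket p q h f) x = -∑ i, ∑ k, fieldDeriv (p i) g x *
      (fieldDeriv (q i) (fieldDeriv (p k) f) x * fieldDeriv (q k) h x +
        fieldDeriv (p k) f x * fieldDeriv (q i) (fieldDeriv (q k) h) x) := by
    rw [← Finset.sum_neg_distrib]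
    refine Finset.sum_congr rfl fun i _ => ?_
    rw [fieldDeriv_congr e2, fieldDeriv_neg (hbr hf hh), fieldDeriv_fieldBracket hp hq hf hh,
      mul_neg, Finset.mul_sum]
  have t3 : fieldBracket p q h (fieldBracket p q f g) x = -∑ i, ∑ k,
      (fieldDeriv (p i) (fieldDeriv (p k) f) x * fieldDeriv (q k) g x +
        fieldDeriv (p k) f x * fieldDeriv (p i) (fieldDeriv (q k) g) x) * fieldDeriv (q i) h x := by
    rw [hskew _ _ x hh (hbr hf hg)]
    refine congrArg Neg.neg (Finset.sum_congr rfl fun i _ => ?_)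
    rw [fieldDeriv_fieldBracket hp hq hf hg, Finset.sum_mul]
  -- Skew-symmetry applied to g and p_k f exchanges q_i p_k f for p_i p_k f, the one term that does
  -- not match after renaming indices.
  have s1 : ∑ i, ∑ k, fieldDeriv (p i) g x *
        (fieldDeriv (q i) (fieldDeriv (p k) f) x * fieldDeriv (q k) h x) =
      -∑ i, ∑ k, fieldDeriv (p i) (fieldDeriv (p k) f) x *
        (fieldDeriv (q i) g x * fieldDeriv (q k) h x) := by
    rw [Finset.sum_comm, Finset.sum_comm (f := fun i k => fieldDeriv (p i) (fieldDeriv (p k) f) x *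
        (fieldDeriv (q i) g x * fieldDeriv (q k) h x)), ← Finset.sum_neg_distrib]
    refine Finset.sum_congr rfl fun k _ => ?_
    have := hskew g (fieldDeriv (p k) f) x hg (hp k f x hf)
    simp only [fieldBracket] at this
    simp only [← mul_assoc, ← Finset.sum_mul]
    rw [this]
    ring
  have s2 : ∑ i, ∑ k, fieldDeriv (p i) g x *
        (fieldDeriv (p k) f x * fieldDeriv (q i) (fieldDeriv (q k) h) x) =
      ∑ i, ∑ k, fieldDeriv (p i) f x *
        (fieldDeriv (p k) g x * fieldDeriv (q k) (fieldDeriv (q i) h) x) := by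
    rw [Finset.sum_comm]
    exact Finset.sum_congr rfl fun i _ => Finset.sum_congr rfl fun k _ => by ring
  have s3 : ∑ i, ∑ k, fieldDeriv (p i) (fieldDeriv (p k) f) x * fieldDeriv (q k) g x *
        fieldDeriv (q i) h x =
      ∑ i, ∑ k, fieldDeriv (p k) (fieldDeriv (p i) f) x *
        (fieldDeriv (q i) g x * fieldDeriv (q k) h x) := by
    rw [Finset.sum_comm]
    exact Finset.sum_congr rfl fun i _ => Finset.sum_congr rfl fun k _ => by ring
  have s4 : ∑ i, ∑ k, fieldDeriv (p k) f x * fieldDeriv (p i) (fieldDeriv (q k) g) x *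
        fieldDeriv (q i) h x =
      ∑ i, ∑ k, fieldDeriv (p i) f x * (fieldDeriv (p k) (fieldDeriv (q i) g) x *
        fieldDeriv (q k) h x) := by
    rw [Finset.sum_comm]
    exact Finset.sum_congr rfl fun i _ => Finset.sum_congr rfl fun k _ => by ring
  rw [t1, t2, t3]
  simp only [mul_add, add_mul, mul_sub, sub_mul, Finset.sum_add_distrib, Finset.sum_sub_distrib]
  rw [s1, s2, s3, s4]
  ring

end Jacobi

/-! ### The bracket of b^L - ρ^R on the group -/

section LeftRight

variable {E : Type*} [NormedAddCommGroup E] [NormedSpace ℂ E] [FiniteDimensional ℂ E]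
  {G : Type*} [Group G] [TopologicalSpace G] [ChartedSpace E G] [LieGroup 𝓘(ℂ, E) ω G]

/-- The covector `v ↦ v^L f` of derivatives along left-invariant vector fields. -/
def leftCov (f : G → ℂ) (g : G) : GroupLieAlgebra 𝓘(ℂ, E) G →ₗ[ℂ] ℂ := dAt f g ∘ₗ dLeft g

/-- The covector `v ↦ v^R f` of derivatives along right-invariant vector fields. -/
def rightCov (f : G → ℂ) (g : G) : GroupLieAlgebra 𝓘(ℂ, E) G →ₗ[ℂ] ℂ := dAt f g ∘ₗ dRight g

lemma leftCov_apply (f : G → ℂ) (g : G) (v : GroupLieAlgebra 𝓘(ℂ, E) G) :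
    leftCov f g v = LD v f g := rfl

lemma rightCov_apply (f : G → ℂ) (g : G) (v : GroupLieAlgebra 𝓘(ℂ, E) G) :
    rightCov f g v = RD v f g := rfl

lemma exists_sum_tmul {V : Type*} [AddCommGroup V] [Module ℂ V] (t : V ⊗[ℂ] V) :
    ∃ (n : ℕ) (a b : Fin n → V), t = ∑ i, a i ⊗ₜ[ℂ] b i := by
  obtain ⟨S, hS⟩ := TensorProduct.exists_finset t
  refine ⟨S.card, fun i => (S.equivFin.symm i).1.1, fun i => (S.equivFin.symm i).1.2, ?_⟩
  rw [hS, ← Finset.sum_coe_sort, ← S.equivFin.symm.sum_comp]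

/-- The bracket `(b^L - ρ^R)(df, dg)`. -/
def leftRightBracket (b ρ : GroupLieAlgebra 𝓘(ℂ, E) G ⊗[ℂ] GroupLieAlgebra 𝓘(ℂ, E) G)
    (f h : G → ℂ) (g : G) : ℂ :=
  eval₂ (leftCov f g) (leftCov h g) b - eval₂ (rightCov f g) (rightCov h g) ρ

lemma eval₃_CYB_sum {V : Type*} [LieRing V] [LieAlgebra ℂ V] {n : ℕ} (a a' : Fin n → V)
    (α β γ : V →ₗ[ℂ] ℂ) : eval₃ α β γ (CYB (∑ i, a i ⊗ₜ[ℂ] a' i)) =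
      ∑ i, ∑ k, (α ⁅a i, a k⁆ * (β (a' i) * γ (a' k)) + α (a i) * (β ⁅a' i, a k⁆ * γ (a' k)) +
        α (a i) * (β (a k) * γ ⁅a' i, a' k⁆)) := by
  simp only [CYB, TensorProduct.sum_tmul, TensorProduct.tmul_sum, map_sum, map_add, br12_13_tmul,
    br12_23_tmul, br13_23_tmul, eval₃_tmul, Finset.sum_add_distrib]
  rw [Finset.sum_comm, Finset.sum_comm (f := fun i k => α (a k) * (β ⁅a' k, a i⁆ * γ (a' i))),
    Finset.sum_comm (f := fun i k => α (a k) * (β (a i) * γ ⁅a' k, a' i⁆))]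

lemma HolAt.leftRightBracket {b ρ : GroupLieAlgebra 𝓘(ℂ, E) G ⊗[ℂ] GroupLieAlgebra 𝓘(ℂ, E) G}
    {f h : G → ℂ} {g : G} (hf : HolAt E f g) (hh : HolAt E h g) :
    HolAt E (leftRightBracket b ρ f h) g := by
  obtain ⟨n, a, a', rfl⟩ := exists_sum_tmul b
  obtain ⟨m, r, r', rfl⟩ := exists_sum_tmul ρ
  have e : QuasiPoisson.leftRightBracket (∑ i, a i ⊗ₜ[ℂ] a' i) (∑ i, r i ⊗ₜ[ℂ] r' i) f h =
      fun y => (∑ i, QuasiPoisson.LD (a i) f y * QuasiPoisson.LD (a' i) h y) +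
        (∑ i, QuasiPoisson.RD (r i) f y * QuasiPoisson.RD (r' i) h y) * (-1) := by
    funext y
    simp [QuasiPoisson.leftRightBracket, eval₂_tmul, leftCov_apply, rightCov_apply, sub_eq_add_neg]
  rw [e]
  exact (HolAt.sum fun i _ => (hf.LD _).mul (hh.LD _)).add
    ((HolAt.sum fun i _ => (hf.RD _).mul (hh.RD _)).mul_const _)

lemma fieldDeriv_neg_dRight (v : GroupLieAlgebra 𝓘(ℂ, E) G) (f : G → ℂ) :
    fieldDeriv (fun g => -dRight g v) f = fun g => -RD v f g := by
  funext g
  exact map_neg (dAt f g) _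

/-- The Jacobiator of the bracket defined by `b^L - ρ^R`. -/
theorem leftRightBracket_jacobiator
    {b ρ : GroupLieAlgebra 𝓘(ℂ, E) G ⊗[ℂ] GroupLieAlgebra 𝓘(ℂ, E) G}
    (hskew : ∀ (f g : G → ℂ) x, HolAt E f x → HolAt E g x →
      leftRightBracket b ρ f g x = -leftRightBracket b ρ g f x)
    {f g h : G → ℂ} {x : G} (hf : HolAt E f x) (hg : HolAt E g x) (hh : HolAt E h x) :
    leftRightBracket b ρ f (leftRightBracket b ρ g h) x +
        leftRightBracket b ρ g (leftRightBracket b ρ h f) x +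
        leftRightBracket b ρ h (leftRightBracket b ρ f g) x =
      eval₃ (leftCov (E := E) f x) (leftCov g x) (leftCov h x) (CYB b) -
        eval₃ (rightCov (E := E) f x) (rightCov g x) (rightCov h x) (CYB ρ) := by
  obtain ⟨n, a, a', rfl⟩ := exists_sum_tmul b
  obtain ⟨m, r, r', rfl⟩ := exists_sum_tmul ρ
  -- The index set is the disjoint union of the terms of b and of ρ; the minus sign in front of ρ^R
  -- is absorbed into p.
  let p : Fin n ⊕ Fin m → ∀ y : G, TangentSpace 𝓘(ℂ, E) y :=
    Sum.elim (fun i y => dLeft y (a i)) (fun j y => -dRight y (r j))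
  let q : Fin n ⊕ Fin m → ∀ y : G, TangentSpace 𝓘(ℂ, E) y :=
    Sum.elim (fun i y => dLeft y (a' i)) (fun j y => dRight y (r' j))
  have hpl : ∀ i f, fieldDeriv (p (Sum.inl i)) f = LD (a i) f := fun i f => rfl
  have hpr : ∀ j f, fieldDeriv (p (Sum.inr j)) f = fun y => -RD (r j) f y :=
    fun j f => fieldDeriv_neg_dRight (r j) f
  have hql : ∀ i f, fieldDeriv (q (Sum.inl i)) f = LD (a' i) f := fun i f => rfl
  have hqr : ∀ j f, fieldDeriv (q (Sum.inr j)) f = RD (r' j) f := fun j f => rfl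
  have e : leftRightBracket (∑ i, a i ⊗ₜ[ℂ] a' i) (∑ i, r i ⊗ₜ[ℂ] r' i) = fieldBracket p q := by
    funext f h y
    simp only [fieldBracket, Fintype.sum_sum_type, hpl, hpr, hql, hqr]
    simp [QuasiPoisson.leftRightBracket, eval₂_tmul, leftCov_apply, rightCov_apply, sub_eq_add_neg]
  have hneg : ∀ {F : G → ℂ} {y}, HolAt E F y → HolAt E (fun z => -F z) y := fun hF => by
    simpa using hF.mul_const (-1)
  have hp : ∀ i (f : G → ℂ) x, HolAt E f x → HolAt E (fieldDeriv (p i) f) x := by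
    rintro (i | j) f x hf
    · rw [hpl]; exact hf.LD _
    · rw [hpr]; exact hneg (hf.RD _)
  have hq : ∀ i (f : G → ℂ) x, HolAt E f x → HolAt E (fieldDeriv (q i) f) x := by
    rintro (i | j) f x hf
    · rw [hql]; exact hf.LD _
    · rw [hqr]; exact hf.RD _
  rw [e] at hskew ⊢
  rw [fieldBracket_jacobiator hp hq hskew hf hg hh, eval₃_CYB_sum, eval₃_CYB_sum]
  have nL : ∀ (v : GroupLieAlgebra 𝓘(ℂ, E) G) {F : G → ℂ}, HolAt E F x →
      LD v (fun z => -F z) x = -LD v F x := fun v F hF => fieldDeriv_neg hF (fun y => dLeft y v)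
  have nR : ∀ (v : GroupLieAlgebra 𝓘(ℂ, E) G) {F : G → ℂ}, HolAt E F x →
      RD v (fun z => -F z) x = -RD v F x := fun v F hF => fieldDeriv_neg hF (fun y => dRight y v)
  have LR : ∀ (u v : GroupLieAlgebra 𝓘(ℂ, E) G) {F : G → ℂ}, HolAt E F x →
      LD u (RD v F) x = RD v (LD u F) x := fun u v F hF => LD_RD_comm hF u v
  have LL : ∀ (u v : GroupLieAlgebra 𝓘(ℂ, E) G) {F : G → ℂ}, HolAt E F x →
      LD u (LD v F) x - LD v (LD u F) x = LD ⁅u, v⁆ F x := fun u v F hF => LD_LD_sub hF u v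
  have RR : ∀ (u v : GroupLieAlgebra 𝓘(ℂ, E) G) {F : G → ℂ}, HolAt E F x →
      RD u (RD v F) x - RD v (RD u F) x = -RD ⁅u, v⁆ F x := fun u v F hF => RD_RD_sub hF u v
  simp only [Fintype.sum_sum_type, hpl, hpr, hql, hqr]
  have e1 : ∀ (v : GroupLieAlgebra 𝓘(ℂ, E) G) (u : GroupLieAlgebra 𝓘(ℂ, E) G) {F : G → ℂ},
      HolAt E F x → LD u (fun z => -RD v F z) x = -RD v (LD u F) x := fun v u F hF => by
    rw [nL _ (hF.RD v), LR _ _ hF]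
  have e2 : ∀ (v : GroupLieAlgebra 𝓘(ℂ, E) G) (u : GroupLieAlgebra 𝓘(ℂ, E) G) {F : G → ℂ},
      HolAt E F x → RD u (fun z => -RD v F z) x = -RD u (RD v F) x := fun v u F hF => by
    rw [nR _ (hF.RD v)]
  have RR' : ∀ (u v : GroupLieAlgebra 𝓘(ℂ, E) G) {F : G → ℂ}, HolAt E F x →
      RD u (RD v F) x = RD v (RD u F) x - RD ⁅u, v⁆ F x := fun u v F hF => by
    linear_combination RR u v hF
  rw [sub_eq_add_neg]
  simp only [← Finset.sum_neg_distrib, Finset.sum_add_distrib (f := fun _ => Finset.sum _ _)]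
  -- The left-left block gives CYB(b), and the mixed blocks vanish since the fields commute. The
  -- right-right block gives -CYB(ρ): each term contains p twice, so its sign cancels, while the
  -- commutator of right-invariant fields contributes a minus sign.
  refine congrArg₂ (· + ·) ((congrArg₂ (· + ·)
    (Finset.sum_congr rfl fun i _ => Finset.sum_congr rfl fun k _ => ?_)
    (Finset.sum_eq_zero fun i _ => Finset.sum_eq_zero fun k _ => ?_)).trans (add_zero _))
    ((congrArg₂ (· + ·) (Finset.sum_eq_zero fun i _ => Finset.sum_eq_zero fun k _ => ?_)
    (Finset.sum_congr rfl fun i _ => Finset.sum_congr rfl fun k _ => ?_)).trans (zero_add _))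
  · rw [LL _ _ hf, LL _ _ hg, LL _ _ hh]
    rfl
  · rw [e1 _ _ hf, e1 _ _ hg, LR _ _ hh]
    ring
  · rw [e1 _ _ hf, LR _ _ hg, LR _ _ hh]
    ring
  · rw [e2 _ _ hf, e2 _ _ hf, e2 _ _ hg, RR' (r i) (r k) hf, RR' (r' i) (r k) hg,
      RR' (r' i) (r' k) hh]
    simp only [rightCov_apply]
    ring

end LeftRight


/-! ### Contracting tensors with covectors -/

section Contraction

variable {V : Type*} [AddCommGroup V] [Module ℂ V]

lemma eval₂_comm (α β : V →ₗ[ℂ] ℂ) (t : V ⊗[ℂ] V) :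
    eval₂ α β (TensorProduct.comm ℂ V V t) = eval₂ β α t := by
  induction t with
  | zero => simp
  | tmul a b => simp [eval₂_tmul, mul_comm]
  | add a b ha hb => rw [map_add, map_add, map_add, ha, hb]

lemma eval₂_map {W : Type*} [AddCommGroup W] [Module ℂ W] (α β : W →ₗ[ℂ] ℂ) (f : V →ₗ[ℂ] W)
    (t : V ⊗[ℂ] V) : eval₂ α β (TensorProduct.map f f t) = eval₂ (α ∘ₗ f) (β ∘ₗ f) t := by
  induction t with
  | zero => simp
  | tmul a b => simp [eval₂_tmul]
  | add a b ha hb => rw [map_add, map_add, map_add, ha, hb]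

lemma eval₃_map {W : Type*} [AddCommGroup W] [Module ℂ W] (α β γ : W →ₗ[ℂ] ℂ) (f : V →ₗ[ℂ] W)
    (t : V ⊗[ℂ] (V ⊗[ℂ] V)) :
    eval₃ α β γ (TensorProduct.map f (TensorProduct.map f f) t) =
      eval₃ (α ∘ₗ f) (β ∘ₗ f) (γ ∘ₗ f) t := by
  induction t with
  | zero => simp
  | tmul a b =>
    rw [TensorProduct.map_tmul]
    simp only [eval₃, LinearMap.comp_apply, TensorProduct.map_tmul, eval₂_map]
  | add a b ha hb => rw [map_add, map_add, map_add, ha, hb]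

lemma eval₂_add_left (α α' β : V →ₗ[ℂ] ℂ) (t : V ⊗[ℂ] V) :
    eval₂ (α + α') β t = eval₂ α β t + eval₂ α' β t := by
  simp [eval₂, TensorProduct.map_add_left]

lemma eval₂_add_right (α β β' : V →ₗ[ℂ] ℂ) (t : V ⊗[ℂ] V) :
    eval₂ α (β + β') t = eval₂ α β t + eval₂ α β' t := by
  simp [eval₂, TensorProduct.map_add_right]

lemma eval₂_smul_left (c : ℂ) (α β : V →ₗ[ℂ] ℂ) (t : V ⊗[ℂ] V) :
    eval₂ (c • α) β t = c * eval₂ α β t := by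
  simp [eval₂, TensorProduct.map_smul_left]

lemma eval₂_smul_right (c : ℂ) (α β : V →ₗ[ℂ] ℂ) (t : V ⊗[ℂ] V) :
    eval₂ α (c • β) t = c * eval₂ α β t := by
  simp [eval₂, TensorProduct.map_smul_right]

lemma eval₂_zero_left (β : V →ₗ[ℂ] ℂ) (t : V ⊗[ℂ] V) : eval₂ 0 β t = 0 := by
  simpa using eval₂_smul_left 0 0 β t

lemma eval₂_zero_right (β : V →ₗ[ℂ] ℂ) (t : V ⊗[ℂ] V) : eval₂ β 0 t = 0 := by
  simpa using eval₂_smul_right 0 β 0 t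

/-- Covectors separate the points of `V ⊗ V`. -/
lemma eq_of_forall_eval₂_eq [FiniteDimensional ℂ V] {s t : V ⊗[ℂ] V}
    (h : ∀ α β : V →ₗ[ℂ] ℂ, eval₂ α β s = eval₂ α β t) : s = t := by
  let b := Module.finBasis ℂ V
  refine (b.tensorProduct b).ext_elem fun ij => ?_
  have key : ∀ r : V ⊗[ℂ] V, (b.tensorProduct b).repr r ij = eval₂ (b.coord ij.1) (b.coord ij.2) r := by
    intro r
    induction r with
    | zero => simp
    | tmul x y => 
      rw [eval₂_tmul]
      refine (Module.Basis.tensorProduct_repr_tmul_apply b b x y ij.1 ij.2).trans ?_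
      simp [mul_comm]
    | add x y hx hy => rw [map_add, map_add, Finsupp.add_apply, hx, hy]
  rw [key, key, h]

/-- Ω is inverse to the form, so contracting a slot with `B w` returns w. In the second slot the
dual of the dual basis appears, and this is where symmetry enters. -/
lemma eval₂_formTensor [FiniteDimensional ℂ V] {B : LinearMap.BilinForm ℂ V} (hB : B.Nondegenerate)
    (hBsymm : B.IsSymm) (l : V →ₗ[ℂ] ℂ) (w : V) : eval₂ l (B w) (formTensor B hB) = l w := by
  let b := Module.finBasis ℂ V
  have hw : ∑ i, B w (B.dualBasis hB b i) • b i = w := by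
    conv_rhs => rw [← (B.dualBasis hB (B.dualBasis hB b)).sum_repr w]
    refine Finset.sum_congr rfl fun i _ => ?_
    rw [LinearMap.BilinForm.dualBasis_repr_apply, LinearMap.BilinForm.dualBasis_dualBasis hB hBsymm]
  conv_rhs => rw [← hw]
  simp only [formTensor, map_sum, eval₂_tmul, map_smul, smul_eq_mul]
  exact Finset.sum_congr rfl fun i _ => mul_comm _ _

lemma eval₂_formTensor' [FiniteDimensional ℂ V] {B : LinearMap.BilinForm ℂ V}
    (hB : B.Nondegenerate) (l : V →ₗ[ℂ] ℂ) (w : V) :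
    eval₂ (B w) l (formTensor B hB) = l w := by
  let b := Module.finBasis ℂ V
  conv_rhs => rw [← (B.dualBasis hB b).sum_repr w]
  simp only [formTensor, map_sum, eval₂_tmul, map_smul, smul_eq_mul,
    LinearMap.BilinForm.dualBasis_repr_apply]
  rfl

lemma exists_form_eq [FiniteDimensional ℂ V] {B : LinearMap.BilinForm ℂ V} (hB : B.Nondegenerate)
    (l : V →ₗ[ℂ] ℂ) : ∃ w, B w = l :=
  ⟨(B.toDual hB).symm l, LinearMap.ext fun v => LinearMap.BilinForm.apply_toDual_symm_apply l v⟩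

/-- The tensor of a form is invariant under isometries. -/
lemma eval₂_formTensor_comp [FiniteDimensional ℂ V] {B : LinearMap.BilinForm ℂ V}
    (hB : B.Nondegenerate) (hBsymm : B.IsSymm) {A : V →ₗ[ℂ] V}
    (hA : ∀ v w, B (A v) (A w) = B v w) (l l' : V →ₗ[ℂ] ℂ) :
    eval₂ (l ∘ₗ A) (l' ∘ₗ A) (formTensor B hB) = eval₂ l l' (formTensor B hB) := by
  have hinj : Function.Injective A := by
    refine (injective_iff_map_eq_zero A).2 fun v hv => ?_
    have : B v = 0 := LinearMap.ext fun w => by rw [← hA, hv]; simp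
    exact (LinearMap.ker_eq_bot'.1 hB.ker_eq_bot) v this
  obtain ⟨w, rfl⟩ := exists_form_eq hB l'
  obtain ⟨w, rfl⟩ := LinearMap.injective_iff_surjective.1 hinj w
  have : B (A w) ∘ₗ A = B w := LinearMap.ext fun v => hA w v
  rw [this, eval₂_formTensor hB hBsymm, eval₂_formTensor hB hBsymm]
  rfl

/-- In each of the three terms two covectors are absorbed by the two copies of b, and the third is
applied to the bracket of the resulting vectors. -/
lemma eval₃_CYB {V : Type*} [LieRing V] [LieAlgebra ℂ V] {b : V ⊗[ℂ] V} {α β γ : V →ₗ[ℂ] ℂ}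
    {uβ uγ vα vβ : V} (h1 : ∀ l, eval₂ l β b = l uβ) (h2 : ∀ l, eval₂ l γ b = l uγ)
    (h3 : ∀ l, eval₂ α l b = l vα) (h4 : ∀ l, eval₂ β l b = l vβ) :
    eval₃ α β γ (CYB b) = α ⁅uβ, uγ⁆ + β ⁅vα, uγ⁆ + γ ⁅vα, vβ⁆ := by
  obtain ⟨n, a, a', rfl⟩ := exists_sum_tmul b
  simp only [map_sum, eval₂_tmul] at h1 h2 h3 h4
  rw [eval₃_CYB_sum]
  simp only [Finset.sum_add_distrib]
  let ad := (LieModule.toEnd ℂ V V : V →ₗ[ℂ] Module.End ℂ V)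
  congr 1; congr 1
  · have e : ∀ i, ∑ k, α ⁅a i, a k⁆ * (β (a' i) * γ (a' k)) = α ⁅a i, uγ⁆ * β (a' i) := fun i => by
      have := h2 (α ∘ₗ ad (a i))
      rw [show α ⁅a i, uγ⁆ = _ from this.symm, Finset.sum_mul]
      exact Finset.sum_congr rfl fun k _ => by
        change α ⁅a i, a k⁆ * _ = α ⁅a i, a k⁆ * _ * _
        ring
    simp only [e]
    exact h1 (α ∘ₗ ad.flip uγ)
  · have e : ∀ i, ∑ k, α (a i) * (β ⁅a' i, a k⁆ * γ (a' k)) = α (a i) * β ⁅a' i, uγ⁆ := fun i => by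
      rw [show β ⁅a' i, uγ⁆ = _ from (h2 (β ∘ₗ ad (a' i))).symm, Finset.mul_sum]
      rfl
    simp only [e]
    exact h3 (β ∘ₗ ad.flip uγ)
  · have e : ∀ i, ∑ k, α (a i) * (β (a k) * γ ⁅a' i, a' k⁆) = α (a i) * γ ⁅a' i, vβ⁆ := fun i => by
      rw [show γ ⁅a' i, vβ⁆ = _ from (h4 (γ ∘ₗ ad (a' i))).symm, Finset.mul_sum]
      rfl
    simp only [e]
    exact h3 (γ ∘ₗ ad.flip vβ)

end Contraction

/-! ### Root vectors, structure constants and the tensor x + Ω/2 -/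

section RootVectors

open LieAlgebra LieAlgebra.IsKilling LieModule

variable {𝔤 : Type*} [LieRing 𝔤] [LieAlgebra ℂ 𝔤] [FiniteDimensional ℂ 𝔤]
  [LieAlgebra.IsSemisimple ℂ 𝔤] {H : LieSubalgebra ℂ 𝔤} [H.IsCartanSubalgebra]

lemma exists_smul_eq_of_mem_rootSpace (α : Weight ℂ H 𝔤) (hα : α.IsNonZero) {x y : 𝔤}
    (hx : x ∈ rootSpace H α) (hy : y ∈ rootSpace H α) (hx0 : x ≠ 0) : ∃ c : ℂ, c • x = y := by
  obtain ⟨c, hc⟩ := (finrank_eq_one_iff_of_nonzero' (⟨x, hx⟩ : rootSpace H α)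
    (by simpa using hx0)).1 (finrank_rootSpace_eq_one α hα) ⟨y, hy⟩
  exact ⟨c, congrArg Subtype.val hc⟩

/-- `[𝔤_α, 𝔤_β] ≠ 0` if `α`, `β` and `α + β` are roots. -/
lemma lie_ne_zero_of_rootSpace_add_ne_bot (α β : Weight ℂ H 𝔤) (hα : α.IsNonZero)
    (hβ : β.IsNonZero) (hαβ : rootSpace H ((α : H → ℂ) + β) ≠ ⊥) {x y : 𝔤}
    (hx : x ∈ rootSpace H α) (hy : y ∈ rootSpace H β) (hx0 : x ≠ 0) (hy0 : y ≠ 0) : ⁅x, y⁆ ≠ 0 := by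
  -- Representation theory of 𝔰𝔩₂ on the α-string through β, with z at the top. Lowering z far
  -- enough reaches 𝔤_β; since β is not the top, raising that vector gives a nonzero multiple of the
  -- vector above. One-dimensionality of root spaces transfers this to x and y.
  obtain ⟨z, hz, hz0⟩ := (chainTop α β).exists_ne_zero
  obtain ⟨h, e, f, isSl2, he, hf⟩ := exists_isSl2Triple_of_weight_isNonZero hα
  obtain rfl := isSl2.h_eq_coroot hα he hf
  have prim : isSl2.HasPrimitiveVectorWith z (chainLength α β : ℂ) :=
    have := lie_mem_genWeightSpace_of_mem_genWeightSpace he hz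
    ⟨hz0, (chainLength_smul _ _ hz).symm, by rwa [genWeightSpace_add_chainTop _ _ hα] at this⟩
  have hk : 1 ≤ chainTopCoeff α β := by
    have := (rootSpace_zsmul_add_ne_bot_iff α β hα 1).1 (by simpa using hαβ)
    exact_mod_cast this.1
  obtain ⟨k, hk⟩ := Nat.exists_eq_add_of_le' hk
  have hle : k + 1 ≤ chainLength α β := hk ▸ chainTopCoeff_le_chainLength α β
  have hw : (toEnd ℂ 𝔤 𝔤 f ^ (k + 1)) z ∈ rootSpace H β := by
    have := toEnd_pow_apply_mem hf hz (k + 1)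
    convert this using 2
    rw [coe_chainTop', hk]
    simp
  have hw0 := prim.pow_toEnd_f_ne_zero_of_eq_nat rfl hle
  have hbr := prim.lie_e_pow_succ_toEnd_f k
  have hne : ⁅e, (toEnd ℂ 𝔤 𝔤 f ^ (k + 1)) z⁆ ≠ 0 := by
    rw [hbr]
    refine smul_ne_zero (mul_ne_zero (by exact_mod_cast Nat.succ_ne_zero k) ?_)
      (prim.pow_toEnd_f_ne_zero_of_eq_nat rfl (by omega))
    rw [sub_ne_zero]
    exact_mod_cast (by omega : chainLength α β ≠ k)
  obtain ⟨c, rfl⟩ := exists_smul_eq_of_mem_rootSpace α hα hx he hx0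
  obtain ⟨d, hd⟩ := exists_smul_eq_of_mem_rootSpace β hβ hy hw hy0
  rw [← hd] at hne
  intro h0
  exact hne (by simp [h0])

variable {B : LinearMap.BilinForm ℂ 𝔤} (hBinv : B.lieInvariant 𝔤)

include hBinv in
lemma form_lie_swap (x y z : 𝔤) : B y ⁅x, z⁆ = -B x ⁅y, z⁆ := by
  have h1 := hBinv x y z
  have h2 := hBinv y x z
  rw [← lie_skew, map_neg, LinearMap.neg_apply] at h2
  linear_combination h1 + h2

include hBinv in
lemma form_lie_rotate (hBsymm : B.IsSymm) (x y z : 𝔤) : B z ⁅x, y⁆ = B x ⁅y, z⁆ := by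
  rw [hBsymm.eq, hBinv, form_lie_swap hBinv, neg_neg]

include hBinv in
-- Invariance under t ∈ 𝔥 gives (χ + ψ)(t) B(x, y) = 0, and some t makes the factor nonzero.
lemma form_eq_zero_of_mem_rootSpace {χ ψ : Module.Dual ℂ H} (h : χ + ψ ≠ 0) {x y : 𝔤}
    (hx : x ∈ rootSpace H χ) (hy : y ∈ rootSpace H ψ) : B x y = 0 := by
  obtain ⟨t, ht⟩ : ∃ t : H, (χ + ψ) t ≠ 0 := by
    by_contra hc
    push Not at hc
    exact h (LinearMap.ext hc)
  have h1 := hBinv (t : 𝔤) x y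
  have e1 : ⁅(t : 𝔤), x⁆ = χ t • x := lie_eq_smul_of_mem_rootSpace hx t
  have e2 : ⁅(t : 𝔤), y⁆ = ψ t • y := lie_eq_smul_of_mem_rootSpace hy t
  rw [e1, e2, map_smul, LinearMap.smul_apply, map_smul, smul_eq_mul, smul_eq_mul] at h1
  have h2 : (χ + ψ) t * B x y = 0 := by
    rw [LinearMap.add_apply]; linear_combination h1
  exact (mul_eq_zero.1 h2).resolve_left ht

lemma mem_rootSpace_zero_of_mem {x : 𝔤} (hx : x ∈ H) :
    x ∈ rootSpace H ((0 : Module.Dual ℂ H) : H → ℂ) := by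
  exact toLieSubmodule_le_rootSpace_zero ℂ 𝔤 H hx

lemma exists_weight_of_mem_roots {α : Module.Dual ℂ H} (h : α ∈ roots H) :
    ∃ w : Weight ℂ H 𝔤, w.IsNonZero ∧ (w : H → ℂ) = α := by
  obtain ⟨i, rfl⟩ := h
  exact ⟨i, H.isNonZero_coe_root i, rfl⟩

variable {e : Module.Dual ℂ H → 𝔤} (he : IsNormalizedRootVectors H B e)

include he in
lemma rootVector_ne_zero {α : Module.Dual ℂ H} (hα : α ∈ roots H) : e α ≠ 0 := by
  intro h0
  have := (he α hα).2
  rw [h0] at this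
  simp at this

include he in
/-- Linear functions on `𝔤` are determined by their values on `𝔥` and on the root vectors. -/
lemma eq_of_apply_rootVector {l l' : 𝔤 →ₗ[ℂ] ℂ} (hH : ∀ v ∈ H, l v = l' v)
    (hR : ∀ α ∈ roots H, l (e α) = l' (e α)) : l = l' := by
  have htop := cartan_sup_iSup_rootSpace_eq_top (K := ℂ) (L := 𝔤) (H := H)
  have : (LinearMap.eqLocus l l') = ⊤ := by
    rw [eq_top_iff]
    have h2 := congrArg LieSubmodule.toSubmodule htop
    rw [LieSubmodule.sup_toSubmodule, LieSubmodule.iSup_toSubmodule,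
      LieSubmodule.top_toSubmodule] at h2
    rw [← h2]
    refine sup_le (fun v hv => hH v hv) (iSup_le fun w => ?_)
    rw [LieSubmodule.iSup_toSubmodule]
    refine iSup_le fun hw v hv => ?_
    have hroot : w.toLinear ∈ roots H := ⟨⟨w, by simpa using hw⟩, rfl⟩
    obtain ⟨c, rfl⟩ := exists_smul_eq_of_mem_rootSpace w hw (he _ hroot).1 hv
      (rootVector_ne_zero he hroot)
    change l _ = l' _
    rw [map_smul, map_smul, hR _ hroot]
  exact LinearMap.ext fun v => by
    have : v ∈ LinearMap.eqLocus l l' := this ▸ Submodule.mem_top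
    exact this

include hBinv he in
lemma form_rootVector_eq_zero {α β : Module.Dual ℂ H} (hα : α ∈ roots H) (hβ : β ∈ roots H)
    (h : α + β ≠ 0) : B (e α) (e β) = 0 :=
  form_eq_zero_of_mem_rootSpace hBinv h (he α hα).1 (he β hβ).1

include hBinv he in
lemma form_rootVector_cartan {α : Module.Dual ℂ H} (hα : α ∈ roots H) {v : 𝔤} (hv : v ∈ H) :
    B (e α) v = 0 :=
  form_eq_zero_of_mem_rootSpace hBinv (by simpa using ne_zero_of_mem_roots hα) (he α hα).1
    (mem_rootSpace_zero_of_mem hv)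

lemma lie_mem_rootSpace {α β : Module.Dual ℂ H} {x y : 𝔤} (hx : x ∈ rootSpace H α)
    (hy : y ∈ rootSpace H β) : ⁅x, y⁆ ∈ rootSpace H ((α + β : Module.Dual ℂ H) : H → ℂ) := by
  have := lie_mem_genWeightSpace_of_mem_genWeightSpace hx hy
  exact this

include hBinv in
lemma form_lie_eq_zero {α β γ : Module.Dual ℂ H} (h : α + β + γ ≠ 0) {x y z : 𝔤}
    (hx : x ∈ rootSpace H α) (hy : y ∈ rootSpace H β) (hz : z ∈ rootSpace H γ) :
    B x ⁅y, z⁆ = 0 :=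
  form_eq_zero_of_mem_rootSpace hBinv (by rwa [← add_assoc]) hx (lie_mem_rootSpace hy hz)

include he in
-- The bracket [E_β, E_γ] is a nonzero vector of the line 𝔤_{-α}, which E_α pairs with nontrivially.
-- The structure constants can therefore be divided out of the equations.
lemma form_lie_ne_zero {α β γ : Module.Dual ℂ H} (hα : α ∈ roots H) (hβ : β ∈ roots H)
    (hγ : γ ∈ roots H) (h : α + β + γ = 0) : B (e α) ⁅e β, e γ⁆ ≠ 0 := by
  have hβγ : β + γ = -α := by rw [eq_neg_iff_add_eq_zero, ← h]; abel
  obtain ⟨wβ, hwβ, eβ⟩ := exists_weight_of_mem_roots hβ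
  obtain ⟨wγ, hwγ, eγ⟩ := exists_weight_of_mem_roots hγ
  obtain ⟨wα, hwα, eα⟩ := exists_weight_of_mem_roots (neg_mem_roots hα)
  have hmem := lie_mem_rootSpace (he β hβ).1 (he γ hγ).1
  have hne : ⁅e β, e γ⁆ ≠ 0 := by
    refine lie_ne_zero_of_rootSpace_add_ne_bot wβ wγ hwβ hwγ ?_ (eβ ▸ (he β hβ).1)
      (eγ ▸ (he γ hγ).1) (rootVector_ne_zero he hβ) (rootVector_ne_zero he hγ)
    have e1 : (wβ : H → ℂ) + wγ = wα := by
      rw [eβ, eγ, eα, ← hβγ]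
      rfl
    rw [e1]
    exact wα.genWeightSpace_ne_bot
  rw [hβγ, ← eα] at hmem
  obtain ⟨c, hc⟩ := exists_smul_eq_of_mem_rootSpace wα hwα (eα ▸ (he _ (neg_mem_roots hα)).1) hmem
    (rootVector_ne_zero he (neg_mem_roots hα))
  rw [← hc, map_smul, (he α hα).2]
  rintro h0
  rw [← hc] at hne
  simp only [smul_eq_mul, mul_one] at h0
  exact hne (by rw [h0, zero_smul])

include hBinv he in
lemma eval₂_rootTensor_right (x : Module.Dual ℂ H → ℂ) (l : 𝔤 →ₗ[ℂ] ℂ) {δ : Module.Dual ℂ H}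
    (hδ : δ ∈ roots H) : eval₂ l (B (e δ)) (rootTensor H e x) = x δ * l (e δ) := by
  obtain ⟨i, rfl⟩ := hδ
  have hr : ∀ j : H.root, (rootSystem H).root j ∈ roots H := fun j => ⟨j, rfl⟩
  simp only [rootTensor, map_sum, map_smul, eval₂_tmul, smul_eq_mul]
  rw [Finset.sum_eq_single i]
  · rw [(he _ (hr i)).2, mul_one]
  · intro j _ hj
    rw [form_rootVector_eq_zero hBinv he (hr i) (neg_mem_roots (hr j)), mul_zero, mul_zero]
    rw [← sub_eq_add_neg, sub_ne_zero]
    exact fun h => hj ((rootSystem H).root.injective h).symm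
  · simp

include hBinv he in
lemma eval₂_rootTensor_left (x : Module.Dual ℂ H → ℂ) (l : 𝔤 →ₗ[ℂ] ℂ) {δ : Module.Dual ℂ H}
    (hδ : δ ∈ roots H) : eval₂ (B (e δ)) l (rootTensor H e x) = x (-δ) * l (e δ) := by
  obtain ⟨i, hi⟩ := neg_mem_roots hδ
  have hδ' : δ = -(rootSystem H).root i := by rw [hi, neg_neg]
  have hr : ∀ j : H.root, (rootSystem H).root j ∈ roots H := fun j => ⟨j, rfl⟩
  simp only [rootTensor, map_sum, map_smul, eval₂_tmul, smul_eq_mul]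
  rw [Finset.sum_eq_single i]
  · rw [hi, neg_neg, (he _ hδ).2, one_mul]
  · intro j _ hj
    rw [form_rootVector_eq_zero hBinv he hδ (hr j), zero_mul, mul_zero]
    rw [hδ', neg_add_eq_sub, sub_ne_zero]
    exact fun h => hj ((rootSystem H).root.injective h)
  · simp

/-- The tensor `x + Ω/2`, where `x = ∑ x_α E_α ⊗ E_{-α}`. -/
def shiftedRootTensor (e : Module.Dual ℂ H → 𝔤) (hB : B.Nondegenerate) (x : Module.Dual ℂ H → ℂ) :
    𝔤 ⊗[ℂ] 𝔤 := rootTensor H e x + (1 / 2 : ℂ) • formTensor B hB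

variable (hB : B.Nondegenerate) (hBsymm : B.IsSymm)

include hBinv he hBsymm in
-- Contraction with ⟨E_δ, ·⟩ yields a multiple of E_δ again. The coefficient involves x_δ in the
-- second slot and x_{-δ} in the first.
lemma eval₂_shiftedRootTensor_right (x : Module.Dual ℂ H → ℂ) (l : 𝔤 →ₗ[ℂ] ℂ)
    {δ : Module.Dual ℂ H} (hδ : δ ∈ roots H) :
    eval₂ l (B (e δ)) (shiftedRootTensor e hB x) = l ((x δ + 1 / 2) • e δ) := by
  rw [shiftedRootTensor, map_add, map_smul, eval₂_rootTensor_right hBinv he x l hδ,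
    eval₂_formTensor hB hBsymm, map_smul, smul_eq_mul, smul_eq_mul]
  ring

include hBinv he in
lemma eval₂_shiftedRootTensor_left (x : Module.Dual ℂ H → ℂ) (l : 𝔤 →ₗ[ℂ] ℂ)
    {δ : Module.Dual ℂ H} (hδ : δ ∈ roots H) :
    eval₂ (B (e δ)) l (shiftedRootTensor e hB x) = l ((x (-δ) + 1 / 2) • e δ) := by
  rw [shiftedRootTensor, map_add, map_smul, eval₂_rootTensor_left hBinv he x l hδ,
    eval₂_formTensor' hB, map_smul, smul_eq_mul, smul_eq_mul]
  ring

include hBinv he hBsymm in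
-- Invariance reduces all three brackets to one structure constant up to sign. Its coefficient is
-- (x_β + ½)(x_γ + ½) - (½ - x_α)(x_γ + ½) + (½ - x_α)(½ - x_β), in which the linear terms cancel.
lemma eval₃_CYB_shiftedRootTensor {x : Module.Dual ℂ H → ℂ} (hx : ∀ α ∈ roots H, x (-α) = -x α)
    {α β γ : Module.Dual ℂ H} (hα : α ∈ roots H) (hβ : β ∈ roots H) (hγ : γ ∈ roots H) :
    eval₃ (B (e α)) (B (e β)) (B (e γ)) (CYB (shiftedRootTensor e hB x)) =
      (x α * x β + x β * x γ + x γ * x α + 1 / 4) * B (e α) ⁅e β, e γ⁆ := by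
  rw [eval₃_CYB (fun l => eval₂_shiftedRootTensor_right hBinv he hB hBsymm x l hβ)
    (fun l => eval₂_shiftedRootTensor_right hBinv he hB hBsymm x l hγ)
    (fun l => eval₂_shiftedRootTensor_left hBinv he hB x l hα)
    (fun l => eval₂_shiftedRootTensor_left hBinv he hB x l hβ), hx α hα, hx β hβ]
  have e1 := form_lie_swap hBinv (e α) (e β) (e γ)
  have e2 := form_lie_rotate hBinv hBsymm (e α) (e β) (e γ)
  simp only [smul_lie, lie_smul, map_smul, smul_eq_mul, e1, e2]
  ring

include hBinv he hBsymm in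
lemma eval₂_add_comm_shiftedRootTensor {x : Module.Dual ℂ H → ℂ}
    {l : 𝔤 →ₗ[ℂ] ℂ} {δ : Module.Dual ℂ H} (hδ : δ ∈ roots H) :
    eval₂ l (B (e δ)) (shiftedRootTensor e hB x + TensorProduct.comm ℂ _ _
      (shiftedRootTensor e hB x)) = (x δ + x (-δ) + 1) * l (e δ) := by
  rw [map_add, eval₂_comm, eval₂_shiftedRootTensor_right hBinv he hB hBsymm x l hδ,
    eval₂_shiftedRootTensor_left hBinv he hB x l hδ, map_smul, map_smul, smul_eq_mul, smul_eq_mul]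
  ring

include hBsymm in
lemma comm_formTensor : TensorProduct.comm ℂ _ _ (formTensor B hB) = formTensor B hB := by
  refine eq_of_forall_eval₂_eq fun l l' => ?_
  obtain ⟨w, rfl⟩ := exists_form_eq hB l'
  rw [eval₂_comm, eval₂_formTensor hB hBsymm, eval₂_formTensor' hB]

include hBsymm in
lemma shiftedRootTensor_add_comm {x : Module.Dual ℂ H → ℂ} (hx : ∀ α ∈ roots H, x (-α) = -x α) :
    shiftedRootTensor e hB x + TensorProduct.comm ℂ _ _ (shiftedRootTensor e hB x) =
      formTensor B hB := by
  have h1 : TensorProduct.comm ℂ _ _ (rootTensor H e x) = -rootTensor H e x := by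
    let _ := (rootSystem H).indexNeg
    simp only [rootTensor, map_sum, map_smul, TensorProduct.comm_tmul]
    have hneg : ∀ i, (rootSystem H).root (-i) = -(rootSystem H).root i :=
      fun i => (rootSystem H).root_reflectionPerm_self i
    rw [← Finset.sum_neg_distrib, ← Equiv.sum_comp (Equiv.neg H.root)]
    refine Finset.sum_congr rfl fun i _ => ?_
    simp only [Equiv.neg_apply, hneg]
    rw [hx _ ⟨i, rfl⟩, neg_neg, neg_smul]
  rw [shiftedRootTensor, map_add, h1, map_smul, comm_formTensor hB hBsymm]
  module

section Annihilator

variable {𝒰 : Set (Module.Dual ℂ H)} (h𝒰 : IsReductiveSet H 𝒰)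

include hBinv he h𝒰 in
-- A functional l that vanishes on 𝔥 equals ∑ l(E_α)⟨E_{-α}, ·⟩, and if it vanishes on 𝔲 only α ∉ 𝒰
-- contribute. Conditions modulo 𝔲 are thereby reduced to root vectors.
lemma dualAnnihilator_regularSubspace : (regularSubspace H 𝒰).dualAnnihilator =
    Submodule.span ℂ ((fun α => B (e α)) '' (roots H \ 𝒰)) := by
  refine le_antisymm (fun l hl => ?_) (Submodule.span_le.2 ?_)
  · rw [Submodule.mem_dualAnnihilator] at hl
    have hr : ∀ j : H.root, (rootSystem H).root j ∈ roots H := fun j => ⟨j, rfl⟩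
    have hexp : l = ∑ i : H.root, l (e ((rootSystem H).root i)) • B (e (-(rootSystem H).root i)) := by
      refine eq_of_apply_rootVector he (fun v hv => ?_) fun α hα => ?_
      · rw [hl v (Submodule.mem_sup_left hv), LinearMap.sum_apply]
        refine (Finset.sum_eq_zero fun i _ => ?_).symm
        rw [LinearMap.smul_apply, form_rootVector_cartan hBinv he (neg_mem_roots (hr i)) hv,
          smul_zero]
      · obtain ⟨i, rfl⟩ := hα
        rw [LinearMap.sum_apply, Finset.sum_eq_single i]
        · have := (he _ (neg_mem_roots (hr i))).2
          rw [neg_neg] at this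
          rw [LinearMap.smul_apply, this, smul_eq_mul, mul_one]
        · intro j _ hj
          rw [LinearMap.smul_apply, form_rootVector_eq_zero hBinv he (neg_mem_roots (hr j)) (hr i),
            smul_zero]
          rw [neg_add_eq_sub, sub_ne_zero]
          exact fun h => hj ((rootSystem H).root.injective h).symm
        · simp
    rw [hexp]
    refine Submodule.sum_mem _ fun i _ => ?_
    by_cases hi : (rootSystem H).root i ∈ 𝒰
    · have : e ((rootSystem H).root i) ∈ regularSubspace H 𝒰 :=
        Submodule.mem_sup_right (Submodule.mem_iSup_of_mem _ (Submodule.mem_iSup_of_mem hi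
          (he _ (hr i)).1))
      rw [hl _ this, zero_smul]
      exact Submodule.zero_mem _
    · exact Submodule.smul_mem _ _ (Submodule.subset_span
        ⟨_, ⟨neg_mem_roots (hr i), fun h => hi (h𝒰.neg_mem_iff.1 h)⟩, rfl⟩)
  · rintro _ ⟨α, hα, rfl⟩
    rw [SetLike.mem_coe, Submodule.mem_dualAnnihilator]
    intro v hv
    have : regularSubspace H 𝒰 ≤ LinearMap.ker (B (e α)) := by
      refine sup_le (fun v hv => form_rootVector_cartan hBinv he hα.1 hv) ?_
      refine iSup₂_le fun β hβ v hv => ?_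
      refine form_eq_zero_of_mem_rootSpace hBinv (fun h => hα.2 ?_) (he _ hα.1).1 hv
      rw [eq_neg_of_add_eq_zero_left h]
      exact h𝒰.neg_mem _ hβ
    exact this hv

end Annihilator

end RootVectors


/-! ### Vanishing on spans of covectors -/

section Spans

variable {V : Type*} [AddCommGroup V] [Module ℂ V]

lemma eval₂_eq_zero_of_mem_span {S : Set (Module.Dual ℂ V)} {t : V ⊗[ℂ] V}
    (h : ∀ α ∈ S, ∀ β ∈ S, eval₂ α β t = 0) {α β : V →ₗ[ℂ] ℂ}
    (hα : α ∈ Submodule.span ℂ S) (hβ : β ∈ Submodule.span ℂ S) : eval₂ α β t = 0 := by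
  induction hα, hβ using Submodule.span_induction₂ with
  | mem_mem α β hα hβ => exact h α hα β hβ
  | zero_left β _ => exact eval₂_zero_left β t
  | zero_right β _ => exact eval₂_zero_right β t
  | add_left α α' β _ _ _ h h' => exact (eval₂_add_left α α' β t).trans (by rw [h, h', add_zero])
  | add_right α β β' _ _ _ h h' => exact (eval₂_add_right α β β' t).trans (by rw [h, h', add_zero])
  | smul_left c α β _ _ h => exact (eval₂_smul_left c α β t).trans (by rw [h, mul_zero])
  | smul_right c α β _ _ h => exact (eval₂_smul_right c α β t).trans (by rw [h, mul_zero])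

lemma eval₃_add_left (α α' β γ : V →ₗ[ℂ] ℂ) (t : V ⊗[ℂ] (V ⊗[ℂ] V)) :
    eval₃ (α + α') β γ t = eval₃ α β γ t + eval₃ α' β γ t := by
  simp [eval₃, TensorProduct.map_add_left]

lemma eval₃_smul_left (c : ℂ) (α β γ : V →ₗ[ℂ] ℂ) (t : V ⊗[ℂ] (V ⊗[ℂ] V)) :
    eval₃ (c • α) β γ t = c * eval₃ α β γ t := by
  simp [eval₃, TensorProduct.map_smul_left]

lemma eval₃_eq_eval₂_contract (α β γ : V →ₗ[ℂ] ℂ) (t : V ⊗[ℂ] (V ⊗[ℂ] V)) :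
    eval₃ α β γ t = eval₂ β γ (TensorProduct.lid ℂ (V ⊗[ℂ] V) (TensorProduct.map α LinearMap.id t)) := by
  induction t with
  | zero => simp
  | tmul a b => simp [eval₃]
  | add a b ha hb => rw [map_add, map_add, map_add, map_add, ha, hb]

lemma eval₃_eq_zero_of_mem_span {S : Set (Module.Dual ℂ V)} {t : V ⊗[ℂ] (V ⊗[ℂ] V)}
    (h : ∀ α ∈ S, ∀ β ∈ S, ∀ γ ∈ S, eval₃ α β γ t = 0) {α β γ : V →ₗ[ℂ] ℂ}
    (hα : α ∈ Submodule.span ℂ S) (hβ : β ∈ Submodule.span ℂ S)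
    (hγ : γ ∈ Submodule.span ℂ S) : eval₃ α β γ t = 0 := by
  induction hα using Submodule.span_induction with
  | mem α hα =>
    rw [eval₃_eq_eval₂_contract]
    exact eval₂_eq_zero_of_mem_span
      (fun β hβ γ hγ => (eval₃_eq_eval₂_contract α β γ t).symm.trans (h α hα β hβ γ hγ)) hβ hγ
  | zero => exact (by simpa using eval₃_smul_left 0 0 β γ t)
  | add α α' _ _ h h' => exact (eval₃_add_left α α' β γ t).trans (by rw [h, h', add_zero])
  | smul c α _ h => exact (eval₃_smul_left c α β γ t).trans (by rw [h, mul_zero])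

end Spans

/-! ### Invariance and the Yang–Baxter equation modulo 𝔲 -/

section Invariance

open LieAlgebra LieAlgebra.IsKilling LieModule

lemma eval₂_lie {𝔤 : Type*} [LieRing 𝔤] [LieAlgebra ℂ 𝔤] (α β : 𝔤 →ₗ[ℂ] ℂ) (u : 𝔤)
    (t : 𝔤 ⊗[ℂ] 𝔤) : eval₂ α β ⁅u, t⁆ =
      eval₂ (α ∘ₗ toEnd ℂ 𝔤 𝔤 u) β t + eval₂ α (β ∘ₗ toEnd ℂ 𝔤 𝔤 u) t := by
  induction t with
  | zero => simp
  | tmul a b => simp [TensorProduct.LieModule.lie_tmul_right, eval₂_tmul]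
  | add a b ha hb => rw [lie_add, map_add, map_add, map_add, ha, hb]; ring

variable {𝔤 : Type*} [LieRing 𝔤] [LieAlgebra ℂ 𝔤] [FiniteDimensional ℂ 𝔤]
  [LieAlgebra.IsSemisimple ℂ 𝔤] {H : LieSubalgebra ℂ 𝔤} [H.IsCartanSubalgebra]
  {B : LinearMap.BilinForm ℂ 𝔤} (hBinv : B.lieInvariant 𝔤)
  {e : Module.Dual ℂ H → 𝔤} (he : IsNormalizedRootVectors H B e)
  (hB : B.Nondegenerate) (hBsymm : B.IsSymm)
  {𝒰 : Set (Module.Dual ℂ H)} (h𝒰 : IsReductiveSet H 𝒰)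

include hBinv he hBsymm in
-- The action of u on either slot produces the same number ⟨E_α, [u, E_β]⟩ up to sign, so the
-- contributions of the invariant tensor Ω cancel.
lemma eval₂_lie_shiftedRootTensor (x : Module.Dual ℂ H → ℂ) (u : 𝔤) {α β : Module.Dual ℂ H}
    (hα : α ∈ roots H) (hβ : β ∈ roots H) :
    eval₂ (B (e α)) (B (e β)) ⁅u, shiftedRootTensor e hB x⁆ =
      (x β - x (-α)) * B (e α) ⁅u, e β⁆ := by
  rw [eval₂_lie, eval₂_shiftedRootTensor_right hBinv he hB hBsymm x _ hβ,
    eval₂_shiftedRootTensor_left hBinv he hB x _ hα]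
  have h1 : B (e β) ⁅u, e α⁆ = -B (e α) ⁅u, e β⁆ := by
    rw [form_lie_rotate hBinv hBsymm u (e α) (e β), form_lie_swap hBinv (e α) u]
  simp only [LinearMap.comp_apply, map_smul, smul_eq_mul, toEnd_apply_apply, h1]
  ring

include hBinv he hBsymm h𝒰 in
/-- `x + Ω/2` is `𝔲`-invariant modulo `𝔲`. -/
theorem SatisfiesEquations.eval₂_lie_eq_zero {x : Module.Dual ℂ H → ℂ}
    (hx : SatisfiesEquations H 𝒰 x) {u : 𝔤} (hu : u ∈ regularSubspace H 𝒰) {l l' : 𝔤 →ₗ[ℂ] ℂ}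
    (hl : l ∈ (regularSubspace H 𝒰).dualAnnihilator)
    (hl' : l' ∈ (regularSubspace H 𝒰).dualAnnihilator) :
    eval₂ l l' ⁅u, shiftedRootTensor e hB x⁆ = 0 := by
  rw [dualAnnihilator_regularSubspace hBinv he h𝒰] at hl hl'
  refine eval₂_eq_zero_of_mem_span ?_ hl hl'
  rintro _ ⟨α, hα, rfl⟩ _ ⟨β, hβ, rfl⟩
  -- By linearity u may be taken in 𝔥 or in some 𝔤_γ, and for weight reasons only α + β = 0 or α + β
  -- + γ = 0 can contribute. In the first case the coefficient vanishes identically; in the second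
  -- it is x_α + x_β.
  have hle : regularSubspace H 𝒰 ≤ LinearMap.ker
      ((eval₂ (B (e α)) (B (e β))) ∘ₗ (LieModule.toEnd ℂ 𝔤 (𝔤 ⊗[ℂ] 𝔤) :
        𝔤 →ₗ[ℂ] Module.End ℂ (𝔤 ⊗[ℂ] 𝔤)).flip (shiftedRootTensor e hB x)) := by
    refine sup_le (fun v hv => ?_) (iSup₂_le fun γ hγ v hv => ?_)
    · refine (eval₂_lie_shiftedRootTensor hBinv he hB hBsymm x v hα.1 hβ.1).trans ?_
      by_cases hαβ : α + β = 0
      · obtain rfl := eq_neg_of_add_eq_zero_left hαβ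
        rw [neg_neg, sub_self, zero_mul]
      · rw [form_lie_eq_zero hBinv (by simpa using hαβ) (he α hα.1).1
          (mem_rootSpace_zero_of_mem hv) (he β hβ.1).1, mul_zero]
    · refine (eval₂_lie_shiftedRootTensor hBinv he hB hBsymm x v hα.1 hβ.1).trans ?_
      by_cases h : α + β + γ = 0
      · rw [hx.neg α hα.1, sub_neg_eq_add, add_comm, hx.add α hα β hβ γ hγ h, zero_mul]
      · rw [form_lie_eq_zero hBinv (by rwa [add_right_comm] at h) (he α hα.1).1 hv (he β hβ.1).1,
          mul_zero]
  exact hle hu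

include hBinv he hBsymm h𝒰 in
theorem SatisfiesEquations.eval₃_CYB_eq_zero {x : Module.Dual ℂ H → ℂ}
    (hx : SatisfiesEquations H 𝒰 x) {l l' l'' : 𝔤 →ₗ[ℂ] ℂ}
    (hl : l ∈ (regularSubspace H 𝒰).dualAnnihilator)
    (hl' : l' ∈ (regularSubspace H 𝒰).dualAnnihilator)
    (hl'' : l'' ∈ (regularSubspace H 𝒰).dualAnnihilator) :
    eval₃ l l' l'' (CYB (shiftedRootTensor e hB x)) = 0 := by
  rw [dualAnnihilator_regularSubspace hBinv he h𝒰] at hl hl' hl''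
  refine eval₃_eq_zero_of_mem_span ?_ hl hl' hl''
  rintro _ ⟨α, hα, rfl⟩ _ ⟨β, hβ, rfl⟩ _ ⟨γ, hγ, rfl⟩
  rw [eval₃_CYB_shiftedRootTensor hBinv he hB hBsymm hx.neg hα.1 hβ.1 hγ.1]
  by_cases h : α + β + γ = 0
  · rw [hx.quad α hα β hβ γ hγ h]
    ring
  · rw [form_lie_eq_zero hBinv h (he α hα.1).1 (he β hβ.1).1 (he γ hγ.1).1, mul_zero]

include hBinv he in
lemma form_rootVector_mem_dualAnnihilator (h𝒰 : IsReductiveSet H 𝒰) {α : Module.Dual ℂ H}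
    (hα : α ∈ roots H \ 𝒰) : B (e α) ∈ (regularSubspace H 𝒰).dualAnnihilator := by
  rw [dualAnnihilator_regularSubspace hBinv he h𝒰]
  exact Submodule.subset_span ⟨α, hα, rfl⟩

include hBinv he h𝒰 hBsymm in
/-- `x` is odd if `x + Ω/2` has the symmetric part `Ω/2` modulo `𝔲`. -/
theorem neg_of_eval₂_add_comm {x : Module.Dual ℂ H → ℂ} (h0 : ∀ α ∈ 𝒰, x α = 0)
    (hskew : ∀ l ∈ (regularSubspace H 𝒰).dualAnnihilator,
      ∀ l' ∈ (regularSubspace H 𝒰).dualAnnihilator,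
      eval₂ l l' (shiftedRootTensor e hB x + TensorProduct.comm ℂ _ _ (shiftedRootTensor e hB x)) =
        eval₂ l l' (formTensor B hB)) : ∀ α ∈ roots H, x (-α) = -x α := by
  have hann : ∀ α ∈ roots H \ 𝒰, B (e α) ∈ (regularSubspace H 𝒰).dualAnnihilator := fun α hα =>
    form_rootVector_mem_dualAnnihilator hBinv he h𝒰 hα
  intro α hα
  by_cases hα𝒰 : α ∈ 𝒰
  · rw [h0 α hα𝒰, h0 _ (h𝒰.neg_mem α hα𝒰), neg_zero]
  · have hα' : -α ∈ roots H \ 𝒰 := ⟨neg_mem_roots hα, fun h => hα𝒰 (h𝒰.neg_mem_iff.1 h)⟩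
    have := hskew _ (hann _ hα') _ (hann α ⟨hα, hα𝒰⟩)
    rw [eval₂_add_comm_shiftedRootTensor hBinv he hB hBsymm hα, eval₂_formTensor hB hBsymm] at this
    have h1 := (he _ hα'.1).2
    rw [neg_neg] at h1
    rw [h1] at this
    linear_combination this

include hBinv he h𝒰 hBsymm in
/-- The equations hold for an odd function `x` if `x + Ω/2` is `𝔲`-invariant and solves the
classical Yang–Baxter equation modulo `𝔲`. -/
theorem satisfiesEquations_of_eval {x : Module.Dual ℂ H → ℂ} (h0 : ∀ α ∈ 𝒰, x α = 0)
    (hodd : ∀ α ∈ roots H, x (-α) = -x α)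
    (hinv : ∀ u ∈ regularSubspace H 𝒰, ∀ l ∈ (regularSubspace H 𝒰).dualAnnihilator,
      ∀ l' ∈ (regularSubspace H 𝒰).dualAnnihilator,
      eval₂ l l' ⁅u, shiftedRootTensor e hB x⁆ = 0)
    (hCYB : ∀ l ∈ (regularSubspace H 𝒰).dualAnnihilator,
      ∀ l' ∈ (regularSubspace H 𝒰).dualAnnihilator,
      ∀ l'' ∈ (regularSubspace H 𝒰).dualAnnihilator,
      eval₃ l l' l'' (CYB (shiftedRootTensor e hB x)) = 0) :
    SatisfiesEquations H 𝒰 x := by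
  have hann : ∀ α ∈ roots H \ 𝒰, B (e α) ∈ (regularSubspace H 𝒰).dualAnnihilator := fun α hα =>
    form_rootVector_mem_dualAnnihilator hBinv he h𝒰 hα
  refine ⟨h0, hodd, ?_, ?_⟩
  · intro α hα β hβ γ hγ h
    have hγ' := h𝒰.subset_roots hγ
    have := hinv (e γ) (Submodule.mem_sup_right (Submodule.mem_iSup_of_mem _
      (Submodule.mem_iSup_of_mem hγ (he _ hγ').1))) _ (hann α hα) _ (hann β hβ)
    rw [eval₂_lie_shiftedRootTensor hBinv he hB hBsymm x _ hα.1 hβ.1, hodd α hα.1] at this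
    have h1 := (mul_eq_zero.1 this).resolve_right
      (form_lie_ne_zero he hα.1 hγ' hβ.1 (by rw [← h]; abel))
    linear_combination h1
  · intro α hα β hβ γ hγ h
    have := hCYB _ (hann α hα) _ (hann β hβ) _ (hann γ hγ)
    rw [eval₃_CYB_shiftedRootTensor hBinv he hB hBsymm hodd hα.1 hβ.1 hγ.1] at this
    have h1 := (mul_eq_zero.1 this).resolve_right (form_lie_ne_zero he hα.1 hβ.1 hγ.1 h)
    linear_combination h1

include hBinv he h𝒰 hBsymm in
/-- An `𝔥`-invariant tensor coincides with some `x + Ω/2` modulo `𝔲`. -/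
theorem exists_shiftedRootTensor_of_invariant {b : 𝔤 ⊗[ℂ] 𝔤}
    (hinv : ∀ u ∈ H, ∀ l ∈ (regularSubspace H 𝒰).dualAnnihilator,
      ∀ l' ∈ (regularSubspace H 𝒰).dualAnnihilator, eval₂ l l' ⁅u, b⁆ = 0) :
    ∃ x : Module.Dual ℂ H → ℂ, (∀ α ∈ 𝒰, x α = 0) ∧
      ∀ l ∈ (regularSubspace H 𝒰).dualAnnihilator,
        ∀ l' ∈ (regularSubspace H 𝒰).dualAnnihilator,
        eval₂ l l' b = eval₂ l l' (shiftedRootTensor e hB x) := by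
  classical
  -- Against the pair ⟨E_{-α}, ·⟩, ⟨E_α, ·⟩ the tensor x + Ω/2 evaluates to x_α + 1/2, which
  -- dictates this value of x.
  refine ⟨fun α => if α ∈ 𝒰 then 0 else eval₂ (B (e (-α))) (B (e α)) b - 1 / 2,
    fun α hα => if_pos hα, fun l hl l' hl' => ?_⟩
  set x : Module.Dual ℂ H → ℂ :=
    fun α => if α ∈ 𝒰 then 0 else eval₂ (B (e (-α))) (B (e α)) b - 1 / 2 with hx
  rw [← sub_eq_zero, ← map_sub]
  have hann : ∀ α ∈ roots H \ 𝒰, B (e α) ∈ (regularSubspace H 𝒰).dualAnnihilator := fun α hα =>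
    form_rootVector_mem_dualAnnihilator hBinv he h𝒰 hα
  rw [dualAnnihilator_regularSubspace hBinv he h𝒰] at hl hl'
  refine eval₂_eq_zero_of_mem_span ?_ hl hl'
  rintro _ ⟨α, hα, rfl⟩ _ ⟨β, hβ, rfl⟩
  change eval₂ (B (e α)) (B (e β)) _ = 0
  rw [map_sub, eval₂_shiftedRootTensor_right hBinv he hB hBsymm x _ hβ.1, map_smul, smul_eq_mul]
  by_cases h : α + β = 0
  · obtain rfl := eq_neg_of_add_eq_zero_left h
    have h1 := (he _ hα.1).2
    rw [neg_neg] at h1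
    rw [h1, hx]
    simp only [if_neg hβ.2]
    ring
  · rw [form_rootVector_eq_zero hBinv he hα.1 hβ.1 h, mul_zero, sub_zero]
    -- Components of nonzero weight are killed by an element t ∈ 𝔥 on which the weight does not
    -- vanish.
    obtain ⟨t, ht⟩ : ∃ t : H, (α + β) t ≠ 0 := by
      by_contra hc
      push Not at hc
      exact h (LinearMap.ext hc)
    have key : ∀ γ ∈ roots H, B (e γ) ∘ₗ toEnd ℂ 𝔤 𝔤 (t : 𝔤) = (-γ t) • B (e γ) := by
      intro γ hγ
      ext v
      have h1 := hBinv (t : 𝔤) (e γ) v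
      have e1 : ⁅(t : 𝔤), e γ⁆ = γ t • e γ := lie_eq_smul_of_mem_rootSpace (he γ hγ).1 t
      rw [e1, map_smul] at h1
      simp only [LinearMap.comp_apply, toEnd_apply_apply, LinearMap.smul_apply, smul_eq_mul] at h1 ⊢
      linear_combination -(1 : ℂ) * (-1) * h1
    have h2 := hinv t t.2 _ (hann α hα) _ (hann β hβ)
    rw [eval₂_lie, key α hα.1, key β hβ.1, eval₂_smul_left, eval₂_smul_right] at h2
    have h3 : (α + β) t * eval₂ (B (e α)) (B (e β)) b = 0 := by
      rw [LinearMap.add_apply]; linear_combination -h2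
    exact (mul_eq_zero.1 h3).resolve_left ht

end Invariance


/-! ### Covectors along invariant fields and skew-symmetry -/

section HomogeneousSpace

variable {E : Type*} [NormedAddCommGroup E] [NormedSpace ℂ E] [FiniteDimensional ℂ E]
  {G : Type*} [Group G] [TopologicalSpace G] [ChartedSpace E G] [LieGroup 𝓘(ℂ, E) ω G]

section Covectors

variable {f f' : G → ℂ} {g : G}

lemma leftCov_congr (h : f =ᶠ[nhds g] f') : leftCov (E := E) f g = leftCov f' g :=
  LinearMap.ext fun v => LD_congr h v

lemma rightCov_congr (h : f =ᶠ[nhds g] f') : rightCov (E := E) f g = rightCov f' g :=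
  LinearMap.ext fun v => RD_congr h v

lemma leftRightBracket_congr_right
    {b ρ : GroupLieAlgebra 𝓘(ℂ, E) G ⊗[ℂ] GroupLieAlgebra 𝓘(ℂ, E) G} {k : G → ℂ}
    (h : f =ᶠ[nhds g] f') : leftRightBracket b ρ k f g = leftRightBracket b ρ k f' g := by
  rw [leftRightBracket, leftRightBracket, leftCov_congr h, rightCov_congr h]

lemma leftCov_eq (hf : HolAt E f g) : leftCov f g = dAt (F := E) (fun t => f (g * t)) (1 : G) :=
  LinearMap.ext fun v => LD_eq hf v

lemma rightCov_eq (hf : HolAt E f g) : rightCov f g = dAt (F := E) (fun t => f (t * g)) (1 : G) :=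
  LinearMap.ext fun v => RD_eq hf v

lemma leftCov_eq_rightCov_comp_Ad (hf : HolAt E f g) :
    leftCov (E := E) f g = rightCov f g ∘ₗ Ad g :=
  LinearMap.ext fun v => (RD_Ad hf v).symm

/-- Skew-symmetry of `b^L - ρ^R`. -/
lemma leftRightBracket_skew {B : LinearMap.BilinForm ℂ (GroupLieAlgebra 𝓘(ℂ, E) G)}
    (hB : B.Nondegenerate) (hBsymm : B.IsSymm)
    (hAd : ∀ (g : G) (v w : GroupLieAlgebra 𝓘(ℂ, E) G), B (Ad g v) (Ad g w) = B v w)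
    {b ρ : GroupLieAlgebra 𝓘(ℂ, E) G ⊗[ℂ] GroupLieAlgebra 𝓘(ℂ, E) G}
    (hb : b + TensorProduct.comm ℂ _ _ b = formTensor B hB)
    (hρ : ρ + TensorProduct.comm ℂ _ _ ρ = formTensor B hB)
    (hf : HolAt E f g) (hf' : HolAt E f' g) :
    leftRightBracket b ρ f f' g = -leftRightBracket b ρ f' f g := by
  -- The symmetric part of b^L - ρ^R is (Ω^L - Ω^R)/2, which vanishes because Ω is Ad-invariant.
  have h1 := congrArg (eval₂ (leftCov f g) (leftCov f' g)) hb
  have h2 := congrArg (eval₂ (rightCov f g) (rightCov f' g)) hρ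
  rw [map_add, eval₂_comm] at h1 h2
  rw [leftCov_eq_rightCov_comp_Ad hf, leftCov_eq_rightCov_comp_Ad hf',
    eval₂_formTensor_comp hB hBsymm (hAd g), ← h2] at h1
  rw [leftRightBracket, leftRightBracket, leftCov_eq_rightCov_comp_Ad hf,
    leftCov_eq_rightCov_comp_Ad hf']
  linear_combination h1

lemma Ad_comp_Ad (g h : G) : (Ad g ∘ₗ Ad h : _ →ₗ[ℂ] GroupLieAlgebra 𝓘(ℂ, E) G) = Ad (g * h) :=
  LinearMap.ext fun v => (Ad_mul_apply g h v).symm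

lemma dLeft_surjective (g : G) : Function.Surjective (dLeft (E := E) g) := by
  intro w
  obtain ⟨v, rfl⟩ := dRight_surjective g w
  refine ⟨Ad g⁻¹ v, ?_⟩
  rw [← dRight_Ad, ← Ad_mul_apply, mul_inv_cancel, Ad_one_apply]

end Covectors

section TensorExt

variable {F : Type*} [NormedAddCommGroup F] [NormedSpace ℂ F] [FiniteDimensional ℂ F]
  {X : Type*} [TopologicalSpace X] [ChartedSpace F X] [IsManifold 𝓘(ℂ, F) ω X]

lemma tensor_ext {x : X} {s t : TangentSpace 𝓘(ℂ, F) x ⊗[ℂ] TangentSpace 𝓘(ℂ, F) x}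
    (h : ∀ f f' : X → ℂ, HolAt F f x → HolAt F f' x →
      eval₂ (dAt f x) (dAt f' x) s = eval₂ (dAt f x) (dAt f' x) t) : s = t := by
  have : FiniteDimensional ℂ (TangentSpace 𝓘(ℂ, F) x) := inferInstanceAs (FiniteDimensional ℂ F)
  refine eq_of_forall_eval₂_eq fun l l' => ?_
  obtain ⟨f, hf, rfl⟩ := exists_holAt_dAt_eq x l
  obtain ⟨f', hf', rfl⟩ := exists_holAt_dAt_eq x l'
  exact h f f' hf hf'

end TensorExt

end HomogeneousSpace

/-! ### Functions on G/U pulled back to G -/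

section Quotient

universe u

variable {E : Type u} [NormedAddCommGroup E] [NormedSpace ℂ E] [FiniteDimensional ℂ E]
  {G : Type*} [Group G] [TopologicalSpace G] [ChartedSpace E G] [LieGroup 𝓘(ℂ, E) ω G]
  {U : Subgroup G}
  {F : Type*} [NormedAddCommGroup F] [NormedSpace ℂ F] [FiniteDimensional ℂ F]
  [ChartedSpace F (G ⧸ U)] [IsManifold 𝓘(ℂ, F) ω (G ⧸ U)]

/-- The pull-back of a function along `p : G → G/U`. -/
def pull (f : G ⧸ U → ℂ) : G → ℂ := fun g => f (QuotientGroup.mk g)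

variable (hp : Manifold.IsSubmersion 𝓘(ℂ, E) 𝓘(ℂ, F) ω (QuotientGroup.mk : G → G ⧸ U))

include hp

lemma contMDiffAt_proj (g : G) :
    ContMDiffAt 𝓘(ℂ, E) 𝓘(ℂ, F) ω (QuotientGroup.mk : G → G ⧸ U) g := hp.contMDiff g

lemma holAt_pull {f : G ⧸ U → ℂ} {g : G} (hf : HolAt F f (QuotientGroup.mk g)) :
    HolAt E (pull f) g := HolAt.comp (g := (QuotientGroup.mk : G → G ⧸ U)) hf (contMDiffAt_proj hp g)

lemma dAt_pull {f : G ⧸ U → ℂ} {g : G} (hf : HolAt F f (QuotientGroup.mk g)) :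
    dAt (F := E) (pull f) g = dAt (F := F) f (QuotientGroup.mk g : G ⧸ U) ∘ₗ dProj U g :=
  LinearMap.ext fun v => dAt_comp (g := (QuotientGroup.mk : G → G ⧸ U)) hf.mdifferentiableAt
    ((contMDiffAt_proj hp g).mdifferentiableAt (by simp)) v

lemma eval₂_map_dProj {f f' : G ⧸ U → ℂ} {g : G} (hf : HolAt F f (QuotientGroup.mk g))
    (hf' : HolAt F f' (QuotientGroup.mk g))
    (b ρ : GroupLieAlgebra 𝓘(ℂ, E) G ⊗[ℂ] GroupLieAlgebra 𝓘(ℂ, E) G) :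
    eval₂ (dAt (F := F) f (QuotientGroup.mk g : G ⧸ U)) (dAt f' (QuotientGroup.mk g : G ⧸ U))
      (TensorProduct.map (dProj U g) (dProj U g) (leftSubRight b ρ g)) =
      leftRightBracket b ρ (pull f) (pull f') g := by
  rw [eval₂_map, ← dAt_pull hp hf, ← dAt_pull hp hf', leftSubRight, map_sub, eval₂_map, eval₂_map]
  rfl

/-- The equation `π = π_b^ρ` in terms of brackets of functions. -/
lemma isPi_iff {b ρ : GroupLieAlgebra 𝓘(ℂ, E) G ⊗[ℂ] GroupLieAlgebra 𝓘(ℂ, E) G}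
    {π : BivectorField F (G ⧸ U)} : IsPi U ρ b π ↔ ∀ (g : G) (f f' : G ⧸ U → ℂ),
      HolAt F f (QuotientGroup.mk g) → HolAt F f' (QuotientGroup.mk g) →
        π.bracket f f' (QuotientGroup.mk g) = leftRightBracket b ρ (pull f) (pull f') g := by
  refine ⟨fun h g f f' hf hf' => ?_, fun h g => tensor_ext fun f f' hf hf' => ?_⟩
  · rw [← eval₂_map_dProj hp hf hf', ← h g]
    rfl
  · rw [eval₂_map_dProj hp hf hf', ← h g f f' hf hf']
    rfl

/-- Near x the map is y ↦ p(g s(y)), with s a local holomorphic section of p. -/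
lemma contMDiffAt_smul_left (g : G) (x : G ⧸ U) :
    ContMDiffAt 𝓘(ℂ, F) 𝓘(ℂ, F) ω (fun y : G ⧸ U => g • y) x := by
  obtain ⟨a, rfl⟩ := QuotientGroup.mk_surjective x
  obtain ⟨s, hs, hsa, hps⟩ := exists_local_section (hp.isSubmersionAt a)
  have h1 : ContMDiffAt 𝓘(ℂ, F) 𝓘(ℂ, F) ω (fun y : G ⧸ U => (QuotientGroup.mk (g * s y) : G ⧸ U))
      (QuotientGroup.mk a) :=
    (contMDiffAt_proj hp _).comp (QuotientGroup.mk a : G ⧸ U)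
      (ContMDiffAt.comp (I' := 𝓘(ℂ, E)) (QuotientGroup.mk a : G ⧸ U) (g := fun t : G => g * t)
        (contMDiffAt_mul_left' g _) hs)
  refine h1.congr_of_eventuallyEq (hps.mono fun y hy => ?_)
  change g • y = g • (QuotientGroup.mk (s y) : G ⧸ U)
  rw [hy]

lemma contMDiffAt_smul_right (g : G) (x : G ⧸ U) :
    ContMDiffAt 𝓘(ℂ, E) 𝓘(ℂ, F) ω (fun t : G => t • x) g := by
  obtain ⟨a, rfl⟩ := QuotientGroup.mk_surjective x
  exact (contMDiffAt_proj hp _).comp g (contMDiffAt_mul_right' a g)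

/-- The multiplicativity equation in terms of brackets of functions. -/
lemma multiplicative_iff {πG : ∀ g : G, TangentSpace 𝓘(ℂ, E) g ⊗[ℂ] TangentSpace 𝓘(ℂ, E) g}
    {π : BivectorField F (G ⧸ U)} {g : G} {x : G ⧸ U} :
    π.toFun (g • x) = TensorProduct.map (dAct g x) (dAct g x) (π.toFun x) +
      TensorProduct.map (dOrbit g x) (dOrbit g x) (πG g) ↔
    ∀ f f' : G ⧸ U → ℂ, HolAt F f (g • x) → HolAt F f' (g • x) →
      π.bracket f f' (g • x) = π.bracket (fun y => f (g • y)) (fun y => f' (g • y)) x +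
        eval₂ (dAt (fun t => f (t • x)) g) (dAt (fun t => f' (t • x)) g) (πG g) := by
  have key : ∀ f f' : G ⧸ U → ℂ, HolAt F f (g • x) → HolAt F f' (g • x) →
      eval₂ (dAt f (g • x)) (dAt f' (g • x)) (TensorProduct.map (dAct g x) (dAct g x) (π.toFun x) +
        TensorProduct.map (dOrbit g x) (dOrbit g x) (πG g)) =
      π.bracket (fun y => f (g • y)) (fun y => f' (g • y)) x +
        eval₂ (dAt (fun t => f (t • x)) g) (dAt (fun t => f' (t • x)) g) (πG g) := by
    have h1 : ∀ f : G ⧸ U → ℂ, HolAt F f (g • x) →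
        dAt f (g • x) ∘ₗ dAct g x = dAt (fun y => f (g • y)) x := fun f hf =>
      LinearMap.ext fun v => (dAt_comp (g := fun y : G ⧸ U => g • y) hf.mdifferentiableAt
        ((contMDiffAt_smul_left hp g x).mdifferentiableAt (by simp)) v).symm
    have h2 : ∀ f : G ⧸ U → ℂ, HolAt F f (g • x) →
        dAt f (g • x) ∘ₗ dOrbit (E := E) g x = dAt (fun t => f (t • x)) g := fun f hf =>
      LinearMap.ext fun v => (dAt_comp (g := fun t : G => t • x) hf.mdifferentiableAt
        ((contMDiffAt_smul_right hp g x).mdifferentiableAt (by simp)) v).symm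
    intro f f' hf hf'
    rw [map_add, eval₂_map, eval₂_map, h1 f hf, h1 f' hf', h2 f hf, h2 f' hf']
    rfl
  refine ⟨fun h f f' hf hf' => ?_, fun h => tensor_ext fun f f' hf hf' => ?_⟩
  · rw [← key f f' hf hf', ← h]
    rfl
  · rw [key f f' hf hf', ← h f f' hf hf']
    rfl

end Quotient


/-! ### The isotropy action and the covectors vanishing on 𝔲 -/

section Isotropy

universe u

variable {E : Type u} [NormedAddCommGroup E] [NormedSpace ℂ E] [FiniteDimensional ℂ E]
  {G : Type*} [Group G] [TopologicalSpace G] [ChartedSpace E G] [LieGroup 𝓘(ℂ, E) ω G]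

/-- The link between Ad(U)-invariance and 𝔲-invariance of b: along u the pairing with Ad_x b changes
at the rate of the pairing with Ad_x [u, b]. -/
lemma eval₂_apply_Ad_const {l l' : GroupLieAlgebra 𝓘(ℂ, E) G →ₗ[ℂ] ℂ}
    (b : GroupLieAlgebra 𝓘(ℂ, E) G ⊗[ℂ] GroupLieAlgebra 𝓘(ℂ, E) G) (g : G) :
    HolAt E (fun x : G => eval₂ (l ∘ₗ Ad x) (l' ∘ₗ Ad x) b) g ∧
    ∀ u : GroupLieAlgebra 𝓘(ℂ, E) G, LD u (fun x : G => eval₂ (l ∘ₗ Ad x) (l' ∘ₗ Ad x) b) g =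
      eval₂ (l ∘ₗ Ad g) (l' ∘ₗ Ad g) ⁅u, b⁆ := by
  obtain ⟨n, a, a', rfl⟩ := exists_sum_tmul b
  have e : (fun x : G => eval₂ (l ∘ₗ Ad x) (l' ∘ₗ Ad x) (∑ i, a i ⊗ₜ[ℂ] a' i)) =
      fun x => ∑ i, l (Ad x (a i)) * l' (Ad x (a' i)) := by
    funext x
    simp [eval₂_tmul]
  have h : ∀ i ∈ Finset.univ, HolAt E (fun x : G => l (Ad x (a i)) * l' (Ad x (a' i))) g :=
    fun i _ => (holAt_apply_Ad l _ g).mul (holAt_apply_Ad l' _ g)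
  rw [e]
  refine ⟨HolAt.sum h, fun u => (dAt_sum h _).trans ?_⟩
  rw [lie_sum, map_sum]
  refine Finset.sum_congr rfl fun i _ => ?_
  rw [dAt_mul (holAt_apply_Ad l _ g) (holAt_apply_Ad l' _ g), TensorProduct.LieModule.lie_tmul_right,
    map_add, eval₂_tmul, eval₂_tmul]
  exact congrArg₂ (· + ·) (congrArg (· * _) (LD_apply_Ad l u (a i) g))
    (congrArg (_ * ·) (LD_apply_Ad l' u (a' i) g))

variable {U : Subgroup G}
  {F : Type*} [NormedAddCommGroup F] [NormedSpace ℂ F] [FiniteDimensional ℂ F]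
  [ChartedSpace F (G ⧸ U)] [IsManifold 𝓘(ℂ, F) ω (G ⧸ U)]
  (hp : Manifold.IsSubmersion 𝓘(ℂ, E) 𝓘(ℂ, F) ω (QuotientGroup.mk : G → G ⧸ U))

include hp

lemma HolAt.comp_smul {f : G ⧸ U → ℂ} {g : G} {x : G ⧸ U} (hf : HolAt F f (g • x)) :
    HolAt F (fun y => f (g • y)) x :=
  HolAt.comp (g := fun y : G ⧸ U => g • y) hf (contMDiffAt_smul_left hp g x)

lemma HolAt.comp_orbit {f : G ⧸ U → ℂ} {g : G} {x : G ⧸ U} (hf : HolAt F f (g • x)) :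
    HolAt E (fun t : G => f (t • x)) g :=
  HolAt.comp (g := fun t : G => t • x) hf (contMDiffAt_smul_right hp g x)

lemma leftCov_pull_mul {f : G ⧸ U → ℂ} {g a : G} (hf : HolAt F f (QuotientGroup.mk (g * a))) :
    leftCov (E := E) (pull f) (g * a) = leftCov (pull fun y => f (g • y)) a := by
  have h : HolAt F (fun y => f (g • y)) (QuotientGroup.mk a) := HolAt.comp_smul hp hf
  rw [leftCov_eq (holAt_pull hp hf), leftCov_eq (holAt_pull hp h)]
  congr 1
  funext t
  change f (QuotientGroup.mk (g * a * t)) = f (QuotientGroup.mk (g * (a * t)))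
  rw [mul_assoc]

/-- Both sides differentiate f(g t a) at t = 1: left translation by g of the orbit map is right
translation by a of the shifted function. -/
lemma leftCov_orbit {f : G ⧸ U → ℂ} {g a : G} (hf : HolAt F f (QuotientGroup.mk (g * a))) :
    leftCov (E := E) (fun t => f (t • (QuotientGroup.mk a : G ⧸ U))) g =
      rightCov (pull fun y => f (g • y)) a := by
  have h : HolAt F (fun y => f (g • y)) (QuotientGroup.mk a) := HolAt.comp_smul hp hf
  have hf' : HolAt F f (g • (QuotientGroup.mk a : G ⧸ U)) := hf
  rw [leftCov_eq (HolAt.comp_orbit hp hf'), rightCov_eq (holAt_pull hp h)]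
  congr 1
  funext t
  change f (QuotientGroup.mk (g * t * a)) = f (QuotientGroup.mk (g * (t * a)))
  rw [mul_assoc]

lemma rightCov_orbit {f : G ⧸ U → ℂ} {g a : G} (hf : HolAt F f (QuotientGroup.mk (g * a))) :
    rightCov (E := E) (fun t => f (t • (QuotientGroup.mk a : G ⧸ U))) g =
      rightCov (pull f) (g * a) := by
  have hf' : HolAt F f (g • (QuotientGroup.mk a : G ⧸ U)) := hf
  rw [rightCov_eq (HolAt.comp_orbit hp hf'), rightCov_eq (holAt_pull hp hf)]
  congr 1
  funext t
  change f (QuotientGroup.mk (t * g * a)) = f (QuotientGroup.mk (t * (g * a)))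
  rw [mul_assoc]

omit hp in
lemma mk_mul_of_mem' (g : G) {u : G} (hu : u ∈ U) :
    (QuotientGroup.mk (g * u) : G ⧸ U) = QuotientGroup.mk g := QuotientGroup.mk_mul_of_mem g hu

lemma rightCov_pull_mul_mem {f : G ⧸ U → ℂ} {g u : G} (hf : HolAt F f (QuotientGroup.mk g))
    (hu : u ∈ U) : rightCov (E := E) (pull f) (g * u) = rightCov (pull f) g := by
  have h : HolAt F f (QuotientGroup.mk (g * u)) := by rwa [mk_mul_of_mem' g hu]
  rw [rightCov_eq (holAt_pull hp hf), rightCov_eq (holAt_pull hp h)]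
  congr 1
  funext t
  simp only [pull]
  rw [← mul_assoc, mk_mul_of_mem' _ hu]

/-- A pulled-back function is right U-invariant, so its right covector is the same at g and gu.
Passing to left covectors introduces Ad_g and Ad_{gu} = Ad_g Ad_u. -/
lemma leftCov_pull_mul_mem {f : G ⧸ U → ℂ} {g u : G} (hf : HolAt F f (QuotientGroup.mk g))
    (hu : u ∈ U) : leftCov (E := E) (pull f) (g * u) = leftCov (pull f) g ∘ₗ Ad u := by
  have h : HolAt F f (QuotientGroup.mk (g * u)) := by rwa [mk_mul_of_mem' g hu]
  rw [leftCov_eq_rightCov_comp_Ad (holAt_pull hp hf), leftCov_eq_rightCov_comp_Ad (holAt_pull hp h),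
    rightCov_pull_mul_mem hp hf hu, LinearMap.comp_assoc, Ad_comp_Ad]

lemma leftRightBracket_pull_mul_mem
    {b ρ : GroupLieAlgebra 𝓘(ℂ, E) G ⊗[ℂ] GroupLieAlgebra 𝓘(ℂ, E) G} {f f' : G ⧸ U → ℂ} {g u : G}
    (hf : HolAt F f (QuotientGroup.mk g)) (hf' : HolAt F f' (QuotientGroup.mk g)) (hu : u ∈ U) :
    leftRightBracket b ρ (pull f) (pull f') (g * u) =
      eval₂ (leftCov (pull f) g ∘ₗ Ad u) (leftCov (pull f') g ∘ₗ Ad u) b -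
        eval₂ (rightCov (pull f) g) (rightCov (pull f') g) ρ := by
  rw [leftRightBracket, leftCov_pull_mul_mem hp hf hu, leftCov_pull_mul_mem hp hf' hu,
    rightCov_pull_mul_mem hp hf hu, rightCov_pull_mul_mem hp hf' hu]

variable {𝔲 : Submodule ℂ (GroupLieAlgebra 𝓘(ℂ, E) G)} (hU : IsConnectedWithLieAlgebra U 𝔲)

include hU

/-- The vector v is the velocity of a curve in U, along which the pulled-back function is constant.
-/
lemma dAt_pull_one_eq_zero {f : G ⧸ U → ℂ} (hf : HolAt F f (QuotientGroup.mk (1 : G)))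
    {v : GroupLieAlgebra 𝓘(ℂ, E) G} (hv : v ∈ 𝔲) : dAt (F := E) (pull f) 1 v = 0 := by
  obtain ⟨c, hc, hc1, hcU, hcv⟩ := (hU.mem_iff v).1 hv
  have hfc : HolAt E (pull f) (c 0) := by rw [hc1]; exact holAt_pull hp hf
  have h1 := dAt_comp hfc.mdifferentiableAt (hc.mdifferentiableAt (by simp)) (1 : ℂ)
  have h2 : (fun z => pull f (c z)) =ᶠ[nhds 0] fun _ => f (QuotientGroup.mk (1 : G)) := by
    filter_upwards [hcU] with z hz
    have := mk_mul_of_mem' (U := U) 1 hz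
    rw [one_mul] at this
    simp only [pull, this]
  have h3 : dAt (F := ℂ) (fun z => pull f (c z)) 0 (1 : ℂ) = 0 := by
    rw [dAt_congr h2, dAt_const]
    rfl
  have h4 := h1.symm.trans h3
  rw [hcv] at h4
  have key : ∀ g : G, g = 1 → dAt (F := E) (pull f) g v = 0 → dAt (F := E) (pull f) 1 v = 0 := by
    rintro g rfl h
    exact h
  exact key _ hc1 h4

lemma leftCov_pull_mem_dualAnnihilator {f : G ⧸ U → ℂ} {g : G}
    (hf : HolAt F f (QuotientGroup.mk g)) : leftCov (E := E) (pull f) g ∈ 𝔲.dualAnnihilator := by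
  rw [Submodule.mem_dualAnnihilator]
  intro v hv
  have hf1 : HolAt F f (g • (QuotientGroup.mk (1 : G) : G ⧸ U)) := by
    have : g • (QuotientGroup.mk (1 : G) : G ⧸ U) = QuotientGroup.mk g := by
      change (QuotientGroup.mk (g * 1) : G ⧸ U) = _
      rw [mul_one]
    rwa [this]
  rw [leftCov_eq (holAt_pull hp hf)]
  exact dAt_pull_one_eq_zero hp hU (HolAt.comp_smul hp hf1) hv

/-- A vector in the kernel of dp is the velocity of a holomorphic curve in the fibre through 1, and
this fibre is U. -/
lemma mem_of_mfderiv_eq_zero {v : E}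
    (hv : mfderiv 𝓘(ℂ, E) 𝓘(ℂ, F) (QuotientGroup.mk : G → G ⧸ U) 1 v = (0 : F)) :
    (v : GroupLieAlgebra 𝓘(ℂ, E) G) ∈ 𝔲 := by
  obtain ⟨c, hc, hc1, hcU, hcv⟩ := exists_curve_of_mfderiv_eq_zero (hp.isSubmersionAt 1)
    hp.contMDiff hv
  refine (hU.mem_iff v).2 ⟨c, hc, hc1, hcU.mono fun z hz => ?_, hcv⟩
  have := QuotientGroup.eq.1 hz.symm
  simpa using this

omit hU in
lemma mfderiv_proj_surjective (g : G) :
    Function.Surjective (mfderiv 𝓘(ℂ, E) 𝓘(ℂ, F) (QuotientGroup.mk : G → G ⧸ U) g : E → F) := by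
  intro w
  obtain ⟨s, hs, hs1, hps⟩ := exists_local_section (hp.isSubmersionAt g)
  have h1 := mfderiv_comp (I := 𝓘(ℂ, F)) (I' := 𝓘(ℂ, E)) (I'' := 𝓘(ℂ, F))
    (QuotientGroup.mk g : G ⧸ U) (g := (QuotientGroup.mk : G → G ⧸ U)) (f := s)
    ((contMDiffAt_proj hp _).mdifferentiableAt (by simp)) (hs.mdifferentiableAt (by simp))
  have h2 : ((QuotientGroup.mk : G → G ⧸ U) ∘ s) =ᶠ[nhds (QuotientGroup.mk g)] id := hps
  have h3 := congrArg (fun L : F →L[ℂ] F => L w) (h1.symm.trans (h2.mfderiv_eq.trans mfderiv_id))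
  refine ⟨mfderiv 𝓘(ℂ, F) 𝓘(ℂ, E) s (QuotientGroup.mk g) w, ?_⟩
  rw [hs1] at h3
  exact h3

omit hU in
lemma leftCov_pull_apply {f : G ⧸ U → ℂ} {g : G} (hf : HolAt F f (QuotientGroup.mk g))
    (v : GroupLieAlgebra 𝓘(ℂ, E) G) :
    leftCov (pull f) g v = dAt (F := F) f (QuotientGroup.mk g : G ⧸ U) (dProj U g (dLeft g v)) :=
  congrArg (fun L => L (dLeft g v)) (dAt_pull hp hf)

/-- Every covector that vanishes on `𝔲` is induced by a covector on `G/U`. -/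
lemma exists_leftCov_pull_eq {l : GroupLieAlgebra 𝓘(ℂ, E) G →ₗ[ℂ] ℂ}
    (hl : l ∈ 𝔲.dualAnnihilator) : ∃ f : G ⧸ U → ℂ, HolAt F f (QuotientGroup.mk (1 : G)) ∧
      leftCov (pull f) 1 = l := by
  let D : E →ₗ[ℂ] F :=
    (mfderiv 𝓘(ℂ, E) 𝓘(ℂ, F) (QuotientGroup.mk : G → G ⧸ U) 1 : E →L[ℂ] F).toLinearMap
  -- With σ a linear right inverse D of dp, the covector l ∘ σ on G/U pulls back to l, because w -
  -- σ(D w) lies in the kernel of D and hence in 𝔲.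
  obtain ⟨σ, hσ⟩ := D.exists_rightInverse_of_surjective
    (LinearMap.range_eq_top.2 (mfderiv_proj_surjective hp 1))
  let l₀ : E →ₗ[ℂ] ℂ := l
  obtain ⟨f, hf, hfl⟩ := exists_holAt_dAt_eq (E := F) (QuotientGroup.mk (1 : G) : G ⧸ U) (l₀ ∘ₗ σ)
  refine ⟨f, hf, LinearMap.ext fun v => ?_⟩
  have h1 : leftCov (pull f) 1 v = l₀ (σ (D v)) := by
    refine (leftCov_pull_apply hp hf v).trans ?_
    rw [hfl]
    exact congrArg (fun w : E => l₀ (σ (D w))) (dLeft_one_apply v)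
  rw [h1]
  have h2 : ∀ w : E, l₀ (w - σ (D w)) = 0 := fun w => by
    refine (Submodule.mem_dualAnnihilator l).1 hl _ (mem_of_mfderiv_eq_zero hp hU ?_)
    change D (w - σ (D w)) = 0
    rw [map_sub, sub_eq_zero]
    exact (congrArg (fun L : F →ₗ[ℂ] F => L (D w)) hσ).symm
  have h3 : ∀ w : E, l₀ (σ (D w)) = l₀ w := fun w => by
    rw [← sub_eq_zero, ← neg_sub, ← map_sub, h2, neg_zero]
  exact h3 v

/-- Every covector that vanishes on 𝔲 comes from a function on G/U. After translation to g it
factors through dp, so it kills v, and v lies in the double annihilator of 𝔲. -/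
lemma mem_of_dProj_dLeft_eq_zero {g : G} {v : GroupLieAlgebra 𝓘(ℂ, E) G}
    (hv : dProj (F := F) U g (dLeft g v) = 0) : v ∈ 𝔲 := by
  rw [← Subspace.dualAnnihilator_dualCoannihilator_eq (W := 𝔲), Submodule.mem_dualCoannihilator]
  intro l hl
  obtain ⟨f, hf, rfl⟩ := exists_leftCov_pull_eq hp hU hl
  have hf' : HolAt F f (QuotientGroup.mk (g⁻¹ * g)) := by rwa [inv_mul_cancel]
  have h1 := leftCov_pull_mul hp hf'
  rw [inv_mul_cancel] at h1
  rw [h1, leftCov_pull_apply hp (HolAt.comp_smul hp hf')]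
  exact (congrArg _ hv).trans (map_zero _)

/-- An `𝔲`-invariant tensor modulo `𝔲` is `Ad(U)`-invariant modulo `𝔲`. -/
theorem eval₂_comp_Ad_of_invariant {b : GroupLieAlgebra 𝓘(ℂ, E) G ⊗[ℂ] GroupLieAlgebra 𝓘(ℂ, E) G}
    (hinv : ∀ u ∈ 𝔲, ∀ l ∈ 𝔲.dualAnnihilator, ∀ l' ∈ 𝔲.dualAnnihilator, eval₂ l l' ⁅u, b⁆ = 0)
    {l l' : GroupLieAlgebra 𝓘(ℂ, E) G →ₗ[ℂ] ℂ} (hl : l ∈ 𝔲.dualAnnihilator)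
    (hl' : l' ∈ 𝔲.dualAnnihilator) {g : G} (hg : g ∈ U) :
    eval₂ (l ∘ₗ Ad g) (l' ∘ₗ Ad g) b = eval₂ l l' b := by
  -- Since Ad(U) preserves the annihilator of 𝔲, the derivatives of q along the fibre vanish at
  -- every point of U. Thus q is locally constant on U, and constant because U is connected.
  set q : G → ℂ := fun x => eval₂ (l ∘ₗ Ad x) (l' ∘ₗ Ad x) b with hq
  have hAd : ∀ l ∈ 𝔲.dualAnnihilator, ∀ y ∈ U, l ∘ₗ Ad y ∈ 𝔲.dualAnnihilator := by
    intro l hl y hy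
    obtain ⟨f, hf, rfl⟩ := exists_leftCov_pull_eq hp hU hl
    rw [← leftCov_pull_mul_mem hp hf hy]
    refine leftCov_pull_mem_dualAnnihilator hp hU ?_
    rwa [mk_mul_of_mem' 1 hy]
  have hmk : ∀ y z : G, y ∈ U →
      ((QuotientGroup.mk z : G ⧸ U) = QuotientGroup.mk y ↔ z ∈ U) := fun y z hy => by
    rw [QuotientGroup.eq]
    exact ⟨fun h => by simpa using U.inv_mem ((U.mul_mem_cancel_right hy).1 h),
      fun h => U.mul_mem (U.inv_mem h) hy⟩
  have hloc : IsLocallyConstant fun y : U => q y := by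
    rw [IsLocallyConstant.iff_eventually_eq]
    intro y
    have h1 := eventually_eq_of_dAt_eq_zero_of_mfderiv (hp.isSubmersionAt (y : G)) hp.contMDiff
      (q := q) (fun z => (eval₂_apply_Ad_const b z).1) ?_
    · have h2 := (continuous_subtype_val (p := (· ∈ U))).continuousAt.eventually h1
      exact h2.mono fun z hz => hz ((hmk y z y.2).2 z.2)
    · intro z hz w hw
      have hzU : z ∈ U := (hmk y z y.2).1 hz
      obtain ⟨v, hv⟩ := dLeft_surjective (E := E) z w
      have hvw : dProj (F := F) U z (dLeft z v) = 0 := (congrArg (dProj (F := F) U z) hv).trans hw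
      have hv𝔲 := mem_of_dProj_dLeft_eq_zero hp hU hvw
      refine (congrArg (dAt (F := E) q z) hv).symm.trans ?_
      exact ((eval₂_apply_Ad_const b z).2 v).trans
        (hinv v hv𝔲 _ (hAd l hl z hzU) _ (hAd l' hl' z hzU))
  have : PreconnectedSpace U := Subtype.preconnectedSpace hU.connected.isPreconnected
  have h3 := hloc.apply_eq_of_preconnectedSpace ⟨g, hg⟩ 1
  have h4 : (Ad (1 : G) : GroupLieAlgebra 𝓘(ℂ, E) G →ₗ[ℂ] _) = LinearMap.id :=
    LinearMap.ext Ad_one_apply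
  change q g = q 1 at h3
  simp only [hq, h4, LinearMap.comp_id] at h3
  exact h3

omit hp in
/-- An `Ad(U)`-invariant tensor modulo `𝔲` is `𝔲`-invariant modulo `𝔲`. -/
theorem eval₂_lie_eq_zero_of_comp_Ad
    {b : GroupLieAlgebra 𝓘(ℂ, E) G ⊗[ℂ] GroupLieAlgebra 𝓘(ℂ, E) G}
    {l l' : GroupLieAlgebra 𝓘(ℂ, E) G →ₗ[ℂ] ℂ}
    (hinv : ∀ g ∈ U, eval₂ (l ∘ₗ Ad g) (l' ∘ₗ Ad g) b = eval₂ l l' b)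
    {u : GroupLieAlgebra 𝓘(ℂ, E) G} (hu : u ∈ 𝔲) : eval₂ l l' ⁅u, b⁆ = 0 := by
  -- The invariance is differentiated along a curve in U with velocity u at 1.
  obtain ⟨c, hc, hc1, hcU, hcv⟩ := (hU.mem_iff u).1 hu
  set q : G → ℂ := fun x => eval₂ (l ∘ₗ Ad x) (l' ∘ₗ Ad x) b with hq
  have h1 := dAt_comp (f := q) (eval₂_apply_Ad_const b (c 0)).1.mdifferentiableAt
    (hc.mdifferentiableAt (by simp)) (1 : ℂ)
  have h2 : (fun z => q (c z)) =ᶠ[nhds 0] fun _ => eval₂ l l' b :=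
    hcU.mono fun z hz => hinv _ hz
  have h3 : dAt (F := ℂ) (fun z => q (c z)) 0 (1 : ℂ) = 0 := by
    rw [dAt_congr h2, dAt_const]
    rfl
  have h4 := h1.symm.trans h3
  rw [hcv] at h4
  have key : ∀ g : G, g = 1 → dAt (F := E) q g u = 0 → dAt (F := E) q 1 u = 0 := by
    rintro g rfl h
    exact h
  have h5 := ((eval₂_apply_Ad_const (l := l) (l' := l') b 1).2 u).symm.trans
    ((LD_one u q).trans (key _ hc1 h4))
  have h6 : (Ad (1 : G) : GroupLieAlgebra 𝓘(ℂ, E) G →ₗ[ℂ] _) = LinearMap.id :=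
    LinearMap.ext Ad_one_apply
  rwa [h6] at h5

end Isotropy


/-! ### The bivector fields π_b^ρ: multiplicativity, Schouten bracket, existence -/

section Classification

universe u

variable {E : Type u} [NormedAddCommGroup E] [NormedSpace ℂ E] [FiniteDimensional ℂ E]
  {G : Type*} [Group G] [TopologicalSpace G] [ChartedSpace E G] [LieGroup 𝓘(ℂ, E) ω G]
  {U : Subgroup G}
  {F : Type*} [NormedAddCommGroup F] [NormedSpace ℂ F] [FiniteDimensional ℂ F]
  [ChartedSpace F (G ⧸ U)] [IsManifold 𝓘(ℂ, F) ω (G ⧸ U)]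
  (hp : Manifold.IsSubmersion 𝓘(ℂ, E) 𝓘(ℂ, F) ω (QuotientGroup.mk : G → G ⧸ U))
  {b ρ : GroupLieAlgebra 𝓘(ℂ, E) G ⊗[ℂ] GroupLieAlgebra 𝓘(ℂ, E) G}
  {π : BivectorField F (G ⧸ U)}

lemma BivectorField.bracket_skew {X : Type*} [TopologicalSpace X] [ChartedSpace F X]
    (π : BivectorField F X) (f f' : X → ℂ) (x : X) : π.bracket f f' x = -π.bracket f' f x := by
  have h := congrArg (eval₂ (dAt f x) (dAt f' x)) (π.skew x)
  rw [eval₂_comm, map_neg] at h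
  simp only [BivectorField.bracket]
  rw [h, neg_neg]

lemma leftCov_one_eq_rightCov_one {f : G → ℂ} (hf : HolAt E f 1) :
    leftCov (E := E) f 1 = rightCov f 1 := by
  rw [leftCov_eq_rightCov_comp_Ad hf]
  exact LinearMap.ext fun v => congrArg (rightCov (E := E) f 1) (Ad_one_apply v)

include hp

/-- The infinitesimal action is the projection of right-invariant fields, so testing φ_X on
functions is testing φ^R on their pull-backs. -/
lemma dAt_comp_dOrbitOne {f : G ⧸ U → ℂ} {g : G} (hf : HolAt F f (QuotientGroup.mk g)) :
    dAt (F := F) f (QuotientGroup.mk g : G ⧸ U) ∘ₗ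
      dOrbitOne (E := E) (QuotientGroup.mk g : G ⧸ U) = rightCov (pull f) g := by
  rw [rightCov_eq (holAt_pull hp hf)]
  have hf' : HolAt F f ((1 : G) • (QuotientGroup.mk g : G ⧸ U)) := by rwa [one_smul]
  have h := dAt_comp (g := fun t : G => t • (QuotientGroup.mk g : G ⧸ U)) hf'.mdifferentiableAt
    ((contMDiffAt_smul_right hp 1 _).mdifferentiableAt (by simp))
  refine LinearMap.ext fun v => Eq.trans ?_ (h v).symm
  have key : ∀ y : G ⧸ U, y = QuotientGroup.mk g → ∀ w : F,
      dAt (F := F) f (QuotientGroup.mk g : G ⧸ U) w = dAt (F := F) f y w := by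
    rintro y rfl w
    rfl
  exact key _ (one_smul G _) _

/-- The Schouten bracket of `π_b^ρ`. -/
theorem halfSchoutenSquareEq_iff (hπ : IsPi U ρ b π)
    (hskew : ∀ (f g : G → ℂ) x, HolAt E f x → HolAt E g x →
      leftRightBracket b ρ f g x = -leftRightBracket b ρ g f x) :
    HalfSchoutenSquareEq π (inducedTrivector (-CYB ρ)) ↔
      ∀ (g : G) (f f' f'' : G ⧸ U → ℂ), HolAt F f (QuotientGroup.mk g) →
        HolAt F f' (QuotientGroup.mk g) → HolAt F f'' (QuotientGroup.mk g) →
        eval₃ (leftCov (E := E) (pull f) g) (leftCov (pull f') g) (leftCov (pull f'') g)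
          (CYB b) = 0 := by
  rw [isPi_iff hp] at hπ
  have hbr : ∀ (g : G) (f f' f'' : G ⧸ U → ℂ), HolAt F f (QuotientGroup.mk g) →
      HolAt F f' (QuotientGroup.mk g) → HolAt F f'' (QuotientGroup.mk g) →
      π.bracket f (π.bracket f' f'') (QuotientGroup.mk g) =
        leftRightBracket b ρ (pull f) (leftRightBracket b ρ (pull f') (pull f'')) g := by
    intro g f f' f'' hf hf' hf''
    refine (hπ g f _ hf (π.holomorphic _ f' f'' hf' hf'')).trans ?_
    refine leftRightBracket_congr_right ?_
    have hc := (contMDiffAt_proj hp g).continuousAt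
    filter_upwards [hc.eventually hf'.eventually, hc.eventually hf''.eventually] with y h1 h2
      using hπ y f' f'' h1 h2
  -- The Jacobiator on the group is CYB(b)^L - CYB(ρ)^R, and its second part is φ_X for φ = -CYB(ρ).
  -- The remaining term is the obstruction.
  have hJ : ∀ (g : G) (f f' f'' : G ⧸ U → ℂ), HolAt F f (QuotientGroup.mk g) →
      HolAt F f' (QuotientGroup.mk g) → HolAt F f'' (QuotientGroup.mk g) →
      π.bracket f (π.bracket f' f'') (QuotientGroup.mk g) +
        π.bracket f' (π.bracket f'' f) (QuotientGroup.mk g) +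
        π.bracket f'' (π.bracket f f') (QuotientGroup.mk g) =
      eval₃ (leftCov (E := E) (pull f) g) (leftCov (pull f') g) (leftCov (pull f'') g) (CYB b) +
        eval₃ (dAt (F := F) f (QuotientGroup.mk g : G ⧸ U)) (dAt f' (QuotientGroup.mk g : G ⧸ U))
          (dAt f'' (QuotientGroup.mk g : G ⧸ U))
          (inducedTrivector (-CYB ρ) (QuotientGroup.mk g : G ⧸ U)) := by
    intro g f f' f'' hf hf' hf''
    rw [hbr g f f' f'' hf hf' hf'', hbr g f' f'' f hf' hf'' hf, hbr g f'' f f' hf'' hf hf',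
      leftRightBracket_jacobiator hskew (holAt_pull hp hf) (holAt_pull hp hf')
        (holAt_pull hp hf''), inducedTrivector, eval₃_map, dAt_comp_dOrbitOne hp hf,
      dAt_comp_dOrbitOne hp hf', dAt_comp_dOrbitOne hp hf'', map_neg, sub_eq_add_neg]
  refine ⟨fun h g f f' f'' hf hf' hf'' => ?_, fun h x f f' f'' hf hf' hf'' => ?_⟩
  · have h1 := hJ g f f' f'' hf hf' hf''
    rw [h _ f f' f'' hf hf' hf''] at h1
    exact right_eq_add.1 h1
  · obtain ⟨g, rfl⟩ := QuotientGroup.mk_surjective x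
    rw [hJ g f f' f'' hf hf' hf'', h g f f' f'' hf hf' hf'', zero_add]

lemma eval₂_dAt_orbit {f f' : G ⧸ U → ℂ} {g a : G} (hf : HolAt F f (QuotientGroup.mk (g * a)))
    (hf' : HolAt F f' (QuotientGroup.mk (g * a))) :
    eval₂ (dAt (F := E) (fun t => f (t • (QuotientGroup.mk a : G ⧸ U))) g)
      (dAt (fun t => f' (t • (QuotientGroup.mk a : G ⧸ U))) g) (leftSubRight ρ ρ g) =
      eval₂ (rightCov (pull fun y => f (g • y)) a) (rightCov (pull fun y => f' (g • y)) a) ρ -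
        eval₂ (rightCov (pull f) (g * a)) (rightCov (pull f') (g * a)) ρ := by
  rw [← leftCov_orbit hp hf, ← leftCov_orbit hp hf', ← rightCov_orbit hp hf,
    ← rightCov_orbit hp hf', leftSubRight, map_sub, eval₂_map, eval₂_map]
  rfl

/-- `π_b^ρ` is multiplicative. -/
theorem IsPi.multiplicative (hπ : IsPi U ρ b π) (g : G) (x : G ⧸ U) :
    π.toFun (g • x) = TensorProduct.map (dAct g x) (dAct g x) (π.toFun x) +
      TensorProduct.map (dOrbit g x) (dOrbit g x) (leftSubRight ρ ρ g) := by
  obtain ⟨a, rfl⟩ := QuotientGroup.mk_surjective x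
  rw [isPi_iff hp] at hπ
  refine (multiplicative_iff hp).2 fun f f' hf hf' => ?_
  rw [eval₂_dAt_orbit hp hf hf', hπ a _ _ (HolAt.comp_smul hp hf) (HolAt.comp_smul hp hf')]
  refine (hπ (g * a) f f' hf hf').trans ?_
  rw [leftRightBracket, leftRightBracket, leftCov_pull_mul hp hf, leftCov_pull_mul hp hf']
  ring

/-- A multiplicative bivector field is of the form `π_b^ρ`. -/
theorem exists_isPi_of_multiplicative
    (hπ : ∀ (g : G) (x : G ⧸ U), π.toFun (g • x) =
      TensorProduct.map (dAct g x) (dAct g x) (π.toFun x) +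
      TensorProduct.map (dOrbit g x) (dOrbit g x) (leftSubRight ρ ρ g)) :
    ∃ b, IsPi U ρ b π := by
  -- The tensor a is any lift of π at the base point. At 1 left- and right-invariant fields agree,
  -- so b - ρ = a is needed, that is, b = a + ρ; multiplicativity determines π elsewhere.
  obtain ⟨a, ha⟩ := TensorProduct.map_surjective
    (g := dProj (E := E) (F := F) U 1) (g' := dProj (E := E) (F := F) U 1)
    (mfderiv_proj_surjective hp 1) (mfderiv_proj_surjective hp 1) (π.toFun (QuotientGroup.mk 1))
  have ha' : ∀ f f' : G ⧸ U → ℂ, HolAt F f (QuotientGroup.mk (1 : G)) →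
      HolAt F f' (QuotientGroup.mk (1 : G)) → π.bracket f f' (QuotientGroup.mk (1 : G)) =
        eval₂ (leftCov (E := E) (pull f) 1) (leftCov (pull f') 1) a := by
    intro f f' hf hf'
    have h1 : ∀ f : G ⧸ U → ℂ, HolAt F f (QuotientGroup.mk (1 : G)) →
        leftCov (E := E) (pull f) 1 =
          dAt (F := F) f (QuotientGroup.mk (1 : G) : G ⧸ U) ∘ₗ dProj U 1 := fun f hf => by
      rw [← dAt_pull hp hf]
      exact LinearMap.ext fun v => LD_one v (pull f)
    rw [h1 f hf, h1 f' hf']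
    refine Eq.trans ?_ (eval₂_map _ _ _ _)
    rw [ha]
    rfl
  refine ⟨a + ρ, (isPi_iff hp).2 fun g f f' hf hf' => ?_⟩
  rw [← mul_one g] at hf hf' ⊢
  have h1 := (multiplicative_iff hp).1 (hπ g (QuotientGroup.mk (1 : G))) f f' hf hf'
  refine h1.trans ?_
  rw [eval₂_dAt_orbit hp hf hf', ha' _ _ (HolAt.comp_smul hp hf) (HolAt.comp_smul hp hf'),
    leftRightBracket, leftCov_pull_mul hp hf, leftCov_pull_mul hp hf', map_add,
    leftCov_one_eq_rightCov_one (holAt_pull hp (HolAt.comp_smul hp hf)),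
    leftCov_one_eq_rightCov_one (holAt_pull hp (HolAt.comp_smul hp hf'))]
  ring

variable {𝔲 : Submodule ℂ (GroupLieAlgebra 𝓘(ℂ, E) G)} (hU : IsConnectedWithLieAlgebra U 𝔲)

include hU

/-- `π_b^ρ` depends on `b` modulo `𝔲` only. -/
lemma IsPi.congr (hπ : IsPi U ρ b π) {b' : GroupLieAlgebra 𝓘(ℂ, E) G ⊗[ℂ] GroupLieAlgebra 𝓘(ℂ, E) G}
    (h : ∀ l ∈ 𝔲.dualAnnihilator, ∀ l' ∈ 𝔲.dualAnnihilator, eval₂ l l' b = eval₂ l l' b') :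
    IsPi U ρ b' π := by
  rw [isPi_iff hp] at hπ ⊢
  intro g f f' hf hf'
  rw [hπ g f f' hf hf', leftRightBracket, leftRightBracket,
    h _ (leftCov_pull_mem_dualAnnihilator hp hU hf) _ (leftCov_pull_mem_dualAnnihilator hp hU hf')]

/-- The points 1 and g ∈ U have the same image in G/U. Comparing the two formulas for π there gives
Ad(U)-invariance of b modulo 𝔲, which is then differentiated. -/
lemma IsPi.eval₂_lie_eq_zero (hπ : IsPi U ρ b π) {u : GroupLieAlgebra 𝓘(ℂ, E) G} (hu : u ∈ 𝔲)
    {l l' : GroupLieAlgebra 𝓘(ℂ, E) G →ₗ[ℂ] ℂ} (hl : l ∈ 𝔲.dualAnnihilator)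
    (hl' : l' ∈ 𝔲.dualAnnihilator) : eval₂ l l' ⁅u, b⁆ = 0 := by
  refine eval₂_lie_eq_zero_of_comp_Ad hU (fun g hg => ?_) hu
  obtain ⟨f, hf, rfl⟩ := exists_leftCov_pull_eq hp hU hl
  obtain ⟨f', hf', rfl⟩ := exists_leftCov_pull_eq hp hU hl'
  rw [isPi_iff hp] at hπ
  have e := mk_mul_of_mem' (U := U) 1 hg
  have h1 := hπ (1 * g) f f' (by rwa [e]) (by rwa [e])
  rw [leftRightBracket_pull_mul_mem hp hf hf' hg, e, hπ 1 f f' hf hf', leftRightBracket] at h1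
  linear_combination -h1

/-- At the base point left and right covectors coincide, so skew-symmetry of π says that b - ρ is
skew modulo 𝔲. -/
lemma IsPi.eval₂_add_comm (hπ : IsPi U ρ b π) {l l' : GroupLieAlgebra 𝓘(ℂ, E) G →ₗ[ℂ] ℂ}
    (hl : l ∈ 𝔲.dualAnnihilator) (hl' : l' ∈ 𝔲.dualAnnihilator) :
    eval₂ l l' (b + TensorProduct.comm ℂ _ _ b) =
      eval₂ l l' (ρ + TensorProduct.comm ℂ _ _ ρ) := by
  obtain ⟨f, hf, rfl⟩ := exists_leftCov_pull_eq hp hU hl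
  obtain ⟨f', hf', rfl⟩ := exists_leftCov_pull_eq hp hU hl'
  rw [isPi_iff hp] at hπ
  have h1 := π.bracket_skew f f' (QuotientGroup.mk (1 : G))
  rw [hπ 1 f f' hf hf', hπ 1 f' f hf' hf, leftRightBracket, leftRightBracket,
    ← leftCov_one_eq_rightCov_one (holAt_pull hp hf),
    ← leftCov_one_eq_rightCov_one (holAt_pull hp hf')] at h1
  rw [map_add, map_add, eval₂_comm, eval₂_comm]
  linear_combination h1

/-- If `b` is `𝔲`-invariant modulo `𝔲`, then `π_b^ρ` is a well defined holomorphic bivector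
field. -/
theorem exists_isPi
    (hskew : ∀ (f g : G → ℂ) x, HolAt E f x → HolAt E g x →
      leftRightBracket b ρ f g x = -leftRightBracket b ρ g f x)
    (hinv : ∀ u ∈ 𝔲, ∀ l ∈ 𝔲.dualAnnihilator, ∀ l' ∈ 𝔲.dualAnnihilator, eval₂ l l' ⁅u, b⁆ = 0) :
    ∃ π : BivectorField F (G ⧸ U), IsPi U ρ b π := by
  -- The value at x is defined through one representative a. Any other is a u with u ∈ U, and
  -- Ad(U)-invariance of b modulo 𝔲 shows that it gives the same result.
  have hex : ∀ x : G ⧸ U, ∃ t : TangentSpace 𝓘(ℂ, F) x ⊗[ℂ] TangentSpace 𝓘(ℂ, F) x,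
      ∀ g : G, (QuotientGroup.mk g : G ⧸ U) = x → ∀ f f' : G ⧸ U → ℂ, HolAt F f x →
        HolAt F f' x → eval₂ (dAt f x) (dAt f' x) t =
          leftRightBracket b ρ (pull f) (pull f') g := by
    intro x
    obtain ⟨a, rfl⟩ := QuotientGroup.mk_surjective x
    refine ⟨TensorProduct.map (dProj U a) (dProj U a) (leftSubRight b ρ a), ?_⟩
    intro g hg f f' hf hf'
    rw [eval₂_map_dProj hp hf hf']
    have hu : a⁻¹ * g ∈ U := QuotientGroup.eq.1 hg.symm
    have h1 := leftRightBracket_pull_mul_mem hp (b := b) (ρ := ρ) hf hf' hu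
    rw [mul_inv_cancel_left] at h1
    rw [h1, eval₂_comp_Ad_of_invariant hp hU hinv (leftCov_pull_mem_dualAnnihilator hp hU hf)
      (leftCov_pull_mem_dualAnnihilator hp hU hf') hu]
    rfl
  choose t ht using hex
  refine ⟨⟨t, fun x => ?_, fun x f f' hf hf' => ?_⟩, (isPi_iff hp).2 fun g f f' hf hf' =>
    ht _ g rfl f f' hf hf'⟩
  · obtain ⟨a, rfl⟩ := QuotientGroup.mk_surjective x
    refine tensor_ext fun f f' hf hf' => ?_
    rw [eval₂_comm, map_neg, ht _ a rfl f f' hf hf', ht _ a rfl f' f hf' hf,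
      hskew _ _ _ (holAt_pull hp hf') (holAt_pull hp hf)]
  · obtain ⟨a, rfl⟩ := QuotientGroup.mk_surjective x
    -- Near x the bracket on G/U is the bracket on G composed with a local section, hence
    -- holomorphic.
    obtain ⟨s, hs, hsa, hps⟩ := exists_local_section (hp.isSubmersionAt a)
    have h1 : HolAt E (leftRightBracket b ρ (pull f) (pull f')) (s (QuotientGroup.mk a)) := by
      rw [hsa]
      exact (holAt_pull hp hf).leftRightBracket (holAt_pull hp hf')
    refine (h1.comp hs).congr ?_
    filter_upwards [hps, hf.eventually, hf'.eventually] with y hy hfy hfy'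
    exact ht y (s y) hy f f' hfy hfy'

end Classification

end QuasiPoisson

end

theorem mainTheorem3
    {E : Type*} [NormedAddCommGroup E] [NormedSpace ℂ E] [FiniteDimensional ℂ E]
    {G : Type*} [Group G] [TopologicalSpace G] [ChartedSpace E G] [LieGroup 𝓘(ℂ, E) ω G]
    [LieAlgebra.IsSemisimple ℂ (GroupLieAlgebra 𝓘(ℂ, E) G)]
    (H : LieSubalgebra ℂ (GroupLieAlgebra 𝓘(ℂ, E) G)) [H.IsCartanSubalgebra]
    (B : LinearMap.BilinForm ℂ (GroupLieAlgebra 𝓘(ℂ, E) G))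
    (hB : B.Nondegenerate) (hBsymm : B.IsSymm)
    (hBinv : B.lieInvariant (GroupLieAlgebra 𝓘(ℂ, E) G))
    (hG : ConnectedSpace G ∨ ∀ (g : G) (v w : GroupLieAlgebra 𝓘(ℂ, E) G),
      B (QuasiPoisson.Ad g v) (QuasiPoisson.Ad g w) = B v w)
    (𝒰 : Set (Module.Dual ℂ H)) (h𝒰 : QuasiPoisson.IsReductiveSet H 𝒰)
    (e : Module.Dual ℂ H → GroupLieAlgebra 𝓘(ℂ, E) G)
    (he : QuasiPoisson.IsNormalizedRootVectors H B e)
    (U : Subgroup G)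
    (hU : QuasiPoisson.IsConnectedWithLieAlgebra U (QuasiPoisson.regularSubspace H 𝒰))
    {F : Type*} [NormedAddCommGroup F] [NormedSpace ℂ F] [FiniteDimensional ℂ F]
    [ChartedSpace F (G ⧸ U)] [IsManifold 𝓘(ℂ, F) ω (G ⧸ U)]
    (hp : Manifold.IsSubmersion 𝓘(ℂ, E) 𝓘(ℂ, F) ω (QuotientGroup.mk : G → G ⧸ U))
    (ρ : GroupLieAlgebra 𝓘(ℂ, E) G ⊗[ℂ] GroupLieAlgebra 𝓘(ℂ, E) G)
    (hρ : ρ + TensorProduct.comm ℂ _ _ ρ = QuasiPoisson.formTensor B hB) :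
    (∀ x : Module.Dual ℂ H → ℂ,
      QuasiPoisson.SatisfiesEquations H 𝒰 x ↔ QuasiPoisson.IsCothFunction H 𝒰 x) ∧
    (∀ π : QuasiPoisson.BivectorField F (G ⧸ U),
      QuasiPoisson.IsQuasiPoissonSpace (QuasiPoisson.leftSubRight ρ ρ) (-QuasiPoisson.CYB ρ) π →
        ∃ x : Module.Dual ℂ H → ℂ, QuasiPoisson.IsCothFunction H 𝒰 x ∧
          QuasiPoisson.IsPi U ρ (QuasiPoisson.rootTensor H e x +
            (1 / 2 : ℂ) • QuasiPoisson.formTensor B hB) π) ∧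
    (∀ x : Module.Dual ℂ H → ℂ, QuasiPoisson.IsCothFunction H 𝒰 x →
      ∃ π : QuasiPoisson.BivectorField F (G ⧸ U),
        QuasiPoisson.IsQuasiPoissonSpace (QuasiPoisson.leftSubRight ρ ρ) (-QuasiPoisson.CYB ρ) π ∧
          QuasiPoisson.IsPi U ρ (QuasiPoisson.rootTensor H e x +
            (1 / 2 : ℂ) • QuasiPoisson.formTensor B hB) π) := by
  have hAd : ∀ (g : G) (v w : GroupLieAlgebra 𝓘(ℂ, E) G),
      B (QuasiPoisson.Ad g v) (QuasiPoisson.Ad g w) = B v w := by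
    rcases hG with hG | hG
    · exact QuasiPoisson.form_Ad_of_connected B hBinv
    · exact hG
  have hodd_skew : ∀ x : Module.Dual ℂ H → ℂ, (∀ α ∈ QuasiPoisson.roots H, x (-α) = -x α) →
      ∀ (f g : G → ℂ) y, QuasiPoisson.HolAt E f y → QuasiPoisson.HolAt E g y →
        QuasiPoisson.leftRightBracket (QuasiPoisson.shiftedRootTensor e hB x) ρ f g y =
          -QuasiPoisson.leftRightBracket (QuasiPoisson.shiftedRootTensor e hB x) ρ g f y :=
    fun x hx f g y hf hg => QuasiPoisson.leftRightBracket_skew hB hBsymm hAd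
      (QuasiPoisson.shiftedRootTensor_add_comm hB hBsymm hx) hρ hf hg
  have hpart : ∀ x : Module.Dual ℂ H → ℂ,
      QuasiPoisson.SatisfiesEquations H 𝒰 x ↔ QuasiPoisson.IsCothFunction H 𝒰 x :=
    QuasiPoisson.satisfiesEquations_iff_isCothFunction h𝒰
  refine ⟨hpart, fun π hπ => ?_, fun x hx => ?_⟩
  -- The b supplied by multiplicativity is arbitrary modulo 𝔲. Its 𝔥-invariance allows it to be
  -- replaced by some x + Ω/2 without changing π.
  · obtain ⟨b, hb⟩ := QuasiPoisson.exists_isPi_of_multiplicative hp hπ.multiplicative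
    obtain ⟨x, hx0, hxb⟩ := QuasiPoisson.exists_shiftedRootTensor_of_invariant hBinv he hB hBsymm
      h𝒰 (b := b) fun u hu l hl l' hl' =>
        hb.eval₂_lie_eq_zero hp hU (Submodule.mem_sup_left hu) hl hl'
    have hπx := hb.congr hp hU hxb
    have hodd := QuasiPoisson.neg_of_eval₂_add_comm hBinv he hB hBsymm h𝒰 hx0
      fun l hl l' hl' => (hπx.eval₂_add_comm hp hU hl hl').trans (by rw [hρ])
    have hS := (QuasiPoisson.halfSchoutenSquareEq_iff hp hπx (hodd_skew x hodd)).1 hπ.schouten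
    refine ⟨x, (hpart x).1 (QuasiPoisson.satisfiesEquations_of_eval hBinv he hB hBsymm h𝒰 hx0 hodd
      (fun u hu l hl l' hl' => hπx.eval₂_lie_eq_zero hp hU hu hl hl')
      fun l hl l' hl' l'' hl'' => ?_), hπx⟩
    -- Any three covectors vanishing on 𝔲 come from functions near the base point, so the Schouten
    -- condition at that single point gives the full Yang–Baxter equation modulo 𝔲.
    obtain ⟨f, hf, rfl⟩ := QuasiPoisson.exists_leftCov_pull_eq hp hU hl
    obtain ⟨f', hf', rfl⟩ := QuasiPoisson.exists_leftCov_pull_eq hp hU hl'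
    obtain ⟨f'', hf'', rfl⟩ := QuasiPoisson.exists_leftCov_pull_eq hp hU hl''
    exact hS 1 f f' f'' hf hf' hf''
  · have hx' := (hpart x).2 hx
    obtain ⟨π, hπ⟩ := QuasiPoisson.exists_isPi hp hU (hodd_skew x hx'.neg)
      fun u hu l hl l' hl' => hx'.eval₂_lie_eq_zero hBinv he hB hBsymm h𝒰 hu hl hl'
    refine ⟨π, ⟨hπ.multiplicative hp, (QuasiPoisson.halfSchoutenSquareEq_iff hp hπ
      (hodd_skew x hx'.neg)).2 fun g f f' f'' hf hf' hf'' => ?_⟩, hπ⟩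
    exact hx'.eval₃_CYB_eq_zero hBinv he hB hBsymm h𝒰
      (QuasiPoisson.leftCov_pull_mem_dualAnnihilator hp hU hf)
      (QuasiPoisson.leftCov_pull_mem_dualAnnihilator hp hU hf')
      (QuasiPoisson.leftCov_pull_mem_dualAnnihilator hp hU hf'')
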